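/- **Setting.** Let $\mathcal C$ be a category of "spaces" with finite products and terminal object $pt$, in which for every $X$ and $n\ge 0$ the symmetric product $p_n\colon X^n\to X^{(n)}=X^n/\Sigma_n$ exists (the categorical quotient of $X^n$ by the permutation action of $\Sigma_n$). For a space $Z$ let $k\colon Z\to pt$ be the constant morphism. Assume given: 1. a covariant pseudofunctor $X\mapsto A(X)$, $f\mapsto f_*$ on $\mathcal C$ with values in pseudo-abelian (Karoubian) $\mathbb Q$-linear additive categories and additive functors; 2. for all $X$ and $n$, an exterior product functor $\boxtimes^n\colon A(X)^{n}\to A(X^n)$ such that, for every $M\in A(X)$, the object $M^{\boxtimes n}$ carries a $\Sigma_n$-equivariant structure, i.e. isomorphisms $\varphi_g\colon g_*M^{\boxtimes n}\to M^{\boxtimes n}$ ($g\in\Sigma_n$) with $\varphi_1=\mathrm{id}$ and $\varphi_{gh}=\varphi_g\circ g_*(\varphi_h)$, up to the structure isomorphisms of the pseudofunctor; 3. a $\mathbb Q$-linear symmetric monoidal structure $\otimes$ on $A(pt)$; 4. for all $X$, $n$ and $M\in A(X)$, a $\Sigma_n$-equivariant isomorphism $k_*(M^{\boxtimes n})\simeq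 (k_*M)^{\otimes n}$ in $A(pt)$, where $\Sigma_n$ acts on the left through 2 and on the right through the symmetry of $\otimes$. For an additive category $B$, let $\bar K_0(B)$ be the Grothendieck group of the monoid of isomorphism classes of objects under $\oplus$; so $\bar K_0(A(pt))$ is a commutative ring with product induced by $\otimes$. A *pre-lambda structure* on a commutative ring $R$ is a group homomorphism $\sigma_t\colon (R,+)\to (R[[t]],\cdot)$, $\sigma_t(a)=1+a\,t+\sum_{n\ge2}\sigma_n(a)t^n$. Put $\lambda_t:=\sigma_{-t}^{-1}$. The associated *Adams operations* $\Psi_r\colon R\to R$ ($r\ge1$) are defined by $$\lambda_t(a)^{-1}\cdot\frac{d}{dt}\lambda_t(a)=\sum_{r\ge1}(-1)^{r-1}\Psi_r(a)\,t^{r-1}.$$ For a space $X$ and $M\in A(X)$, the equivariant structure of $M^{\boxtimes r}$ gives an action of $\Sigma_r$ on $p_{r*}M^{\boxtimes r}$ in $A(X^{(r)})$. Writing $A_{\Sigma_r}(X^{(r)})$ for the category of objects of $A(X^{(r)})$ with a $\Sigma_r$-action, the decomposition $$\bar K_0(A_{\Sigma_r}(X^{(r)}))\simeq \bar K_0(A(X^{(r)}))\otimes_{\mathbb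 Z}\mathrm{Rep}_{\mathbb Q}(\Sigma_r)$$ is given by $[V]\mapsto\sum_\lambda [S_\lambda(V)]\otimes[V_\lambda]$, where $V_\lambda=\mathbb Q[\Sigma_r]e_\lambda$ (with $e_\lambda$ a primitive idempotent) runs over the irreducible rational representations of $\Sigma_r$ and $S_\lambda(V)=e_\lambda V$ is the corresponding Schur functor. For an $r$-cycle $g\in\Sigma_r$ with trace homomorphism $tr(g)\colon\mathrm{Rep}_{\mathbb Q}(\Sigma_r)\to\mathbb Z$, define $$\Psi_r(M):=(\mathrm{id}\otimes tr(g))\big([p_{r*}M^{\boxtimes r}]\big)\in\bar K_0(A(X^{(r)})).$$ **Proposition.** There is a unique pre-lambda structure on $\bar K_0(A(pt))$ with $$\sigma_t([V])=1+\sum_{n\ge1}[(V^{\otimes n})^{\Sigma_n}]\,t^n\qquad\text{for all objects }V\text{ of }A(pt).$$ Let $\Psi_r$ ($r\ge1$) be its Adams operations. Then for every space $X$, every $M\in A(X)$, every $r\ge1$ and every $r$-cycle $g\in\Sigma_r$ used to define $\Psi_r(M)$, $$\Psi_r([k_*M])=k_*(\Psi_r(M))\qquad\text{in }\bar K_0(A(pt)),$$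 where on the right $k_*\colon\bar K_0(A(X^{(r)}))\to\bar K_0(A(pt))$ is induced by the constant morphism $k\colon X^{(r)}\to pt$. -/

import Mathlib

open CategoryTheory CategoryTheory.Limits MonoidalCategory

universe v u v₁ u₁ v₂ u₂

noncomputable section

set_option linter.unusedSectionVars false

namespace SymProd

section K0

variable (C : Type u) [Category.{v} C]

/-- The set of isomorphism classes of objects of a category. -/
def IsoClass : Type u := Quotient (isIsomorphicSetoid C)

variable {C}

/-- The isomorphism class of an object. -/
def IsoClass.mk (X : C) : IsoClass C := Quotient.mk (isIsomorphicSetoid C) X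

theorem IsoClass.sound {X Y : C} (e : X ≅ Y) : IsoClass.mk X = IsoClass.mk Y :=
  Quotient.sound (s := isIsomorphicSetoid C) ⟨e⟩

theorem IsoClass.ind {P : IsoClass C → Prop} (h : ∀ X : C, P (IsoClass.mk X)) (x : IsoClass C) :
    P x :=
  Quotient.ind (s := isIsomorphicSetoid C) h x

variable [Preadditive C] [HasZeroObject C] [HasBinaryBiproducts C]

open scoped ZeroObject

instance : Add (IsoClass C) :=
  ⟨Quotient.map₂ (sa := isIsomorphicSetoid C) (sb := isIsomorphicSetoid C)
    (sc := isIsomorphicSetoid C) (fun X Y => X ⊞ Y)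
    (fun _ _ ⟨e⟩ _ _ ⟨f⟩ => ⟨biprod.mapIso e f⟩)⟩

instance : Zero (IsoClass C) := ⟨IsoClass.mk (0 : C)⟩

/-- Isomorphism classes of objects of an additive category form an abelian monoid under `⊕`. -/
instance : AddCommMonoid (IsoClass C) where
  add_assoc := by
    intro a b c
    induction a using IsoClass.ind
    induction b using IsoClass.ind
    induction c using IsoClass.ind
    exact IsoClass.sound (biprod.associator _ _ _)
  zero_add := by
    intro a
    induction a using IsoClass.ind
    exact IsoClass.sound (isoZeroBiprod (isZero_zero C)).symm
  add_zero := by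
    intro a
    induction a using IsoClass.ind
    exact IsoClass.sound (isoBiprodZero (isZero_zero C)).symm
  add_comm := by
    intro a b
    induction a using IsoClass.ind
    induction b using IsoClass.ind
    exact IsoClass.sound (biprod.braiding _ _)
  nsmul := nsmulRec

theorem IsoClass.mk_add (X Y : C) : IsoClass.mk X + IsoClass.mk Y = IsoClass.mk (X ⊞ Y) := rfl

theorem IsoClass.mk_zero : (0 : IsoClass C) = IsoClass.mk (0 : C) := rfl

variable (C) in
/-- The Grothendieck group `K̄₀(C)` of an additive category with respect to direct sums, i.e.
the group completion of the abelian monoid of isomorphism classes of objects. -/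
def K0 : Type u := Algebra.GrothendieckAddGroup (IsoClass C)

instance : AddCommGroup (K0 C) :=
  inferInstanceAs (AddCommGroup (Algebra.GrothendieckAddGroup (IsoClass C)))

/-- The canonical monoid homomorphism from isomorphism classes to the Grothendieck group. -/
def K0.ofClass : IsoClass C →+ K0 C := Algebra.GrothendieckAddGroup.of

/-- The class `[X]` of an object in the Grothendieck group. -/
def K0.of (X : C) : K0 C := K0.ofClass (IsoClass.mk X)

/-- The universal property of the Grothendieck group. -/
def K0.lift {B : Type*} [AddCommGroup B] (f : IsoClass C →+ B) : K0 C →+ B :=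
  Algebra.GrothendieckAddGroup.lift f

theorem K0.lift_ofClass {B : Type*} [AddCommGroup B] (f : IsoClass C →+ B) (x : IsoClass C) :
    K0.lift f (K0.ofClass x) = f x :=
  DFunLike.congr_fun (Algebra.GrothendieckAddGroup.lift.symm_apply_apply f) x

theorem K0.hom_ext {B : Type*} [AddCommGroup B] {f g : K0 C →+ B}
    (h : ∀ x, f (K0.ofClass x) = g (K0.ofClass x)) : f = g :=
  Algebra.GrothendieckAddGroup.lift.symm.injective (AddMonoidHom.ext h)

variable {D : Type u₁} [Category.{v₁} D] [Preadditive D] [HasZeroObject D] [HasBinaryBiproducts D]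

/-- The homomorphism of Grothendieck groups induced by an additive functor,
`[X] ↦ [F(X)]`. -/
def K0.map (F : C ⥤ D) [F.Additive] : K0 C →+ K0 D :=
  K0.lift
    { toFun := Quotient.lift (s := isIsomorphicSetoid C) (fun X => K0.of (F.obj X))
        (fun _ _ ⟨e⟩ => congrArg K0.ofClass (IsoClass.sound (F.mapIso e)))
      map_zero' := by
        refine (congrArg K0.ofClass (IsoClass.sound ?_)).trans (map_zero (K0.ofClass (C := D)))
        exact F.mapZeroObject
      map_add' := by
        intro a b
        induction a using IsoClass.ind with | _ X
        induction b using IsoClass.ind with | _ Y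
        have := preservesBinaryBiproducts_of_preservesBiproducts F
        exact (congrArg K0.ofClass (IsoClass.sound (F.mapBiprod X Y))).trans
          (map_add (K0.ofClass (C := D)) (IsoClass.mk (F.obj X)) (IsoClass.mk (F.obj Y))) }

theorem K0.map_of (F : C ⥤ D) [F.Additive] (X : C) : K0.map F (K0.of X) = K0.of (F.obj X) :=
  K0.lift_ofClass _ _

end K0

section K0Ring

variable {T : Type u} [Category.{v} T] [Preadditive T] [HasZeroObject T] [HasBinaryBiproducts T]
  [MonoidalCategory T] [SymmetricCategory T] [MonoidalPreadditive T]

/-- For a symmetric monoidal additive category, the tensor product makes the monoid of isomorphism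
classes into a commutative semiring. -/
instance : CommSemiring (IsoClass T) where
  mul := Quotient.map₂ (sa := isIsomorphicSetoid T) (sb := isIsomorphicSetoid T)
    (sc := isIsomorphicSetoid T) (fun X Y => X ⊗ Y)
    (fun _ _ ⟨e⟩ _ _ ⟨f⟩ => ⟨e ⊗ᵢ f⟩)
  one := IsoClass.mk (𝟙_ T)
  mul_assoc := by
    intro a b c
    induction a using IsoClass.ind
    induction b using IsoClass.ind
    induction c using IsoClass.ind
    exact IsoClass.sound (α_ _ _ _)
  one_mul := by
    intro a
    induction a using IsoClass.ind
    exact IsoClass.sound (λ_ _)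
  mul_one := by
    intro a
    induction a using IsoClass.ind
    exact IsoClass.sound (ρ_ _)
  mul_comm := by
    intro a b
    induction a using IsoClass.ind
    induction b using IsoClass.ind
    exact IsoClass.sound (β_ _ _)
  left_distrib := by
    intro a b c
    induction a using IsoClass.ind with | _ X
    induction b using IsoClass.ind
    induction c using IsoClass.ind
    have := preservesBinaryBiproducts_of_preservesBiproducts (tensorLeft X)
    exact IsoClass.sound ((tensorLeft X).mapBiprod _ _)
  right_distrib := by
    intro a b c
    induction a using IsoClass.ind
    induction b using IsoClass.ind
    induction c using IsoClass.ind with | _ X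
    have := preservesBinaryBiproducts_of_preservesBiproducts (tensorRight X)
    exact IsoClass.sound ((tensorRight X).mapBiprod _ _)
  zero_mul := by
    intro a
    induction a using IsoClass.ind with | _ X
    exact IsoClass.sound (tensorRight X).mapZeroObject
  mul_zero := by
    intro a
    induction a using IsoClass.ind with | _ X
    exact IsoClass.sound (tensorLeft X).mapZeroObject

/-- The biadditive extension to the Grothendieck group of the product `[X] · [Y] = [X ⊗ Y]`. -/
def K0.mulHom : K0 T →+ K0 T →+ K0 T :=
  K0.lift
    { toFun := fun x => K0.lift (K0.ofClass.comp (AddMonoidHom.mulLeft x))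
      map_zero' := by
        apply K0.hom_ext
        intro y
        simp [K0.lift_ofClass]
      map_add' := by
        intro a b
        apply K0.hom_ext
        intro y
        simp [K0.lift_ofClass, add_mul] }

instance : Mul (K0 T) := ⟨fun x y => K0.mulHom x y⟩

instance : One (K0 T) := ⟨K0.of (𝟙_ T)⟩

theorem K0.mul_def (x y : K0 T) : x * y = K0.mulHom x y := rfl

theorem K0.ofClass_mul (x y : IsoClass T) :
    K0.ofClass x * K0.ofClass y = K0.ofClass (x * y) := by
  rw [K0.mul_def, K0.mulHom, K0.lift_ofClass]
  exact K0.lift_ofClass _ _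

theorem K0.induction {P : K0 T → Prop} (h : ∀ x y, P (K0.ofClass x - K0.ofClass y)) (x : K0 T) :
    P x := by
  have key : ∃ a b : IsoClass T, x = K0.ofClass a - K0.ofClass b := by
    obtain ⟨⟨a, b⟩, hab⟩ := (AddLocalization.addMonoidOf (⊤ : AddSubmonoid (IsoClass T))).surj x
    exact ⟨a, b, eq_sub_of_add_eq hab⟩
  obtain ⟨a, b, rfl⟩ := key
  exact h a b

/-- The commutative ring `K̄₀(T)` of a symmetric monoidal additive category. -/
instance : CommRing (K0 T) where
  left_distrib a b c := map_add (K0.mulHom a) b c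
  right_distrib a b c := by simp [K0.mul_def]
  zero_mul a := by simp [K0.mul_def]
  mul_zero a := by simp [K0.mul_def]
  mul_assoc a b c := by
    have h : ∀ x y z : IsoClass T, K0.mulHom (K0.mulHom (K0.ofClass x) (K0.ofClass y))
        (K0.ofClass z) = K0.mulHom (K0.ofClass x) (K0.mulHom (K0.ofClass y) (K0.ofClass z)) := by
      intro x y z
      simp only [← K0.mul_def, K0.ofClass_mul, mul_assoc]
    simp only [K0.mul_def]
    induction a using K0.induction
    induction b using K0.induction
    induction c using K0.induction
    simp only [map_sub, AddMonoidHom.sub_apply, h]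
  one_mul a := by
    simp only [K0.mul_def]
    have h : ∀ x : IsoClass T, K0.mulHom (1 : K0 T) (K0.ofClass x) = K0.ofClass x := fun x =>
      (K0.ofClass_mul 1 x).trans (congrArg K0.ofClass (one_mul x))
    induction a using K0.induction
    simp only [map_sub, h]
  mul_one a := by
    simp only [K0.mul_def]
    have h : ∀ x : IsoClass T, K0.mulHom (K0.ofClass x) (1 : K0 T) = K0.ofClass x := fun x =>
      (K0.ofClass_mul x 1).trans (congrArg K0.ofClass (mul_one x))
    induction a using K0.induction
    simp only [map_sub, AddMonoidHom.sub_apply, h]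
  mul_comm a b := by
    have h : ∀ x y : IsoClass T, K0.mulHom (K0.ofClass x) (K0.ofClass y) =
        K0.mulHom (K0.ofClass y) (K0.ofClass x) := by
      intro x y
      simp only [← K0.mul_def, K0.ofClass_mul, mul_comm]
    simp only [K0.mul_def]
    induction a using K0.induction with | _ a₁ a₂
    induction b using K0.induction with | _ b₁ b₂
    simp only [map_sub, AddMonoidHom.sub_apply, h _ a₁, h _ a₂]
    abel
  neg_add_cancel := neg_add_cancel
  zsmul := zsmulRec

end K0Ring

section TensorPower

variable {T : Type u} [Category.{v} T] [MonoidalCategory T]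

/-- The tensor power `V^{⊗ n}`, with `V^{⊗ 0} = 𝟙` and `V^{⊗ (n+1)} = V ⊗ V^{⊗ n}`. -/
def tensorPow (V : T) : ℕ → T
  | 0 => 𝟙_ T
  | n + 1 => V ⊗ tensorPow V n

variable [SymmetricCategory T]

/-- The exchange of the first two factors of `V ⊗ (V ⊗ W)`. -/
def swapFront (V W : T) : V ⊗ (V ⊗ W) ⟶ V ⊗ (V ⊗ W) :=
  (α_ V V W).inv ≫ (β_ V V).hom ▷ W ≫ (α_ V V W).hom

theorem swapFront_swapFront (V W : T) : swapFront V W ≫ swapFront V W = 𝟙 _ := by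
  simp [swapFront, ← comp_whiskerRight_assoc]

theorem swapFront_natural (V : T) {W W' : T} (f : W ⟶ W') :
    V ◁ V ◁ f ≫ swapFront V W' = swapFront V W ≫ V ◁ V ◁ f := by
  simp only [swapFront, Category.assoc]
  rw [associator_inv_naturality_right_assoc, whisker_exchange_assoc,
    associator_naturality_right]

theorem swapFront_braid (V W : T) :
    V ◁ swapFront V W ≫ swapFront V (V ⊗ W) ≫ V ◁ swapFront V W =
      swapFront V (V ⊗ W) ≫ V ◁ swapFront V W ≫ swapFront V (V ⊗ W) := by
  have hL : V ◁ swapFront V W ≫ swapFront V (V ⊗ W) ≫ V ◁ swapFront V W =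
      𝟙 (V ⊗ V ⊗ V ⊗ W) ⊗≫ (𝟙 ((V ⊗ V) ⊗ V) ⊗≫ (V ◁ (β_ V V).hom ⊗≫ (β_ V V).hom ▷ V ⊗≫
        V ◁ (β_ V V).hom) ⊗≫ 𝟙 (V ⊗ V ⊗ V)) ▷ W ⊗≫ 𝟙 (V ⊗ V ⊗ V ⊗ W) := by
    simp only [swapFront]
    monoidal
  have hR : swapFront V (V ⊗ W) ≫ V ◁ swapFront V W ≫ swapFront V (V ⊗ W) =
      𝟙 (V ⊗ V ⊗ V ⊗ W) ⊗≫ ((β_ V V).hom ▷ V ⊗≫ V ◁ (β_ V V).hom ⊗≫ (β_ V V).hom ▷ V) ▷ W ⊗≫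
        𝟙 (V ⊗ V ⊗ V ⊗ W) := by
    simp only [swapFront]
    monoidal
  rw [hL, hR, BraidedCategory.yang_baxter']
  monoidal

/-- The exchange of the first two factors of `V^{⊗ (n+2)}`. -/
def exch (V : T) (n : ℕ) : tensorPow V (n + 2) ⟶ tensorPow V (n + 2) :=
  swapFront V (tensorPow V n)

/-- The endomorphism `id ⊗ f` of `V^{⊗ (n+1)} = V ⊗ V^{⊗ n}`. -/
def onTail (V : T) {n : ℕ} (f : tensorPow V n ⟶ tensorPow V n) :
    tensorPow V (n + 1) ⟶ tensorPow V (n + 1) :=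
  V ◁ f

theorem onTail_id (V : T) (n : ℕ) : onTail V (𝟙 (tensorPow V n)) = 𝟙 _ :=
  MonoidalCategory.whiskerLeft_id _ _

theorem onTail_comp (V : T) {n : ℕ} (f g : tensorPow V n ⟶ tensorPow V n) :
    onTail V (f ≫ g) = onTail V f ≫ onTail V g :=
  MonoidalCategory.whiskerLeft_comp _ _ _

theorem exch_exch (V : T) (n : ℕ) : exch V n ≫ exch V n = 𝟙 _ :=
  swapFront_swapFront _ _

theorem onTail_onTail_exch (V : T) {n : ℕ} (f : tensorPow V n ⟶ tensorPow V n) :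
    onTail V (onTail V f) ≫ exch V n = exch V n ≫ onTail V (onTail V f) :=
  swapFront_natural V f

theorem exch_braid (V : T) (n : ℕ) :
    onTail V (exch V n) ≫ exch V (n + 1) ≫ onTail V (exch V n) =
      exch V (n + 1) ≫ onTail V (exch V n) ≫ exch V (n + 1) :=
  swapFront_braid V (tensorPow V n)

theorem onTail_onTail_exch_assoc (V : T) {n : ℕ} (f : tensorPow V n ⟶ tensorPow V n) {Z : T}
    (h : tensorPow V (n + 2) ⟶ Z) :
    onTail V (onTail V f) ≫ exch V n ≫ h = exch V n ≫ onTail V (onTail V f) ≫ h := by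
  rw [← Category.assoc, onTail_onTail_exch, Category.assoc]

theorem exch_braid_assoc (V : T) (n : ℕ) {Z : T} (h : tensorPow V (n + 3) ⟶ Z) :
    onTail V (exch V n) ≫ exch V (n + 1) ≫ onTail V (exch V n) ≫ h =
      exch V (n + 1) ≫ onTail V (exch V n) ≫ exch V (n + 1) ≫ h := by
  simpa only [Category.assoc] using congrArg (· ≫ h) (exch_braid V n)

/-- The exchange of the factors at positions `j` and `j + 1` of `V^{⊗ n}`
(and the identity if `j + 1 ≥ n`). -/
def adjSwap (V : T) : (n j : ℕ) → (tensorPow V n ⟶ tensorPow V n)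
  | 0, _ => 𝟙 _
  | 1, _ => 𝟙 _
  | n + 2, 0 => exch V n
  | n + 2, j + 1 => onTail V (adjSwap V (n + 1) j)

/-- The endomorphism of `V^{⊗ n}` that moves the factor at position `0` to position `i < n`,
keeping the order of the other factors. -/
def moveFront (V : T) : (n i : ℕ) → (tensorPow V n ⟶ tensorPow V n)
  | 0, _ => 𝟙 _
  | 1, _ => 𝟙 _
  | _ + 2, 0 => 𝟙 _
  | n + 2, i + 1 => exch V n ≫ onTail V (moveFront V (n + 1) i)

theorem adjSwap_succ (V : T) (n j : ℕ) :
    adjSwap V (n + 1) (j + 1) = onTail V (adjSwap V n j) := by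
  cases n
  · simp only [adjSwap, onTail_id]
  · rfl

theorem moveFront_zero (V : T) (n : ℕ) : moveFront V n 0 = 𝟙 _ := by
  rcases n with _ | _ | n <;> rfl

theorem moveFront_adjSwap (V : T) (n j : ℕ) (h : j + 1 < n) :
    moveFront V n j ≫ adjSwap V n j = moveFront V n (j + 1) := by
  induction j generalizing n with
  | zero =>
    obtain ⟨n, rfl⟩ : ∃ m, n = m + 2 := ⟨n - 2, by omega⟩
    rw [moveFront_zero, Category.id_comp, moveFront, moveFront_zero, adjSwap, onTail_id,
      Category.comp_id]
  | succ j ih =>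
    obtain ⟨n, rfl⟩ : ∃ m, n = m + 2 := ⟨n - 2, by omega⟩
    rw [moveFront, adjSwap, moveFront, Category.assoc, ← onTail_comp, ih _ (by omega)]

theorem adjSwap_adjSwap (V : T) (n j : ℕ) : adjSwap V n j ≫ adjSwap V n j = 𝟙 _ := by
  induction j generalizing n with
  | zero =>
    rcases n with _ | _ | n
    · exact Category.id_comp _
    · exact Category.id_comp _
    · exact exch_exch _ _
  | succ j ih =>
    rcases n with _ | _ | n
    · exact Category.id_comp _
    · exact Category.id_comp _
    · rw [adjSwap, ← onTail_comp, ih, onTail_id]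

theorem moveFront_adjSwap_of_lt (V : T) (n i j : ℕ) (h : i ≤ j) :
    moveFront V (n + 1) i ≫ adjSwap V (n + 1) (j + 1) =
      onTail V (adjSwap V n j) ≫ moveFront V (n + 1) i := by
  induction i generalizing n j with
  | zero => rw [moveFront_zero, adjSwap_succ, Category.id_comp, Category.comp_id]
  | succ i ih =>
    obtain ⟨j, rfl⟩ : ∃ m, j = m + 1 := ⟨j - 1, by omega⟩
    rcases n with _ | n
    · simp only [moveFront, adjSwap, onTail_id]
    · have h2 := ih n j (by omega)
      rw [moveFront, adjSwap_succ _ (n + 1), Category.assoc, ← onTail_comp, h2,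
        adjSwap_succ, onTail_comp, onTail_onTail_exch_assoc]

theorem moveFront_adjSwap_of_gt (V : T) (n i j : ℕ) (h : j + 1 < i) (hi : i < n + 1) :
    moveFront V (n + 1) i ≫ adjSwap V (n + 1) j =
      onTail V (adjSwap V n j) ≫ moveFront V (n + 1) i := by
  induction j generalizing n i with
  | zero =>
    obtain ⟨i, rfl⟩ : ∃ m, i = m + 2 := ⟨i - 2, by omega⟩
    obtain ⟨n, rfl⟩ : ∃ m, n = m + 2 := ⟨n - 2, by omega⟩
    simp only [moveFront, adjSwap, Category.assoc, onTail_comp]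
    rw [onTail_onTail_exch, exch_braid_assoc]
  | succ j ih =>
    obtain ⟨i, rfl⟩ : ∃ m, i = m + 1 := ⟨i - 1, by omega⟩
    obtain ⟨n, rfl⟩ : ∃ m, n = m + 1 := ⟨n - 1, by omega⟩
    have h2 := ih n i (by omega) (by omega)
    rw [moveFront, adjSwap_succ _ (n + 1), Category.assoc, ← onTail_comp, h2,
      adjSwap_succ, onTail_comp, onTail_onTail_exch_assoc]

/-- For a permutation `σ` of `{0, …, n}`, the permutation of `{0, …, n-1}` describing the order in
which `σ` places `1, …, n` in the complement of `σ 0`. -/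
def permTail {n : ℕ} (σ : Equiv.Perm (Fin (n + 1))) : Equiv.Perm (Fin n) :=
  (Equiv.Perm.decomposeFin (Fin.cycleRange (σ 0) * σ)).2

theorem succAbove_permTail {n : ℕ} (σ : Equiv.Perm (Fin (n + 1))) (j : Fin n) :
    (σ 0).succAbove (permTail σ j) = σ j.succ := by
  set τ := Fin.cycleRange (σ 0) * σ with hτ
  have h0 : τ 0 = 0 := by simp [hτ]
  have h1 : Equiv.Perm.decomposeFin.symm (0, (Equiv.Perm.decomposeFin τ).2) = τ := by
    have h2 : (Equiv.Perm.decomposeFin τ).1 = 0 := by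
      have := Equiv.Perm.decomposeFin_symm_apply_zero (Equiv.Perm.decomposeFin τ).1
        (Equiv.Perm.decomposeFin τ).2
      rw [Prod.mk.eta, Equiv.symm_apply_apply, h0] at this
      exact this.symm
    rw [← h2, Prod.mk.eta, Equiv.symm_apply_apply]
  have h3 : (permTail σ j).succ = τ j.succ := by
    conv_rhs => rw [← h1]
    simp [permTail, hτ]
  have h4 : σ j.succ = (Fin.cycleRange (σ 0)).symm (τ j.succ) := by simp [hτ]
  rw [h4, ← h3, Fin.cycleRange_symm_succ]

theorem permTail_eq {n : ℕ} {σ : Equiv.Perm (Fin (n + 1))} {e : Equiv.Perm (Fin n)}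
    (h : ∀ j, (σ 0).succAbove (e j) = σ j.succ) : permTail σ = e := by
  ext j
  rw [Fin.succAbove_right_injective ((succAbove_permTail σ j).trans (h j).symm)]

/-- The endomorphism of `V^{⊗ n}` that moves the factor at position `i` to position `σ i`, for
all `i`. -/
def permMor (V : T) : (n : ℕ) → Equiv.Perm (Fin n) → (tensorPow V n ⟶ tensorPow V n)
  | 0, _ => 𝟙 _
  | n + 1, σ => onTail V (permMor V n (permTail σ)) ≫ moveFront V (n + 1) (σ 0)

theorem permMor_succ (V : T) (n : ℕ) (σ : Equiv.Perm (Fin (n + 1))) : permMor V (n + 1) σ =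
    onTail V (permMor V n (permTail σ)) ≫ moveFront V (n + 1) (σ 0) := rfl

theorem permMor_one (V : T) (n : ℕ) : permMor V n 1 = 𝟙 _ := by
  induction n with
  | zero => rfl
  | succ n ih =>
    have h : permTail (1 : Equiv.Perm (Fin (n + 1))) = 1 := permTail_eq (by simp)
    rw [permMor, h, ih, onTail_id]
    exact (Category.id_comp _).trans (moveFront_zero V _)

/-- The transposition of `j` and `j + 1`. -/
def adjTransp {n : ℕ} (j : Fin n) : Equiv.Perm (Fin (n + 1)) := Equiv.swap j.castSucc j.succ

theorem adjTransp_val {n : ℕ} (j : Fin n) (x : Fin (n + 1)) : (adjTransp j x : ℕ) =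
    if (x : ℕ) = j then (j : ℕ) + 1 else if (x : ℕ) = j + 1 then (j : ℕ) else x := by
  simp only [adjTransp, Equiv.swap_apply_def, Fin.ext_iff, Fin.val_castSucc, Fin.val_succ]
  split_ifs <;> simp_all

theorem succAbove_val {n : ℕ} (a : Fin (n + 1)) (x : Fin n) :
    (a.succAbove x : ℕ) = if (x : ℕ) < a then (x : ℕ) else x + 1 := by
  simp only [Fin.succAbove, Fin.lt_def, Fin.val_castSucc]
  split_ifs <;> rfl

theorem permMor_adjTransp_mul (V : T) (n : ℕ) (j : Fin n) (σ : Equiv.Perm (Fin (n + 1))) :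
    permMor V (n + 1) (adjTransp j * σ) = permMor V (n + 1) σ ≫ adjSwap V (n + 1) j := by
  induction n with
  | zero => exact j.elim0
  | succ n ih =>
    have hs := adjTransp_val j
    have hv : ((adjTransp j * σ) 0 : Fin (n + 2)) = adjTransp j (σ 0) := rfl
    have hv' := congrArg Fin.val hv
    rw [hs] at hv'
    have hlt := (σ 0).isLt
    have hj := j.isLt
    rcases lt_trichotomy ((σ 0 : Fin (n + 2)) : ℕ) (j : ℕ) with h | h | h
    · -- the moved factor ends up to the left of the exchanged ones
      obtain ⟨k, hk⟩ : ∃ k : Fin n, (k : ℕ) + 1 = j := ⟨⟨j - 1, by omega⟩, by simp; omega⟩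
      obtain ⟨m, rfl⟩ : ∃ m, n = m + 1 := ⟨n - 1, by have := k.isLt; omega⟩
      have hz : (adjTransp j * σ) 0 = σ 0 := by
        apply Fin.ext
        rw [hv', if_neg (by omega), if_neg (by omega)]
      have ht : permTail (adjTransp j * σ) = adjTransp k * permTail σ := by
        refine permTail_eq fun x => Fin.ext ?_
        rw [Equiv.Perm.mul_apply _ _ x.succ, ← succAbove_permTail σ x, hs]
        rw [hz, Equiv.Perm.mul_apply]
        have hk2 := adjTransp_val k (permTail σ x)
        rw [succAbove_val, succAbove_val]
        clear ih hs hv hv' hz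
        generalize ((adjTransp k (permTail σ x) : Fin _) : ℕ) = z at hk2 ⊢
        split_ifs at hk2 ⊢ <;> omega
      rw [permMor_succ V _ (adjTransp j * σ), ht, hz, ih, permMor_succ V _ σ, onTail_comp, Category.assoc, Category.assoc, ← hk,
        ← moveFront_adjSwap_of_lt _ _ _ _ (by omega)]
    · -- the moved factor is exchanged with its right neighbour
      have hz : (((adjTransp j * σ) 0 : Fin (n + 2)) : ℕ) = j + 1 := by rw [hv', if_pos h]
      have ht : permTail (adjTransp j * σ) = permTail σ := by
        refine permTail_eq fun x => Fin.ext ?_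
        rw [Equiv.Perm.mul_apply _ _ x.succ, ← succAbove_permTail σ x, hs]
        rw [succAbove_val, succAbove_val]
        split_ifs at * <;> omega
      rw [permMor_succ V _ (adjTransp j * σ), ht, permMor_succ V _ σ, Category.assoc, hz, h, moveFront_adjSwap _ _ _ (by omega)]
    · rcases Nat.lt_or_ge ((σ 0 : Fin (n + 2)) : ℕ) (j + 2 : ℕ) with h' | h'
      · -- the moved factor is exchanged with its left neighbour
        have h1 : ((σ 0 : Fin (n + 2)) : ℕ) = j + 1 := by omega
        have hz : (((adjTransp j * σ) 0 : Fin (n + 2)) : ℕ) = j := by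
          rw [hv', if_neg (by omega), if_pos h1]
        have ht : permTail (adjTransp j * σ) = permTail σ := by
          refine permTail_eq fun x => Fin.ext ?_
          rw [Equiv.Perm.mul_apply _ _ x.succ, ← succAbove_permTail σ x, hs]
          rw [succAbove_val, succAbove_val]
          split_ifs at * <;> omega
        rw [permMor_succ V _ (adjTransp j * σ), ht, permMor_succ V _ σ, Category.assoc, hz, h1, ← moveFront_adjSwap _ _ _ (by omega),
          Category.assoc, adjSwap_adjSwap, Category.comp_id]
      · -- the moved factor ends up to the right of the exchanged ones
        obtain ⟨m, rfl⟩ : ∃ m, n = m + 1 := ⟨n - 1, by omega⟩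
        have hz : (adjTransp j * σ) 0 = σ 0 := by
          apply Fin.ext
          rw [hv', if_neg (by omega), if_neg (by omega)]
        obtain ⟨k, hk⟩ : ∃ k : Fin (m + 1), (k : ℕ) = j := ⟨⟨j, by omega⟩, rfl⟩
        have ht : permTail (adjTransp j * σ) = adjTransp k * permTail σ := by
          refine permTail_eq fun x => Fin.ext ?_
          rw [Equiv.Perm.mul_apply _ _ x.succ, ← succAbove_permTail σ x, hs]
          rw [hz, Equiv.Perm.mul_apply]
          have hk2 := adjTransp_val k (permTail σ x)
          rw [succAbove_val, succAbove_val]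
          clear ih hs hv hv' hz
          generalize ((adjTransp k (permTail σ x) : Fin _) : ℕ) = z at hk2 ⊢
          split_ifs at hk2 ⊢ <;> omega
        rw [permMor_succ V _ (adjTransp j * σ), ht, hz, ih, permMor_succ V _ σ, onTail_comp, Category.assoc, Category.assoc, ← hk,
          moveFront_adjSwap_of_gt _ _ _ _ (by omega) (by omega)]

theorem permMor_mul (V : T) (n : ℕ) (σ τ : Equiv.Perm (Fin n)) :
    permMor V n (σ * τ) = permMor V n τ ≫ permMor V n σ := by
  rcases n with _ | n
  · exact (Category.id_comp _).symm
  have h : σ ∈ Submonoid.closure (Set.range (fun i : Fin n => Equiv.swap i.castSucc i.succ)) := by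
    rw [Equiv.Perm.mclosure_swap_castSucc_succ]
    trivial
  induction h using Submonoid.closure_induction generalizing τ with
  | mem x hx =>
    obtain ⟨j, rfl⟩ := hx
    have h1 := permMor_adjTransp_mul V n j 1
    rw [mul_one, permMor_one, Category.id_comp] at h1
    exact (permMor_adjTransp_mul V n j τ).trans (congrArg _ h1.symm)
  | one => rw [one_mul, permMor_one, Category.comp_id]
  | mul x y _ _ hx hy => rw [mul_assoc, hx, hy, hx, Category.assoc]

/-- The `n`-th tensor power `V^{⊗ n}` as an object with an action of the symmetric group, which
permutes the factors through the symmetry of the tensor product. -/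
def tensorPowAction (V : T) (n : ℕ) : Action T (Equiv.Perm (Fin n)) where
  V := tensorPow V n
  ρ :=
    { toFun := permMor V n
      map_one' := permMor_one V n
      map_mul' := permMor_mul V n }

end TensorPower
section Schur

variable {G : Type} [Group G] {A : Type u} [Category.{v} A] [Preadditive A] [Linear ℚ A]

/-- The action of the rational group algebra on (the underlying object of) an object with an action
of `G` in a `ℚ`-linear category. -/
def groupAlgebraAct (V : Action A G) : MonoidAlgebra ℚ G →ₐ[ℚ] End V.V :=
  MonoidAlgebra.lift ℚ (End V.V) G V.ρ

theorem groupAlgebraAct_natural {V W : Action A G} (f : V ⟶ W) (x : MonoidAlgebra ℚ G) :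
    (groupAlgebraAct V x : V.V ⟶ V.V) ≫ f.hom = f.hom ≫ groupAlgebraAct W x := by
  induction x using MonoidAlgebra.induction_on with
  | of g =>
    simp only [groupAlgebraAct, MonoidAlgebra.lift_of]
    exact f.comm g
  | add x y hx hy =>
    rw [map_add, map_add]
    exact (Preadditive.add_comp _ _ _ _ _ _).trans
      ((congrArg₂ (· + ·) hx hy).trans (Preadditive.comp_add _ _ _ _ _ _).symm)
  | smul r x hx =>
    rw [map_smul, map_smul]
    exact (Linear.smul_comp _ _ _ _ _ _).trans
      ((congrArg (r • ·) hx).trans (Linear.comp_smul _ _ _ _ _ _).symm)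

variable [IsIdempotentComplete A]

theorem exists_split (e : MonoidAlgebra ℚ G) (he : IsIdempotentElem e) (V : Action A G) :
    ∃ (Y : A) (i : Y ⟶ V.V) (p : V.V ⟶ Y), i ≫ p = 𝟙 Y ∧ p ≫ i = groupAlgebraAct V e :=
  IsIdempotentComplete.idempotents_split V.V (groupAlgebraAct V e)
    ((map_mul (groupAlgebraAct V) e e).symm.trans (congrArg _ he))

/-- The image `e · V` of the projector given by an idempotent `e` of the rational group algebra
on an object `V` with an action of `G`. -/
def imageObj (e : MonoidAlgebra ℚ G) (he : IsIdempotentElem e) (V : Action A G) : A :=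
  (exists_split e he V).choose

/-- The inclusion of the image of a projector. -/
def imageIncl (e : MonoidAlgebra ℚ G) (he : IsIdempotentElem e) (V : Action A G) :
    imageObj e he V ⟶ V.V :=
  (exists_split e he V).choose_spec.choose

/-- The projection onto the image of a projector. -/
def imageProj (e : MonoidAlgebra ℚ G) (he : IsIdempotentElem e) (V : Action A G) :
    V.V ⟶ imageObj e he V :=
  (exists_split e he V).choose_spec.choose_spec.choose

theorem imageIncl_imageProj (e : MonoidAlgebra ℚ G) (he : IsIdempotentElem e) (V : Action A G) :
    imageIncl e he V ≫ imageProj e he V = 𝟙 _ :=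
  (exists_split e he V).choose_spec.choose_spec.choose_spec.1

theorem imageProj_imageIncl (e : MonoidAlgebra ℚ G) (he : IsIdempotentElem e) (V : Action A G) :
    imageProj e he V ≫ imageIncl e he V = (groupAlgebraAct V e : V.V ⟶ V.V) :=
  (exists_split e he V).choose_spec.choose_spec.choose_spec.2

/-- The functor `V ↦ e · V`. -/
def imageFunctor (e : MonoidAlgebra ℚ G) (he : IsIdempotentElem e) : Action A G ⥤ A where
  obj V := imageObj e he V
  map {V W} f := imageIncl e he V ≫ f.hom ≫ imageProj e he W
  map_id V := by
    rw [Action.id_hom, Category.id_comp, imageIncl_imageProj]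
  map_comp {U V W} f g := by
    have h : imageIncl e he U ≫ (groupAlgebraAct U e : U.V ⟶ U.V) = imageIncl e he U := by
      rw [← imageProj_imageIncl e he U, ← Category.assoc, imageIncl_imageProj, Category.id_comp]
    have h' := groupAlgebraAct_natural f e
    rw [← imageProj_imageIncl e he V] at h'
    simp only [Category.assoc, Action.comp_hom]
    rw [← reassoc_of% h', reassoc_of% h]

instance (e : MonoidAlgebra ℚ G) (he : IsIdempotentElem e) :
    (imageFunctor (A := A) e he).Additive where
  map_add {V W f g} := by
    change imageIncl e he V ≫ (f.hom + g.hom) ≫ imageProj e he W = _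
    rw [Preadditive.add_comp, Preadditive.comp_add]
    rfl

variable [Fintype G]

variable (G) in
/-- The idempotent `(1 / |G|) ∑ g` of the rational group algebra. -/
def symIdem : MonoidAlgebra ℚ G := (Fintype.card G : ℚ)⁻¹ • ∑ g : G, MonoidAlgebra.of ℚ G g

variable (G) in
theorem symIdem_idem : IsIdempotentElem (symIdem G) := by
  have h : ∀ g : G, MonoidAlgebra.of ℚ G g * ∑ h : G, MonoidAlgebra.of ℚ G h =
      ∑ h : G, MonoidAlgebra.of ℚ G h := by
    intro g
    rw [Finset.mul_sum]
    simp only [← map_mul]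
    exact Equiv.sum_comp (Equiv.mulLeft g) (fun h => MonoidAlgebra.of ℚ G h)
  have hc : (Fintype.card G : ℚ) ≠ 0 := by simp
  rw [IsIdempotentElem, symIdem, smul_mul_smul_comm, Finset.sum_mul, Finset.sum_congr rfl
    (fun g _ => h g), Finset.sum_const, Finset.card_univ, ← Nat.cast_smul_eq_nsmul ℚ, smul_smul,
    mul_assoc, inv_mul_cancel₀ hc, mul_one]

/-- The invariants `V^G`: the image of the projector `(1 / |G|) ∑ g`. -/
def invariants (V : Action A G) : A := (imageFunctor (symIdem G) (symIdem_idem G)).obj V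

end Schur

section Decomposition

/-- The set of isomorphism classes of irreducible rational representations of a finite group `G`:
these correspond to the isotypic components of the regular representation `ℚ[G]`. -/
abbrev Irrep (G : Type) [Group G] : Type :=
  isotypicComponents (MonoidAlgebra ℚ G) (MonoidAlgebra ℚ G)

variable {G : Type} [Group G] [Finite G]

instance : IsSemisimpleRing (MonoidAlgebra ℚ G) := by
  have := Fintype.ofFinite G
  infer_instance

instance : IsNoetherianRing (MonoidAlgebra ℚ G) := inferInstance

instance : Finite (Irrep G) := inferInstance

/-- A minimal left ideal `V_c` of `ℚ[G]` in the given class. -/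
def Irrep.ideal (c : Irrep G) : Submodule (MonoidAlgebra ℚ G) (MonoidAlgebra ℚ G) :=
  c.2.choose

theorem Irrep.ideal_spec (c : Irrep G) : IsSimpleModule (MonoidAlgebra ℚ G) c.ideal ∧
    c.1 = isotypicComponent (MonoidAlgebra ℚ G) (MonoidAlgebra ℚ G) c.ideal :=
  c.2.choose_spec

theorem Irrep.exists_idem (c : Irrep G) :
    ∃ e : MonoidAlgebra ℚ G, IsIdempotentElem e ∧ c.ideal = Ideal.span {e} :=
  IsSemisimpleRing.ideal_eq_span_idempotent c.ideal

/-- A primitive idempotent `e_c` of `ℚ[G]` with `V_c = ℚ[G] e_c`. -/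
def Irrep.idem (c : Irrep G) : MonoidAlgebra ℚ G := c.exists_idem.choose

theorem Irrep.isIdempotentElem_idem (c : Irrep G) : IsIdempotentElem c.idem :=
  c.exists_idem.choose_spec.1

/-- The irreducible representation `V_c` with `G` acting by left multiplication. -/
def Irrep.rep (c : Irrep G) : FDRep ℚ G :=
  have : Module.Finite ℚ c.ideal := by
    have := Fintype.ofFinite G
    have : Module.Finite ℚ (MonoidAlgebra ℚ G) := inferInstance
    exact inferInstanceAs (Module.Finite ℚ (c.ideal.restrictScalars ℚ))
  FDRep.of (((Algebra.lsmul ℚ ℚ c.ideal : MonoidAlgebra ℚ G →ₐ[ℚ] Module.End ℚ c.ideal) :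
    MonoidAlgebra ℚ G →* Module.End ℚ c.ideal).comp (MonoidAlgebra.of ℚ G))


instance : HasBinaryBiproducts (FDRep ℚ G) := inferInstance

open scoped ZeroObject

/-- The (additive group of the) rational representation ring of a finite group: the Grothendieck
group of finite dimensional rational representations. -/
abbrev RepRing (G : Type) [Group G] [Finite G] : Type 1 := K0 (FDRep ℚ G)

/-- The trace of an element of a finite group on a rational representation is an algebraic
integer. -/
theorem isIntegral_trace {V : Type} [AddCommGroup V] [Module ℚ V] [Module.Finite ℚ V]
    (ρ : Representation ℚ G V) (g : G) : IsIntegral ℤ (LinearMap.trace ℚ V (ρ g)) := by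
  let b := Module.finBasis ℚ V
  set M := LinearMap.toMatrix b b (ρ g) with hM
  have hpow : M ^ orderOf g = 1 := by
    rw [hM, LinearMap.toMatrix_pow, ← map_pow, pow_orderOf_eq_one, map_one,
      LinearMap.toMatrix_one]
  rw [LinearMap.trace_eq_matrix_trace ℚ b, ← hM]
  set N := M.map (algebraMap ℚ ℂ) with hN
  have hNpow : N ^ orderOf g = 1 := by
    rw [hN, ← Matrix.map_pow, hpow, Matrix.map_one _ (map_zero _) (map_one _)]
  have htr : algebraMap ℚ ℂ M.trace = N.trace := by
    rw [hN]
    exact AddMonoidHom.map_trace (algebraMap ℚ ℂ) M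
  rw [← isIntegral_algebraMap_iff (algebraMap ℚ ℂ).injective, htr,
    Matrix.trace_eq_sum_roots_charpoly]
  refine IsIntegral.multiset_sum fun μ hμ => ?_
  have h1 : Module.End.HasEigenvalue (Matrix.toLin' N) μ := by
    rw [Module.End.hasEigenvalue_iff_isRoot_charpoly, Matrix.charpoly_toLin']
    exact Polynomial.isRoot_of_mem_roots hμ
  obtain ⟨v, hv⟩ := h1.exists_hasEigenvector
  have h2 := hv.pow_apply (orderOf g)
  rw [← Matrix.toLin'_pow, hNpow, Matrix.toLin'_one, LinearMap.id_apply] at h2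
  have h3 : μ ^ orderOf g = 1 := by
    have h4 : (μ ^ orderOf g - 1) • v = 0 := by rw [sub_smul, ← h2, one_smul, sub_self]
    exact sub_eq_zero.1 ((smul_eq_zero.1 h4).resolve_right hv.2)
  exact IsIntegral.of_pow (orderOf_pos g) (h3 ▸ isIntegral_one)

theorem exists_int_character (V : FDRep ℚ G) (g : G) : ∃ m : ℤ, (m : ℚ) = V.character g :=
  (IsIntegrallyClosed.isIntegral_iff (R := ℤ) (K := ℚ)).1 (isIntegral_trace V.ρ g)

/-- The linear map underlying a morphism of representations. -/
def linOf {V W : FDRep ℚ G} (f : V ⟶ W) : V →ₗ[ℚ] W := f.hom.hom.hom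

theorem trace_retract {V B : FDRep ℚ G} (i : V ⟶ B) (p : B ⟶ V) (h : i ≫ p = 𝟙 V) (g : G) :
    LinearMap.trace ℚ B (B.ρ g ∘ₗ linOf i ∘ₗ linOf p) = V.character g := by
  have h1 : B.ρ g ∘ₗ linOf i = linOf i ∘ₗ V.ρ g := by
    ext x
    exact (ConcreteCategory.congr_hom (congrArg (fun f => f.hom) (i.comm g)) x).symm
  have h2 : linOf p ∘ₗ linOf i = LinearMap.id := by
    change linOf (i ≫ p) = LinearMap.id
    rw [h]
    rfl
  rw [← LinearMap.comp_assoc, h1, LinearMap.comp_assoc, LinearMap.trace_comp_comm',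
    LinearMap.comp_assoc, h2]
  rfl

theorem character_zero (g : G) : (0 : FDRep ℚ G).character g = 0 := by
  have h : linOf (𝟙 (0 : FDRep ℚ G)) = linOf 0 :=
    congrArg linOf ((isZero_zero (FDRep ℚ G)).eq_of_src _ _)
  have h1 := trace_retract (𝟙 (0 : FDRep ℚ G)) (𝟙 _) (Category.comp_id _) g
  rw [← h1, h]
  exact (congrArg (LinearMap.trace ℚ (0 : FDRep ℚ G)) (LinearMap.comp_zero _)).trans (map_zero _)

theorem character_biprod (V W : FDRep ℚ G) (g : G) :
    (V ⊞ W).character g = V.character g + W.character g := by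
  have h : linOf (biprod.inl : V ⟶ V ⊞ W) ∘ₗ linOf biprod.fst +
      linOf (biprod.inr : W ⟶ V ⊞ W) ∘ₗ linOf biprod.snd = LinearMap.id :=
    congrArg linOf (biprod.total (X := V) (Y := W))
  rw [← trace_retract (biprod.inl : V ⟶ V ⊞ W) biprod.fst biprod.inl_fst g,
    ← trace_retract (biprod.inr : W ⟶ V ⊞ W) biprod.snd biprod.inr_snd g, ← map_add,
    ← LinearMap.comp_add, h]
  rfl

/-- The integer-valued trace `tr(g)` of `g` on isomorphism classes of representations. -/
def trClass (g : G) : IsoClass (FDRep ℚ G) →+ ℤ where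
  toFun := Quotient.lift (s := isIsomorphicSetoid (FDRep ℚ G))
    (fun V => (exists_int_character V g).choose) (by
      rintro V W ⟨e⟩
      rw [← Int.cast_inj (α := ℚ), (exists_int_character V g).choose_spec,
        (exists_int_character W g).choose_spec]
      exact congrFun (FDRep.char_iso e) g)
  map_zero' := by
    rw [← Int.cast_inj (α := ℚ), Int.cast_zero]
    exact (exists_int_character (0 : FDRep ℚ G) g).choose_spec.trans (character_zero g)
  map_add' a b := by
    induction a using IsoClass.ind with | _ V
    induction b using IsoClass.ind with | _ W
    rw [← Int.cast_inj (α := ℚ), Int.cast_add]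
    refine (exists_int_character (V ⊞ W) g).choose_spec.trans
      ((character_biprod V W g).trans (congrArg₂ (· + ·) ?_ ?_))
    · exact (exists_int_character V g).choose_spec.symm
    · exact (exists_int_character W g).choose_spec.symm

/-- The group homomorphism `tr(g) : Rep_ℚ(G) → ℤ` given by the trace of `g`. -/
def tr (g : G) : RepRing G →+ ℤ := K0.lift (trClass g)

theorem tr_of (g : G) (V : FDRep ℚ G) : (tr g (K0.of V) : ℚ) = V.character g := by
  rw [tr, K0.of, K0.lift_ofClass]
  exact (exists_int_character V g).choose_spec

variable {A : Type u} [Category.{v} A] [Preadditive A] [Linear ℚ A] [HasZeroObject A]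
  [HasBinaryBiproducts A] [IsIdempotentComplete A]

instance : HasBinaryBiproducts (Action A G) :=
  have : HasFiniteProducts A := hasFiniteProducts_of_has_binary_and_terminal
  HasBinaryBiproducts.of_hasBinaryProducts

instance : HasZeroObject (Action A G) :=
  have : HasFiniteProducts A := hasFiniteProducts_of_has_binary_and_terminal
  hasZeroObject_of_hasTerminal_object

open scoped TensorProduct

variable (A) in
/-- The decomposition isomorphism `K̄₀(A_{Σ_n}) ≅ K̄₀(A) ⊗ Rep_ℚ(Σ_n)` for objects with an action
of the symmetric group `Σ_n`, as a homomorphism. It comes from the decomposition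
`V ≅ ⨁_λ V_λ ⊗ S_λ(V)` over the irreducible rational representations `V_λ` of `Σ_n`, i.e. it is
`[V] ↦ ∑_λ [S_λ(V)] ⊗ [V_λ]`. Here `V_λ = ℚ[Σ_n] e_λ` and `S_λ(V) = Hom_{Σ_n}(V_λ, V) = e_λ · V` is the
Schur functor (recall that `End(V_λ) = ℚ` for symmetric groups). -/
def decomp (n : ℕ) : K0 (Action A (Equiv.Perm (Fin n))) →+
    K0 A ⊗[ℤ] RepRing (Equiv.Perm (Fin n)) :=
  have := Fintype.ofFinite (Irrep (Equiv.Perm (Fin n)))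
  ∑ c : Irrep (Equiv.Perm (Fin n)),
    ((TensorProduct.mk ℤ (K0 A) (RepRing (Equiv.Perm (Fin n)))).flip
      (K0.of c.rep)).toAddMonoidHom.comp (K0.map (imageFunctor c.idem c.isIdempotentElem_idem))

/-- The map `id ⊗ φ : K ⊗ R → K ⊗ ℤ ≅ K` for a homomorphism `φ : R → ℤ`. -/
def idTensor {K R : Type*} [AddCommGroup K] [AddCommGroup R] (φ : R →+ ℤ) : K ⊗[ℤ] R →+ K :=
  ((TensorProduct.rid ℤ K).toLinearMap.comp
    (LinearMap.lTensor K φ.toIntLinearMap)).toAddMonoidHom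

end Decomposition

section Equivariant

open Bicategory

variable {C : Type u₁} [Category.{v₁} C] (F : Pseudofunctor (LocallyDiscrete C) Cat.{v, u})

/-- The category `A(X)` attached to a space `X` by a pseudofunctor `A`. -/
abbrev Fib (X : C) : Type u := F.obj (LocallyDiscrete.mk X)

/-- The push-forward functor `f_* : A(X) ⥤ A(Y)`. -/
abbrev push {X Y : C} (f : X ⟶ Y) : Fib F X ⥤ Fib F Y := (F.map f.toLoc).toFunctor

/-- The structure isomorphism `f_* ≅ id` of a pseudofunctor for an identity morphism `f`. -/
def pushId {X : C} (f : X ⟶ X) (hf : f = 𝟙 X) : push F f ≅ 𝟭 (Fib F X) :=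
  Cat.Hom.toNatIso (F.mapId' f.toLoc (congrArg Quiver.Hom.toLoc hf))

/-- The structure isomorphism `(g ∘ f)_* ≅ g_* f_*` of a pseudofunctor. -/
def pushComp {X Y Z : C} (f : X ⟶ Y) (g : Y ⟶ Z) (fg : X ⟶ Z) (h : f ≫ g = fg) :
    push F fg ≅ push F f ⋙ push F g :=
  Cat.Hom.toNatIso (F.mapComp' f.toLoc g.toLoc fg.toLoc (congrArg Quiver.Hom.toLoc h))

theorem pushComp_pushId {X Y : C} (f : X ⟶ X) (hf : f = 𝟙 X) (p : X ⟶ Y) (h : f ≫ p = p)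
    (M : Fib F X) :
    (pushComp F f p p h).hom.app M ≫ (push F p).map ((pushId F f hf).hom.app M) =
      𝟙 ((push F p).obj M) := by
  subst hf
  have h1 := congrArg (fun t => Cat.Hom₂.toNatTrans t)
    (Pseudofunctor.mapComp'_id_comp_hom F p.toLoc)
  have h2 := congrArg (fun t => NatTrans.app t M) h1
  have h3 : (pushComp F (𝟙 X) p p h).hom.app M =
      (push F p).map ((Cat.Hom.toNatIso (F.mapId ⟨X⟩)).inv.app M) :=
    h2.trans (Category.id_comp _)
  have h4 : (pushId F (𝟙 X) rfl).hom.app M = (Cat.Hom.toNatIso (F.mapId ⟨X⟩)).hom.app M :=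
    congrArg (fun t => (Cat.Hom.toNatIso t).hom.app M) (Pseudofunctor.mapId'_eq_mapId F _)
  rw [h3, h4]
  exact ((push F p).map_comp _ _).symm.trans
    ((congrArg _ (Iso.inv_hom_id_app _ _)).trans ((push F p).map_id M))

theorem pushComp_assoc {W X Y Z : C} (f : W ⟶ X) (g : X ⟶ Y) (k : Y ⟶ Z) (fg : W ⟶ Y)
    (gk : X ⟶ Z) (fgk : W ⟶ Z) (h₁ : f ≫ g = fg) (h₂ : g ≫ k = gk) (h₃ : fg ≫ k = fgk)
    (h₄ : f ≫ gk = fgk) (M : Fib F W) :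
    (pushComp F fg k fgk h₃).hom.app M ≫ (push F k).map ((pushComp F f g fg h₁).hom.app M) =
      (pushComp F f gk fgk h₄).hom.app M ≫
        (pushComp F g k gk h₂).hom.app ((push F f).obj M) := by
  have h := congrArg (fun t => NatTrans.app (Cat.Hom₂.toNatTrans t) M)
    (Pseudofunctor.mapComp'₀₂₃_hom_comp_mapComp'_hom_whiskerRight F f.toLoc g.toLoc k.toLoc fg.toLoc
      gk.toLoc fgk.toLoc (congrArg Quiver.Hom.toLoc h₁) (congrArg Quiver.Hom.toLoc h₂)
      (congrArg Quiver.Hom.toLoc h₃))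
  exact h.trans (congrArg (fun t => (pushComp F f gk fgk h₄).hom.app M ≫ t) (Category.comp_id _))

/-- A `G`-equivariant structure on an object `M ∈ A(X)`, for a (left) action `ρ` of `G` on `X`:
isomorphisms `φ_g : g_* M ≅ M` with `φ_1 = e⁻¹` and `φ_{gh} = φ_g ∘ g_*(φ_h) ∘ c`. -/
structure EquivariantStructure {G : Type} [Group G] {X : C} (ρ : G →* End X) (M : Fib F X) where
  /-- The isomorphism `φ_g`. -/
  iso (g : G) : (push F (ρ g)).obj M ≅ M
  iso_one : (iso 1).hom = (pushId F (ρ 1) (map_one ρ)).hom.app M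
  iso_mul (g h : G) : (iso (g * h)).hom =
    (pushComp F (ρ h) (ρ g) (ρ (g * h)) (map_mul ρ g h).symm).hom.app M ≫
      (push F (ρ g)).map (iso h).hom ≫ (iso g).hom

/-- The push-forward of a `G`-equivariant object along a `G`-invariant morphism `p : X ⟶ Y`, i.e.
along a `G`-equivariant morphism to a space with trivial action: this is an object of `A(Y)` with
an action of `G`. -/
def pushAction {G : Type} [Group G] {X Y : C} {ρ : G →* End X} {M : Fib F X}
    (E : EquivariantStructure F ρ M) (p : X ⟶ Y) (hp : ∀ g, (ρ g : X ⟶ X) ≫ p = p) :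
    Action (Fib F Y) G where
  V := (push F p).obj M
  ρ :=
    { toFun := fun g => (pushComp F (ρ g) p p (hp g)).hom.app M ≫ (push F p).map (E.iso g).hom
      map_one' := by
        rw [E.iso_one]
        exact pushComp_pushId F _ _ p _ M
      map_mul' := fun g h => by
        have h1 := pushComp_assoc F (ρ h) (ρ g) p (ρ (g * h)) p p (map_mul ρ g h).symm (hp g)
          (hp (g * h)) (hp h) M
        have h2 := (pushComp F (ρ g) p p (hp g)).hom.naturality (E.iso h).hom
        rw [E.iso_mul, Functor.map_comp, Functor.map_comp, reassoc_of% h1]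
        change _ = ((pushComp F (ρ h) p p (hp h)).hom.app M ≫ (push F p).map (E.iso h).hom) ≫
          (pushComp F (ρ g) p p (hp g)).hom.app M ≫ (push F p).map (E.iso g).hom
        rw [Category.assoc, reassoc_of% h2] }

end Equivariant

section Spaces

variable {C : Type u₁} [Category.{v₁} C] [HasFiniteProducts C]

/-- The cartesian power `X^n`. -/
abbrev cartPow (X : C) (n : ℕ) : C := ∏ᶜ fun _ : Fin n => X

/-- The (left) action of the symmetric group on `X^n` permuting the factors:
`σ (x_0, …, x_{n-1})` has `i`-th component `x_{σ⁻¹ i}`. -/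
def permCartPow (X : C) (n : ℕ) : Equiv.Perm (Fin n) →* End (cartPow X n) where
  toFun σ := Pi.lift fun i => Pi.π (fun _ : Fin n => X) (σ⁻¹ i)
  map_one' := by
    apply limit.hom_ext
    rintro ⟨i⟩
    exact (limit.lift_π _ _).trans (Category.id_comp _).symm
  map_mul' σ τ := by
    apply Pi.hom_ext
    intro i
    change _ = (Pi.lift (fun i => Pi.π (fun _ : Fin n => X) (τ⁻¹ i)) ≫
      Pi.lift (fun i => Pi.π (fun _ : Fin n => X) (σ⁻¹ i))) ≫ Pi.π (fun _ : Fin n => X) i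
    rw [Category.assoc, Pi.lift_π, Pi.lift_π, Pi.lift_π, mul_inv_rev, Equiv.Perm.mul_apply]

variable (C) in
/-- A category of spaces in which all the symmetric products `X^n / Σ_n` exist, as quotients of
`X^n` by the action of the symmetric group. -/
class HasSymmetricProducts : Prop where
  hasColimit (X : C) (n : ℕ) : HasColimit (SingleObj.functor (permCartPow X n))

attribute [instance] HasSymmetricProducts.hasColimit

variable [HasSymmetricProducts C]

/-- The symmetric product `X^{(n)} = X^n / Σ_n`. -/
def symProd (X : C) (n : ℕ) : C := colimit (SingleObj.functor (permCartPow X n))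

/-- The projection `p_n : X^n ⟶ X^{(n)}`. -/
def symProj (X : C) (n : ℕ) : cartPow X n ⟶ symProd X n :=
  colimit.ι (SingleObj.functor (permCartPow X n)) (SingleObj.star (Equiv.Perm (Fin n)))

theorem perm_symProj (X : C) (n : ℕ) (σ : Equiv.Perm (Fin n)) :
    (permCartPow X n σ : cartPow X n ⟶ cartPow X n) ≫ symProj X n = symProj X n :=
  colimit.w (SingleObj.functor (permCartPow X n))
    (j := SingleObj.star (Equiv.Perm (Fin n))) (j' := SingleObj.star (Equiv.Perm (Fin n))) σ

end Spaces

section CoefficientTheory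

variable (C : Type u₁) [Category.{v₁} C] [HasFiniteProducts C]

/-- A coefficient theory `A` on a category of spaces:
* a covariant pseudofunctor `A` with values in pseudo-abelian `ℚ`-linear additive categories
  (an additive functor between such categories is automatically `ℚ`-linear);
* external products `⊠ⁿ : A(X)ⁿ → A(Xⁿ)` such that `M^{⊠ n}` is a `Σ_n`-equivariant object;
* a `ℚ`-linear symmetric monoidal structure on `A(pt)`;
* `Σ_n`-equivariant Künneth isomorphisms `k_*(M^{⊠ n}) ≅ (k_* M)^{⊗ n}` for the constant maps `k` to
  the point. -/
structure CoefficientTheory where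
  /-- The pseudofunctor `X ↦ A(X)`, `f ↦ f_*`. -/
  F : Pseudofunctor (LocallyDiscrete C) Cat.{v, u}
  [preadditive : ∀ X : C, Preadditive (Fib F X)]
  [linear : ∀ X : C, Linear ℚ (Fib F X)]
  [hasZeroObject : ∀ X : C, HasZeroObject (Fib F X)]
  [hasBinaryBiproducts : ∀ X : C, HasBinaryBiproducts (Fib F X)]
  [karoubian : ∀ X : C, IsIdempotentComplete (Fib F X)]
  [additive : ∀ {X Y : C} (f : X ⟶ Y), (push F f).Additive]
  /-- The external product of `n` objects of `A(X)`. -/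
  box (X : C) (n : ℕ) : (Fin n → Fib F X) ⥤ Fib F (cartPow X n)
  /-- The `Σ_n`-equivariant structure of `M^{⊠ n}`. -/
  boxEquivariant (X : C) (n : ℕ) (M : Fib F X) :
    EquivariantStructure F (permCartPow X n) ((box X n).obj fun _ => M)
  [monoidal : MonoidalCategory (Fib F (⊤_ C))]
  [symmetric : SymmetricCategory (Fib F (⊤_ C))]
  [monoidalPreadditive : MonoidalPreadditive (Fib F (⊤_ C))]
  [monoidalLinear : MonoidalLinear ℚ (Fib F (⊤_ C))]
  kunneth (X : C) (n : ℕ) (M : Fib F X) :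
    Nonempty (pushAction F (boxEquivariant X n M) (terminal.from _)
        (fun _ => Subsingleton.elim _ _) ≅
      tensorPowAction ((push F (terminal.from X)).obj M) n)

namespace CoefficientTheory

attribute [instance] preadditive linear hasZeroObject hasBinaryBiproducts karoubian additive
  monoidal symmetric monoidalPreadditive monoidalLinear

variable {C} [HasSymmetricProducts C] (A : CoefficientTheory.{v, u} C)

/-- The category `A(X)`. -/
abbrev Coeff (X : C) : Type u := Fib A.F X

/-- The push-forward to the point, `k_* : A(X) ⥤ A(pt)`. -/
abbrev toPt (X : C) : A.Coeff X ⥤ A.Coeff (⊤_ C) := push A.F (terminal.from X)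

/-- The object `p_{n*} M^{⊠ n}` of `A_{Σ_n}(X^{(n)})`. -/
def symPush {X : C} (n : ℕ) (M : A.Coeff X) : Action (A.Coeff (symProd X n)) (Equiv.Perm (Fin n)) :=
  pushAction A.F (A.boxEquivariant X n M) (symProj X n) (perm_symProj X n)

/-- The operation `φ_X : ob A(X) → K̄₀(A(X^{(n)}))` attached to a homomorphism
`φ : Rep_ℚ(Σ_n) → ℤ`. -/
def operation {X : C} (n : ℕ) (φ : RepRing (Equiv.Perm (Fin n)) →+ ℤ) (M : A.Coeff X) :
    K0 (A.Coeff (symProd X n)) :=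
  idTensor φ (decomp (A.Coeff (symProd X n)) n (K0.of (A.symPush n M)))

/-- The Adams-operation coefficients `Ψ_n(M) ∈ K̄₀(A(X^{(n)}))`, defined as the operation attached
to the trace `tr(g)` of an `n`-cycle `g`. -/
def adamsCoeff {X : C} (n : ℕ) (g : Equiv.Perm (Fin n)) (M : A.Coeff X) :
    K0 (A.Coeff (symProd X n)) :=
  A.operation n (tr g) M

end CoefficientTheory

end CoefficientTheory

section PreLambda

open PowerSeries

/-- A pre-lambda structure on a commutative ring `R`: a homomorphism `σ_t` from `(R, +)` to
`(R⟦t⟧, ·)` with `σ_t(a) = 1 + a t + ⋯`. -/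
structure PreLambda (R : Type*) [CommRing R] where
  /-- The series `σ_t(a)`. -/
  series : R → PowerSeries R
  series_zero : series 0 = 1
  series_add (a b : R) : series (a + b) = series a * series b
  coeff_zero (a : R) : coeff 0 (series a) = 1
  coeff_one (a : R) : coeff 1 (series a) = a

namespace PreLambda

variable {R : Type*} [CommRing R] (σ : PreLambda R)

/-- The opposite pre-lambda structure `λ_t = σ_{-t}⁻¹`. -/
def opp (a : R) : PowerSeries R := invOfUnit (rescale (-1) (σ.series a)) 1

/-- The `r`-th Adams operation (`r ≥ 1`), determined by
`λ_t(a)⁻¹ · d/dt λ_t(a) = ∑_{r ≥ 1} (-1)^{r-1} Ψ_r(a) t^{r-1}`. -/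
def adams (r : ℕ) (a : R) : R :=
  (-1) ^ (r - 1) * coeff (r - 1) (invOfUnit (σ.opp a) 1 * d⁄dX R (σ.opp a))

end PreLambda

/-- A pre-lambda structure on `K̄₀(T)`, for a pseudo-abelian `ℚ`-linear symmetric monoidal category
`T`, is the one given by symmetric powers if `σ_t([V]) = 1 + ∑_{n ≥ 1} [(V^{⊗ n})^{Σ_n}] tⁿ` for all
objects `V`. -/
def IsSymmetricPowers {T : Type u} [Category.{v} T] [Preadditive T] [Linear ℚ T] [HasZeroObject T]
    [HasBinaryBiproducts T] [IsIdempotentComplete T] [MonoidalCategory T] [SymmetricCategory T]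
    [MonoidalPreadditive T] (σ : PreLambda (K0 T)) : Prop :=
  ∀ (V : T) (n : ℕ), 1 ≤ n →
    PowerSeries.coeff n (σ.series (K0.of V)) = K0.of (invariants (tensorPowAction V n))

end PreLambda

end SymProd

end

open SymProd

/-! Put `V = k_* M`. Additive functors commute with images of projectors, and pushing forward along
`p_r` and then to the point is pushing forward to the point. With the Künneth isomorphism this gives
`k_*(Ψ_r(M)) = ∑_c tr(g | V_c) [e_c V^{⊗ r}]` (`CoefficientTheory.map_adamsCoeff`). It remains to
construct the pre-lambda structure and to identify this sum with its `r`-th Adams operation at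
`[V]`.

Both tasks are calculations with idempotents of `ℚ[Σ_r]`. The assignment `f ↦ [f V^{⊗ r}]` is
additive on orthogonal idempotents and invariant under Murray–von Neumann equivalence
(`IsIdemAdditive`). Hence it equals `∑_c n_c(f) [e_c V^{⊗ r}]`, where `n_c(f)` is determined by the
character of `V_c` at `f` (`IsIdemAdditive.exists_mult_char`). Relations between such classes can
therefore be checked on characters.

Let `f_k` antisymmetrize `k` letters and symmetrize the other `r - k`; its image on `V^{⊗ r}` has
class `[Sym^{r-k} V] [Λ^k V]`. For a class function `τ`, the number `(-1)^k τ(f_k)` is an average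
over `h ∈ Σ_r` and over the `h`-stable `k`-subsets, with a sign. The signed count of `h`-stable
subsets weighted by `t^k` is `∏ (1 - t^ℓ)` over the cycle lengths `ℓ` of `h`. Its value at `t = 1`
is zero, so the series of symmetric powers is invertible with inverse `∑ (-1)^k [Λ^k V] t^k`. Its
derivative at `t = 1` is supported on the `r`-cycles, so `τ(g) = -∑ k (-1)^k τ(f_k)`. Newton's
formula for `λ_t⁻¹ λ_t'` expresses `Ψ_r([V])` by the same combination of the classes `[Sym^{r-k} V]
[Λ^k V]`.

Over `ℚ`, the character at `f` is `n_c(f)` times the character at `e_c`, which is the dimension of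
`End(V_c)`. This factor is `1` whenever some `f_k` acts nontrivially on `V_c`
(`Irrep.char_idem_self_eq_one`). For all other `c` the multiplicities `n_c(f_k)` and `tr(g | V_c)`
vanish together. No classification of the representations of `Σ_r` is needed.

Multiplicativity of the series on `V ⊕ W` comes from decomposing `(V ⊕ W)^{⊗ n}` by subsets of the
letters and collecting orbits (`IsIdemAdditive.apply_symmetrizer`, `symClass_biprod`). Uniqueness
holds because every element is `[V] - [W]` and the series of `[W]` is invertible. -/

noncomputable section

namespace SymProd

/-! ### Classes in `K̄₀` of images of idempotents. -/

section IdempotentClass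

variable {T : Type u} [Category.{v} T] [Preadditive T] [HasZeroObject T] [HasBinaryBiproducts T]

theorem K0.of_iso {X Y : T} (e : X ≅ Y) : K0.of X = K0.of Y :=
  congrArg K0.ofClass (IsoClass.sound e)

theorem K0.of_biprod (X Y : T) : K0.of (X ⊞ Y) = K0.of X + K0.of Y :=
  map_add K0.ofClass (IsoClass.mk X) (IsoClass.mk Y)

open Classical in
/-- The class in `K̄₀` of the image of a split idempotent endomorphism (and `0` for an endomorphism
that is not a split idempotent). -/
def idemClass {X : T} (e : End X) : K0 T :=
  if h : ∃ (Y : T) (i : Y ⟶ X) (p : X ⟶ Y), i ≫ p = 𝟙 Y ∧ p ≫ i = e then K0.of h.choose else 0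

/-- The maps `u` and `w` restrict to mutually inverse isomorphisms of the images, because `u ≫ w`
and `w ≫ u` act as identities there. They are not required to vanish on the complements. -/
theorem K0.of_eq_of_mvn {X X' Y Y' : T} {i : Y ⟶ X} {p : X ⟶ Y} {i' : Y' ⟶ X'} {p' : X' ⟶ Y'}
    (h : i ≫ p = 𝟙 Y) (h' : i' ≫ p' = 𝟙 Y') (u : X ⟶ X') (w : X' ⟶ X)
    (huw : u ≫ w = p ≫ i) (hwu : w ≫ u = p' ≫ i') : K0.of Y = K0.of Y' := by
  have hi : i ≫ u ≫ w = i := by rw [huw, ← Category.assoc, h, Category.id_comp]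
  have hi' : i' ≫ w ≫ u = i' := by rw [hwu, ← Category.assoc, h', Category.id_comp]
  refine K0.of_iso ⟨i ≫ u ≫ p', i' ≫ w ≫ p, ?_, ?_⟩
  · calc (i ≫ u ≫ p') ≫ i' ≫ w ≫ p = i ≫ u ≫ (p' ≫ i') ≫ w ≫ p := by simp
      _ = (i ≫ u ≫ w) ≫ (u ≫ w) ≫ p := by rw [← hwu]; simp
      _ = 𝟙 _ := by rw [hi, huw, Category.assoc, h, Category.comp_id, h]
  · calc (i' ≫ w ≫ p) ≫ i ≫ u ≫ p' = i' ≫ w ≫ (p ≫ i) ≫ u ≫ p' := by simp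
      _ = (i' ≫ w ≫ u) ≫ (w ≫ u) ≫ p' := by rw [← huw]; simp
      _ = 𝟙 _ := by rw [hi', hwu, Category.assoc, h', Category.comp_id, h']

/-- This makes the class independent of the chosen splitting: `e` is equivalent to itself through `u
= w = e`. -/
theorem idemClass_eq {X Y : T} {e : End X} {i : Y ⟶ X} {p : X ⟶ Y} (h : i ≫ p = 𝟙 Y)
    (he : p ≫ i = e) : idemClass e = K0.of Y := by
  have hex : ∃ (Y : T) (i : Y ⟶ X) (p : X ⟶ Y), i ≫ p = 𝟙 Y ∧ p ≫ i = e := ⟨Y, i, p, h, he⟩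
  rw [idemClass, dif_pos hex]
  obtain ⟨j, q, hj, hq⟩ := hex.choose_spec
  have hm : e ≫ e = e := by rw [← he, Category.assoc, reassoc_of% h]
  exact K0.of_eq_of_mvn hj h e e (hm.trans hq.symm) (hm.trans he.symm)

theorem idemClass_id (X : T) : idemClass (𝟙 X : End X) = K0.of X :=
  idemClass_eq (Category.id_comp (𝟙 X)) (Category.id_comp (𝟙 X))

theorem idemClass_groupAlgebraAct {G : Type} [Group G] [Linear ℚ T] [IsIdempotentComplete T]
    (e : MonoidAlgebra ℚ G) (he : IsIdempotentElem e) (V : Action T G) :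
    idemClass (groupAlgebraAct V e) = K0.of ((imageFunctor e he).obj V) :=
  idemClass_eq (imageIncl_imageProj e he V) (imageProj_imageIncl e he V)

theorem groupAlgebraAct_of {A : Type u} [Category.{v} A] [Preadditive A] [Linear ℚ A] {G : Type}
    [Group G] (V : Action A G) (g : G) : groupAlgebraAct V (MonoidAlgebra.of ℚ G g) = V.ρ g :=
  MonoidAlgebra.lift_of _ _

theorem exists_splitting [IsIdempotentComplete T] {X : T} {e : End X} (he : e ≫ e = e) :
    ∃ (Y : T) (i : Y ⟶ X) (p : X ⟶ Y), i ≫ p = 𝟙 Y ∧ p ≫ i = e :=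
  IsIdempotentComplete.idempotents_split X e he

variable [IsIdempotentComplete T]

/-- Murray–von Neumann equivalent idempotents have the same class. -/
theorem idemClass_mvn {X Y : T} {e : End X} {f : End Y} (he : e ≫ e = e) (hf : f ≫ f = f)
    (u : X ⟶ Y) (w : Y ⟶ X) (huw : u ≫ w = e) (hwu : w ≫ u = f) : idemClass e = idemClass f := by
  obtain ⟨A, i, p, h, h'⟩ := exists_splitting he
  obtain ⟨B, j, q, k, k'⟩ := exists_splitting hf
  rw [idemClass_eq h h', idemClass_eq k k']
  exact K0.of_eq_of_mvn h k u w (huw.trans h'.symm) (hwu.trans k'.symm)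

theorem idemClass_conj {X Y : T} {e : End X} {f : End Y} (he : e ≫ e = e) (φ : X ≅ Y)
    (h : (e : X ⟶ X) ≫ φ.hom = φ.hom ≫ (f : Y ⟶ Y)) : idemClass e = idemClass f := by
  have hf : (f : Y ⟶ Y) = φ.inv ≫ (e : X ⟶ X) ≫ φ.hom := by rw [h, φ.inv_hom_id_assoc]
  refine idemClass_mvn he ?_ ((e : X ⟶ X) ≫ φ.hom) φ.inv (by simp) hf.symm
  rw [hf]
  simp only [Category.assoc, Iso.hom_inv_id_assoc, reassoc_of% he]

/-- Orthogonality kills the cross maps between the two images, so their biproduct splits `e + f`. -/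
theorem idemClass_add {X : T} {e f : End X} (he : e ≫ e = e) (hf : f ≫ f = f)
    (hef : e ≫ f = 0) (hfe : f ≫ e = 0) : idemClass (e + f) = idemClass e + idemClass f := by
  obtain ⟨A, i, p, h, h'⟩ := exists_splitting he
  obtain ⟨B, j, q, k, k'⟩ := exists_splitting hf
  rw [idemClass_eq h h', idemClass_eq k k', ← K0.of_biprod]
  -- Inserting `i ≫ p = 𝟙` and `j ≫ q = 𝟙` exposes the factor `e ≫ f`.
  have hiq : i ≫ q = 0 := by
    calc i ≫ q = (i ≫ p) ≫ i ≫ q ≫ (j ≫ q) := by simp [h, k]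
      _ = i ≫ ((p ≫ i) ≫ (q ≫ j)) ≫ q := by simp
      _ = 0 := by rw [h', k', hef]; simp
  have hjp : j ≫ p = 0 := by
    calc j ≫ p = (j ≫ q) ≫ j ≫ p ≫ (i ≫ p) := by simp [h, k]
      _ = j ≫ ((q ≫ j) ≫ (p ≫ i)) ≫ p := by simp
      _ = 0 := by rw [h', k', hfe]; simp
  refine idemClass_eq (i := biprod.desc i j) (p := biprod.lift p q) ?_ ?_
  · apply biprod.hom_ext <;> apply biprod.hom_ext' <;> simp [h, k, hiq, hjp]
  · rw [biprod.lift_desc, h', k']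

theorem K0.map_idemClass {S : Type u₁} [Category.{v₁} S] [Preadditive S] [HasZeroObject S]
    [HasBinaryBiproducts S] (F : T ⥤ S) [F.Additive] {X : T} {e : End X} (he : e ≫ e = e) :
    K0.map F (idemClass e) = idemClass (F.map e : End (F.obj X)) := by
  obtain ⟨A, i, p, h, h'⟩ := exists_splitting he
  rw [idemClass_eq h h', K0.map_of]
  refine (idemClass_eq (i := F.map i) (p := F.map p) ?_ ?_).symm
  · rw [← F.map_comp, h, F.map_id]
  · rw [← F.map_comp, h']

theorem idemClass_tensor [MonoidalCategory T] [SymmetricCategory T] [MonoidalPreadditive T]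
    {X Y : T} {e : End X} {f : End Y} (he : e ≫ e = e) (hf : f ≫ f = f) :
    idemClass (MonoidalCategoryStruct.tensorHom (C := T) e f : End (X ⊗ Y)) =
      idemClass e * idemClass f := by
  obtain ⟨A, i, p, h, h'⟩ := exists_splitting he
  obtain ⟨B, j, q, k, k'⟩ := exists_splitting hf
  rw [idemClass_eq h h', idemClass_eq k k']
  refine (idemClass_eq (i := MonoidalCategoryStruct.tensorHom i j)
    (p := MonoidalCategoryStruct.tensorHom p q) ?_ ?_).trans
    (K0.ofClass_mul (IsoClass.mk A) (IsoClass.mk B)).symm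
  · rw [tensorHom_comp_tensorHom, h, k, id_tensorHom_id]
  · rw [tensorHom_comp_tensorHom, h', k']

/-- A function on a ring with values in an abelian group that behaves, on idempotents, like the
class of the image: it is additive on orthogonal idempotents and invariant under Murray–von Neumann
equivalence. -/
structure IsIdemAdditive {R B : Type*} [Ring R] [AddCommGroup B] (Φ : R → B) : Prop where
  add {e f : R} : IsIdempotentElem e → IsIdempotentElem f → e * f = 0 → f * e = 0 →
    Φ (e + f) = Φ e + Φ f
  mvn {a b : R} : IsIdempotentElem (a * b) → IsIdempotentElem (b * a) → Φ (a * b) = Φ (b * a)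

theorem isIdemAdditive_idemClass (X : T) : IsIdemAdditive (idemClass (T := T) (X := X)) where
  add he hf hef hfe := idemClass_add he hf hfe hef
  mvn {a b} h h' := idemClass_mvn h h' b a rfl rfl

end IdempotentClass

/-! ### Formal properties of functions that behave like the class of the image. -/

namespace IsIdemAdditive

variable {R S B B' : Type*} [Ring R] [Ring S] [AddCommGroup B] [AddCommGroup B']

theorem map_zero {Φ : R → B} (h : IsIdemAdditive Φ) : Φ 0 = 0 := by
  have := h.add (e := 0) (f := 0) (mul_zero 0) (mul_zero 0) (mul_zero 0) (mul_zero 0)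
  simpa using this

theorem comp {Φ : R → B} (h : IsIdemAdditive Φ) (φ : S →+* R) : IsIdemAdditive (Φ ∘ φ) where
  add {e f} he hf hef hfe := by
    simp only [Function.comp_apply, map_add]
    exact h.add (he.map φ) (hf.map φ) (by rw [← map_mul, hef, _root_.map_zero])
      (by rw [← map_mul, hfe, _root_.map_zero])
  mvn {a b} hab hba := by
    simp only [Function.comp_apply, map_mul]
    exact h.mvn (by rw [← map_mul]; exact hab.map φ) (by rw [← map_mul]; exact hba.map φ)

/-- Pairing allows one family of multiplicities to serve for a class in `K̄₀` and for all characters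
at once. -/
theorem prodMk {Φ : R → B} {Φ' : R → B'} (h : IsIdemAdditive Φ) (h' : IsIdemAdditive Φ') :
    IsIdemAdditive fun x => (Φ x, Φ' x) where
  add he hf hef hfe := Prod.ext (h.add he hf hef hfe) (h'.add he hf hef hfe)
  mvn hab hba := Prod.ext (h.mvn hab hba) (h'.mvn hab hba)

theorem pi {ι : Type*} {Φ : ι → R → B} (h : ∀ i, IsIdemAdditive (Φ i)) :
    IsIdemAdditive fun x i => Φ i x where
  add he hf hef hfe := funext fun i => (h i).add he hf hef hfe
  mvn hab hba := funext fun i => (h i).mvn hab hba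

/-- Additivity on finite orthogonal families of idempotents. -/
theorem sum {Φ : R → B} (h : IsIdemAdditive Φ) {ι : Type*} (s : Finset ι) (e : ι → R)
    (he : ∀ i ∈ s, IsIdempotentElem (e i)) (hij : ∀ i ∈ s, ∀ j ∈ s, i ≠ j → e i * e j = 0) :
    Φ (∑ i ∈ s, e i) = ∑ i ∈ s, Φ (e i) := by
  classical
  have key : IsIdempotentElem (∑ i ∈ s, e i) ∧ Φ (∑ i ∈ s, e i) = ∑ i ∈ s, Φ (e i) := by
    induction s using Finset.induction_on with
    | empty => simpa using ⟨IsIdempotentElem.zero, h.map_zero⟩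
    | insert i s hi ih =>
      obtain ⟨h1, h2⟩ := ih (fun j hj => he j (Finset.mem_insert_of_mem hj))
        (fun j hj k hk => hij j (Finset.mem_insert_of_mem hj) k (Finset.mem_insert_of_mem hk))
      have hne : ∀ j ∈ s, i ≠ j := fun j hj hij => hi (hij ▸ hj)
      have h3 : e i * ∑ j ∈ s, e j = 0 := by
        rw [Finset.mul_sum]
        exact Finset.sum_eq_zero fun j hj => hij i (Finset.mem_insert_self _ _) j
          (Finset.mem_insert_of_mem hj) (hne j hj)
      have h4 : (∑ j ∈ s, e j) * e i = 0 := by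
        rw [Finset.sum_mul]
        exact Finset.sum_eq_zero fun j hj => hij j (Finset.mem_insert_of_mem hj) i
          (Finset.mem_insert_self _ _) (hne j hj).symm
      have h5 := he i (Finset.mem_insert_self _ _)
      rw [Finset.sum_insert hi, Finset.sum_insert hi]
      refine ⟨?_, by rw [h.add h5 h1 h3 h4, h2]⟩
      rw [IsIdempotentElem, mul_add, add_mul, add_mul, h3, h4, h5.eq, h1.eq, add_zero, zero_add]
  exact key.2

theorem of_trace {τ : R →+ B} (h : ∀ x y, τ (x * y) = τ (y * x)) : IsIdemAdditive τ where
  add _ _ _ _ := map_add τ _ _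
  mvn _ _ := h _ _

end IsIdemAdditive

/-! ### Decomposition of idempotents of `ℚ[G]` into primitive ones. -/

section Multiplicities

variable {G : Type} [Group G] [Finite G]

/-- Take the isotypic component of `S` itself as `c`. It is also the isotypic component of
`c.ideal`, so its simple submodule `S` is isomorphic to `c.ideal`. -/
theorem Irrep.exists_equiv_ideal {S : Submodule (MonoidAlgebra ℚ G) (MonoidAlgebra ℚ G)}
    (hS : IsSimpleModule (MonoidAlgebra ℚ G) S) :
    ∃ c : Irrep G, Nonempty (S ≃ₗ[MonoidAlgebra ℚ G] c.ideal) := by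
  let c : Irrep G := ⟨isotypicComponent (MonoidAlgebra ℚ G) (MonoidAlgebra ℚ G) S, S, hS, rfl⟩
  have h := c.ideal_spec
  have := h.1
  refine ⟨c, isIsotypicOfType_submodule_iff.1 (.isotypicComponent (MonoidAlgebra ℚ G)
    (MonoidAlgebra ℚ G) c.ideal) S ?_⟩
  rw [← h.2]
  exact S.le_isotypicComponent

theorem Irrep.eq_of_equiv {c c' : Irrep G} (e : c.ideal ≃ₗ[MonoidAlgebra ℚ G] c'.ideal) :
    c = c' :=
  Subtype.ext (c.ideal_spec.2.trans (e.isotypicComponent_eq.trans c'.ideal_spec.2.symm))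

theorem Irrep.ideal_eq_span (c : Irrep G) : c.ideal = Ideal.span {c.idem} :=
  c.exists_idem.choose_spec.2

theorem Irrep.idem_mem (c : Irrep G) : c.idem ∈ c.ideal := by
  rw [c.ideal_eq_span]
  exact Ideal.mem_span_singleton_self _

theorem mul_eq_of_mem_span {R : Type*} [Ring R] {e x : R} (he : IsIdempotentElem e)
    (hx : x ∈ Ideal.span {e}) : x * e = x := by
  obtain ⟨a, rfl⟩ := Ideal.mem_span_singleton'.1 hx
  rw [mul_assoc, he.eq]

/-- Idempotents generating isomorphic left ideals are Murray–von Neumann equivalent. -/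
theorem exists_mvn_of_equiv {R : Type*} [Ring R] {s e : R} (hs : IsIdempotentElem s)
    (he : IsIdempotentElem e) {S E : Submodule R R} (hS : S = Ideal.span {s})
    (hE : E = Ideal.span {e}) (φ : S ≃ₗ[R] E) : ∃ a b : R, a * b = s ∧ b * a = e := by
  have hsS : s ∈ S := hS ▸ Ideal.mem_span_singleton_self s
  have heE : e ∈ E := hE ▸ Ideal.mem_span_singleton_self e
  have h1 : ∀ x : S, (x : R) * s = x := fun x => mul_eq_of_mem_span hs (hS ▸ x.2)
  have h2 : ∀ x : E, (x : R) * e = x := fun x => mul_eq_of_mem_span he (hE ▸ x.2)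
  have h3 : ((φ ⟨s, hsS⟩ : E) : R) • φ.symm ⟨e, heE⟩ = ⟨s, hsS⟩ := by
    rw [← map_smul, LinearEquiv.symm_apply_eq]
    exact Subtype.ext (h2 _)
  have h4 : ((φ.symm ⟨e, heE⟩ : S) : R) • φ ⟨s, hsS⟩ = ⟨e, heE⟩ := by
    rw [← map_smul, ← LinearEquiv.eq_symm_apply]
    exact Subtype.ext (h1 _)
  exact ⟨φ ⟨s, hsS⟩, φ.symm ⟨e, heE⟩, congrArg Subtype.val h3, congrArg Subtype.val h4⟩

/-- A summand of the left ideal generated by an idempotent splits off an idempotent. -/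
theorem exists_idem_of_le {R : Type*} [Ring R] [IsSemisimpleRing R] {f : R}
    (hf : IsIdempotentElem f) {S : Submodule R R} (hS : S ≤ Ideal.span {f}) :
    ∃ s c : R, f = s + c ∧ IsIdempotentElem s ∧ IsIdempotentElem c ∧ s * c = 0 ∧ c * s = 0 ∧
      S = Ideal.span {s} := by
  obtain ⟨C, hC⟩ := exists_isCompl S
  -- The candidates are the components of `f` along `S` and a complement. All the required relations
  -- follow by comparing components in `S ⊕ C`.
  obtain ⟨s, hs, c, hc, hsc⟩ := Submodule.mem_sup.1
    (show f ∈ S ⊔ C by rw [hC.sup_eq_top]; trivial)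
  have hz : ∀ x, x ∈ S → x ∈ C → x = 0 := fun x h1 h2 => Submodule.disjoint_def.1 hC.disjoint x h1 h2
  have hSf : ∀ x ∈ S, x * f = x := fun x hx => mul_eq_of_mem_span hf (hS hx)
  have hxs : ∀ x ∈ S, x * c = 0 := fun x hx => by
    have h1 : x * c = x - x * s := by rw [eq_sub_iff_add_eq, ← mul_add, add_comm c, hsc, hSf x hx]
    refine hz _ ?_ (C.smul_mem x hc)
    rw [h1]
    exact S.sub_mem hx (S.smul_mem x hs)
  have hcf : c * f = c := by
    rw [eq_sub_of_add_eq' hsc, sub_mul, hf.eq, hSf s hs]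
  have hcs : c * s = 0 := by
    have h1 : c * s = c - c * c := by rw [eq_sub_iff_add_eq, ← mul_add, hsc, hcf]
    refine hz _ (S.smul_mem c hs) ?_
    rw [h1]
    exact C.sub_mem hc (C.smul_mem c hc)
  have hxx : ∀ x ∈ S, x * s = x := fun x hx => by
    conv_rhs => rw [← hSf x hx, ← hsc, mul_add, hxs x hx, add_zero]
  refine ⟨s, c, hsc.symm, hxx s hs, ?_, hxs s hs, hcs, le_antisymm ?_ ?_⟩
  · have h : c * (s + c) = c := by rw [hsc, hcf]
    rwa [mul_add, hcs, zero_add] at h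
  · intro x hx
    exact Ideal.mem_span_singleton'.2 ⟨x, hxx x hx⟩
  · exact (Ideal.span_singleton_le_iff_mem S).2 hs

/-- An idempotent of the group algebra is, up to Murray–von Neumann equivalence, an orthogonal sum
of the primitive idempotents `e_c`. -/
theorem IsIdemAdditive.exists_mult [Fintype (Irrep G)] {B : Type*} [AddCommGroup B]
    {Φ : MonoidAlgebra ℚ G → B} (h : IsIdemAdditive Φ) {f : MonoidAlgebra ℚ G}
    (hf : IsIdempotentElem f) : ∃ n : Irrep G → ℕ, Φ f = ∑ c, n c • Φ c.idem := by
  classical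
  -- The ring is artinian, and splitting a simple summand off the left ideal generated by `f` makes
  -- it strictly smaller.
  induction hI : (Ideal.span {f} : Submodule (MonoidAlgebra ℚ G) (MonoidAlgebra ℚ G)) using
    WellFoundedLT.induction generalizing f with
  | ind I ih =>
  subst hI
  rcases IsSemisimpleModule.eq_bot_or_exists_simple_le (Ideal.span {f}) with h0 | ⟨S, hS, hsimp⟩
  · refine ⟨0, ?_⟩
    rw [Ideal.span_singleton_eq_bot.1 h0, h.map_zero]
    simp
  · obtain ⟨s, c, rfl, hs, hc, hsc, hcs, hSs⟩ := exists_idem_of_le hf hS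
    obtain ⟨i, ⟨φ⟩⟩ := Irrep.exists_equiv_ideal hsimp
    obtain ⟨a, b, hab, hba⟩ := exists_mvn_of_equiv hs i.isIdempotentElem_idem hSs i.ideal_eq_span φ
    have hlt : Ideal.span {c} < Ideal.span {s + c} := by
      refine lt_of_le_of_ne ?_ fun heq => ?_
      · refine (Ideal.span_singleton_le_iff_mem _).2 (Ideal.mem_span_singleton'.2 ⟨c, ?_⟩)
        rw [mul_add, hcs, zero_add, hc.eq]
      · have h1 := mul_eq_of_mem_span hc (heq.symm ▸ Ideal.mem_span_singleton_self (s + c))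
        rw [add_mul, hsc, zero_add, hc.eq] at h1
        have h2 : s = 0 := by simpa using h1.symm
        rw [h2] at hSs
        have h3 : S = ⊥ := hSs.trans (Ideal.span_singleton_eq_bot.2 rfl)
        have := IsSimpleModule.nontrivial (MonoidAlgebra ℚ G) S
        exact Submodule.nontrivial_iff_ne_bot.1 this h3
    obtain ⟨n, hn⟩ := ih _ hlt hc rfl
    refine ⟨n + Pi.single i 1, ?_⟩
    have hΦ : Φ s = Φ i.idem := by
      rw [← hab, ← hba]
      exact h.mvn (hab ▸ hs) (hba ▸ i.isIdempotentElem_idem)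
    rw [h.add hs hc hsc hcs, hn, hΦ]
    simp only [Pi.add_apply, add_smul, Finset.sum_add_distrib, Pi.single_apply, ite_smul, one_smul,
      zero_smul, Finset.sum_ite_eq', Finset.mem_univ, if_true]
    exact add_comm _ _

end Multiplicities

/-! ### Characters of irreducible representations at idempotents. -/

section Traces

variable {G : Type} [Group G] [Finite G]

instance (c : Irrep G) : Module.Finite ℚ c.ideal :=
  have := Fintype.ofFinite G
  have : Module.Finite ℚ (MonoidAlgebra ℚ G) := inferInstance
  inferInstanceAs (Module.Finite ℚ (c.ideal.restrictScalars ℚ))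

/-- The action of the group algebra on the irreducible representation `V_c`. -/
def Irrep.act (c : Irrep G) : MonoidAlgebra ℚ G →ₐ[ℚ] Module.End ℚ c.ideal :=
  Algebra.lsmul ℚ ℚ c.ideal

/-- The character of `V_c`, on the group algebra. -/
def Irrep.char (c : Irrep G) : MonoidAlgebra ℚ G →ₗ[ℚ] ℚ :=
  (LinearMap.trace ℚ c.ideal).comp c.act.toLinearMap

theorem Irrep.char_mul_comm (c : Irrep G) (x y : MonoidAlgebra ℚ G) :
    c.char (x * y) = c.char (y * x) := by
  simp only [Irrep.char, LinearMap.comp_apply, AlgHom.toLinearMap_apply, map_mul]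
  exact LinearMap.trace_mul_comm ℚ _ _

theorem Irrep.char_of (c : Irrep G) (g : G) :
    c.char (MonoidAlgebra.of ℚ G g) = c.rep.character g := rfl

theorem trace_eq_finrank_range {V : Type*} [AddCommGroup V] [Module ℚ V] [Module.Finite ℚ V]
    {f : Module.End ℚ V} (hf : IsIdempotentElem f) :
    LinearMap.trace ℚ V f = Module.finrank ℚ (LinearMap.range f) :=
  (LinearMap.IsIdempotentElem.isProj_range _ hf).trace

theorem finrank_le_one_of_le_span {V : Type*} [AddCommGroup V] [Module ℚ V] [Module.Finite ℚ V]
    {W : Submodule ℚ V} {v : V} (h : W ≤ Submodule.span ℚ {v}) : Module.finrank ℚ W ≤ 1 :=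
  (Submodule.finrank_mono h).trans ((finrank_span_le_card ({v} : Set V)).trans_eq (by simp))

theorem Irrep.char_idem_eq (c : Irrep G) {e : MonoidAlgebra ℚ G} (he : IsIdempotentElem e) :
    c.char e = Module.finrank ℚ (LinearMap.range (c.act e)) :=
  trace_eq_finrank_range (he.map c.act)

/-- In characteristic zero the trace of a projector detects its rank. -/
theorem Irrep.char_eq_zero_iff (c : Irrep G) {e : MonoidAlgebra ℚ G} (he : IsIdempotentElem e) :
    c.char e = 0 ↔ ∀ x : c.ideal, e • x = 0 := by
  rw [c.char_idem_eq he, Nat.cast_eq_zero, Submodule.finrank_eq_zero, LinearMap.range_eq_bot]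
  exact LinearMap.ext_iff

/-- Schur's lemma: `e • x` is the value at `e` of the linear map `s ↦ s • x` from `S` to `M`, which
must vanish. -/
theorem smul_eq_zero_of_simple {R : Type*} [Ring R] {S : Submodule R R} {M : Type*}
    [AddCommGroup M] [Module R M] (hS : IsSimpleModule R S) (hM : IsSimpleModule R M)
    (h : ¬ Nonempty (S ≃ₗ[R] M)) {e : R} (he : e ∈ S) (x : M) : e • x = 0 := by
  rcases LinearMap.bijective_or_eq_zero ((LinearMap.toSpanSingleton R M x).comp S.subtype) with
    hφ | hφ
  · exact absurd ⟨LinearEquiv.ofBijective _ hφ⟩ h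
  · exact DFunLike.congr_fun hφ ⟨e, he⟩

theorem Irrep.char_idem_of_ne {c c' : Irrep G} (h : c ≠ c') : c'.char c.idem = 0 := by
  rw [c'.char_eq_zero_iff c.isIdempotentElem_idem]
  intro x
  refine smul_eq_zero_of_simple c.ideal_spec.1 c'.ideal_spec.1 ?_ c.idem_mem x
  rintro ⟨φ⟩
  exact h (Irrep.eq_of_equiv φ)

theorem Irrep.exists_smul_eq (c : Irrep G) {v : c.ideal} (hv : v ≠ 0) (w : c.ideal) :
    ∃ x : MonoidAlgebra ℚ G, x • v = w := by
  have := c.ideal_spec.1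
  exact LinearMap.mem_range.1 ((IsSimpleModule.toSpanSingleton_surjective (MonoidAlgebra ℚ G) hv) w)

theorem Irrep.exists_fixed_of_char_ne (c : Irrep G) {e : MonoidAlgebra ℚ G}
    (he : IsIdempotentElem e) (h : c.char e ≠ 0) : ∃ v : c.ideal, v ≠ 0 ∧ e • v = v := by
  rw [Ne, c.char_eq_zero_iff he] at h
  push Not at h
  obtain ⟨x, hx⟩ := h
  exact ⟨e • x, hx, by rw [smul_smul, he.eq]⟩

/-- If `v ≠ 0` is fixed by `f`, then it generates `V_c`, so `e V_c = e ℚ[G] f v = 0`. -/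
theorem Irrep.char_eq_zero_of_mul (c : Irrep G) {e f : MonoidAlgebra ℚ G}
    (he : IsIdempotentElem e) (hf : IsIdempotentElem f) (h : ∀ x, e * x * f = 0)
    (hc : c.char f ≠ 0) : c.char e = 0 := by
  rw [c.char_eq_zero_iff he]
  obtain ⟨v, hv, hfv⟩ := c.exists_fixed_of_char_ne hf hc
  intro w
  obtain ⟨x, rfl⟩ := c.exists_smul_eq hv w
  rw [← hfv, smul_smul, smul_smul, h, zero_smul]

/-- With `v` fixed by `f` and generating `V_c`, the image `e V_c = e ℚ[G] f v` lies on the line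
through `e f v`, so `e` has rank at most one. -/
theorem Irrep.char_eq_one_of_mul (c : Irrep G) {e f : MonoidAlgebra ℚ G}
    (he : IsIdempotentElem e) (hf : IsIdempotentElem f)
    (h : ∀ x, ∃ q : ℚ, e * x * f = q • (e * f)) (hc : c.char f ≠ 0) (hc' : c.char e ≠ 0) :
    c.char e = 1 := by
  obtain ⟨v, hv, hfv⟩ := c.exists_fixed_of_char_ne hf hc
  rw [c.char_idem_eq he] at hc' ⊢
  have hle : LinearMap.range (c.act e) ≤ Submodule.span ℚ {(e * f) • v} := by
    rintro _ ⟨w, rfl⟩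
    obtain ⟨x, rfl⟩ := c.exists_smul_eq hv w
    obtain ⟨q, hq⟩ := h x
    refine Submodule.mem_span_singleton.2 ⟨q, ?_⟩
    change _ = e • x • v
    rw [← smul_assoc, ← hq]
    conv_rhs => rw [← hfv]
    simp only [smul_smul, mul_assoc]
  have h1 := finrank_le_one_of_le_span hle
  rw [Nat.cast_ne_zero] at hc'
  rw [show Module.finrank ℚ (LinearMap.range (c.act e)) = 1 by omega, Nat.cast_one]

end Traces

/-! ### Idempotents attached to sign characters. -/

section CharIdem

variable {H H' G : Type} [Group H] [Group H'] [Fintype H] [Fintype H'] [Group G]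

/-- The sign `±1` as a rational number. -/
def unitRat : ℤˣ →* ℚ := (Int.castRingHom ℚ : ℤ →* ℚ).comp (Units.coeHom ℤ)

theorem unitRat_mul_self (u : ℤˣ) : unitRat u * unitRat u = 1 := by
  rw [← map_mul, Int.units_mul_self, map_one]

/-- The idempotent `|H|⁻¹ ∑ ε(h) θ(h)` of the group algebra of `G`, for a homomorphism `θ : H → G`
and a sign character `ε` of `H`. -/
def charIdem (θ : H →* G) (ε : H →* ℤˣ) : MonoidAlgebra ℚ G :=
  (Fintype.card H : ℚ)⁻¹ • ∑ h : H, unitRat (ε h) • MonoidAlgebra.of ℚ G (θ h)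

theorem of_mul_charIdem (θ : H →* G) (ε : H →* ℤˣ) (h : H) :
    MonoidAlgebra.of ℚ G (θ h) * charIdem θ ε = unitRat (ε h) • charIdem θ ε := by
  rw [charIdem, mul_smul_comm, smul_comm, Finset.mul_sum,
    Finset.smul_sum (r := unitRat (ε h))]
  refine congrArg _ (Fintype.sum_equiv (Equiv.mulLeft h) _ _ fun k => ?_)
  rw [Equiv.coe_mulLeft, mul_smul_comm, smul_smul, map_mul ε, map_mul unitRat, ← mul_assoc,
    unitRat_mul_self, one_mul, map_mul, map_mul]

theorem charIdem_mul_of (θ : H →* G) (ε : H →* ℤˣ) (h : H) :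
    charIdem θ ε * MonoidAlgebra.of ℚ G (θ h) = unitRat (ε h) • charIdem θ ε := by
  rw [charIdem, smul_mul_assoc, smul_comm, Finset.sum_mul,
    Finset.smul_sum (r := unitRat (ε h))]
  refine congrArg _ (Fintype.sum_equiv (Equiv.mulRight h) _ _ fun k => ?_)
  rw [Equiv.coe_mulRight, smul_mul_assoc, smul_smul, map_mul ε, map_mul unitRat, mul_comm, mul_assoc,
    unitRat_mul_self, mul_one, map_mul, map_mul]

theorem isIdempotentElem_charIdem (θ : H →* G) (ε : H →* ℤˣ) :
    IsIdempotentElem (charIdem θ ε) := by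
  rw [IsIdempotentElem]
  conv_lhs => enter [1]; rw [charIdem]
  simp only [smul_mul_assoc, Finset.sum_mul, of_mul_charIdem, smul_smul, unitRat_mul_self,
    Finset.sum_const, Finset.card_univ, one_smul]
  rw [← Nat.cast_smul_eq_nsmul ℚ, smul_smul, inv_mul_cancel₀ (by simp), one_smul]

theorem charIdem_comp (θ : H →* G) (ε : H →* ℤˣ) (e : H' ≃* H) :
    charIdem (θ.comp e.toMonoidHom) (ε.comp e.toMonoidHom) = charIdem θ ε := by
  rw [charIdem, charIdem, Fintype.card_congr e.toEquiv]
  congr 1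
  exact Fintype.sum_equiv e.toEquiv _ _ fun k => rfl

theorem symIdem_eq_charIdem (G : Type) [Group G] [Fintype G] :
    symIdem G = charIdem (MonoidHom.id G) 1 := by
  simp [symIdem, charIdem]

/-- If `θ h x = x θ' h'` with opposite signs of `h` and `h'`, then `f x f' = 0`. -/
theorem charIdem_mul_mul_eq_zero {θ : H →* G} {ε : H →* ℤˣ} {θ' : H' →* G} {ε' : H' →* ℤˣ}
    {x : G} {h : H} {h' : H'} (hx : θ h * x = x * θ' h') (hε : ε h = -ε' h') :
    charIdem θ ε * MonoidAlgebra.of ℚ G x * charIdem θ' ε' = 0 := by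
  have h1 : charIdem θ ε * MonoidAlgebra.of ℚ G (θ h * x) * charIdem θ' ε' =
      unitRat (ε h) • (charIdem θ ε * MonoidAlgebra.of ℚ G x * charIdem θ' ε') := by
    rw [map_mul, ← mul_assoc, charIdem_mul_of, smul_mul_assoc, smul_mul_assoc]
  have h2 : charIdem θ ε * MonoidAlgebra.of ℚ G (x * θ' h') * charIdem θ' ε' =
      unitRat (ε' h') • (charIdem θ ε * MonoidAlgebra.of ℚ G x * charIdem θ' ε') := by
    rw [map_mul, ← mul_assoc, mul_assoc, of_mul_charIdem, mul_smul_comm]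
  rw [hx, h2, hε] at h1
  have h3 : unitRat (-ε' h') = -unitRat (ε' h') := by simp [unitRat]
  rw [h3, neg_smul, eq_neg_iff_add_eq_zero, ← add_smul, smul_eq_zero] at h1
  refine h1.resolve_left ?_
  have := unitRat_mul_self (ε' h')
  intro h0
  have h4 : unitRat (ε' h') = 0 := by linarith
  rw [h4] at this
  simp at this

end CharIdem

/-! ### The idempotents antisymmetrizing `B` and symmetrizing its complement. -/

section SplitIdem

variable {α : Type} [Fintype α] [DecidableEq α]

/-- The homomorphism `Σ_B × Σ_{Bᶜ} → Σ_α`. -/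
abbrev splitHom (B : Finset α) :
    Equiv.Perm {x // x ∈ B} × Equiv.Perm {x // x ∉ B} →* Equiv.Perm α :=
  Equiv.Perm.subtypeCongrHom (· ∈ B)

/-- The character of `Σ_B × Σ_{Bᶜ}` given by the sign on the first factor. -/
abbrev splitSign (B : Finset α) : Equiv.Perm {x // x ∈ B} × Equiv.Perm {x // x ∉ B} →* ℤˣ :=
  Equiv.Perm.sign.comp (MonoidHom.fst _ _)

/-- The idempotent which antisymmetrizes over `B` and symmetrizes over the complement of `B`. -/
def splitIdem (B : Finset α) : MonoidAlgebra ℚ (Equiv.Perm α) :=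
  charIdem (splitHom B) (splitSign B)

theorem isIdempotentElem_splitIdem (B : Finset α) : IsIdempotentElem (splitIdem B) :=
  isIdempotentElem_charIdem _ _

theorem splitHom_apply_mem {B : Finset α} (p : Equiv.Perm {x // x ∈ B} × Equiv.Perm {x // x ∉ B})
    {x : α} (hx : x ∈ B) : splitHom B p x = p.1 ⟨x, hx⟩ :=
  Equiv.Perm.subtypeCongr.left_apply _ _ hx

theorem splitHom_apply_notMem {B : Finset α}
    (p : Equiv.Perm {x // x ∈ B} × Equiv.Perm {x // x ∉ B}) {x : α} (hx : x ∉ B) :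
    splitHom B p x = p.2 ⟨x, hx⟩ :=
  Equiv.Perm.subtypeCongr.right_apply _ _ hx

theorem splitHom_apply_mem_iff {B : Finset α}
    (p : Equiv.Perm {x // x ∈ B} × Equiv.Perm {x // x ∉ B}) (x : α) :
    splitHom B p x ∈ B ↔ x ∈ B := by
  by_cases hx : x ∈ B
  · rw [splitHom_apply_mem p hx]
    exact iff_of_true (Subtype.prop _) hx
  · rw [splitHom_apply_notMem p hx]
    exact iff_of_false (Subtype.prop (p.2 ⟨x, hx⟩)) hx

theorem exists_splitHom_eq {B : Finset α} {h : Equiv.Perm α} (hB : ∀ x, h x ∈ B ↔ x ∈ B) :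
    splitHom B (h.subtypePerm hB, h.subtypePerm fun x => not_congr (hB x)) = h := by
  ext x
  by_cases hx : x ∈ B
  · rw [splitHom_apply_mem _ hx]
    rfl
  · rw [splitHom_apply_notMem _ hx]
    rfl

theorem splitHom_swap_mem {B : Finset α} {p q : α} (hp : p ∈ B) (hq : q ∈ B) :
    splitHom B (Equiv.swap ⟨p, hp⟩ ⟨q, hq⟩, 1) = Equiv.swap p q := by
  ext x
  by_cases hx : x ∈ B
  · rw [splitHom_apply_mem _ hx]
    simp only [Equiv.swap_apply_def, Subtype.mk.injEq]
    split_ifs <;> rfl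
  · rw [splitHom_apply_notMem _ hx, Equiv.swap_apply_of_ne_of_ne]
    · rfl
    · rintro rfl; exact hx hp
    · rintro rfl; exact hx hq

theorem splitHom_swap_notMem {B : Finset α} {p q : α} (hp : p ∉ B) (hq : q ∉ B) :
    splitHom B (1, Equiv.swap ⟨p, hp⟩ ⟨q, hq⟩) = Equiv.swap p q := by
  ext x
  by_cases hx : x ∈ B
  · rw [splitHom_apply_mem _ hx, Equiv.swap_apply_of_ne_of_ne]
    · rfl
    · rintro rfl; exact hp hx
    · rintro rfl; exact hq hx
  · rw [splitHom_apply_notMem _ hx]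
    simp only [Equiv.swap_apply_def, Subtype.mk.injEq]
    split_ifs <;> rfl

theorem swap_mul_eq (x : Equiv.Perm α) (p q : α) :
    Equiv.swap (x p) (x q) * x = x * Equiv.swap p q :=
  Equiv.swap_mul_eq_mul_swap _ _ _ |>.trans (by simp)

/-- Two points outside `B` whose preimages lie in `C` make the product vanish. -/
theorem splitIdem_mul_mul_eq_zero {B C : Finset α} {x : Equiv.Perm α} {p q : α} (hpq : p ≠ q)
    (hp : p ∈ C) (hq : q ∈ C) (hp' : x p ∉ B) (hq' : x q ∉ B) :
    splitIdem B * MonoidAlgebra.of ℚ _ x * splitIdem C = 0 := by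
  refine charIdem_mul_mul_eq_zero (h := (1, Equiv.swap ⟨x p, hp'⟩ ⟨x q, hq'⟩))
    (h' := (Equiv.swap ⟨p, hp⟩ ⟨q, hq⟩, 1)) ?_ ?_
  · rw [splitHom_swap_notMem, splitHom_swap_mem, swap_mul_eq]
  · have h1 : (⟨p, hp⟩ : {x // x ∈ C}) ≠ ⟨q, hq⟩ := fun h => hpq (congrArg Subtype.val h)
    simp [Equiv.Perm.sign_swap h1]

theorem splitIdem_mul_mul_eq_zero' {B C : Finset α} {x : Equiv.Perm α} {p q : α} (hpq : p ≠ q)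
    (hp : p ∉ C) (hq : q ∉ C) (hp' : x p ∈ B) (hq' : x q ∈ B) :
    splitIdem B * MonoidAlgebra.of ℚ _ x * splitIdem C = 0 := by
  refine charIdem_mul_mul_eq_zero (h := (Equiv.swap ⟨x p, hp'⟩ ⟨x q, hq'⟩, 1))
    (h' := (1, Equiv.swap ⟨p, hp⟩ ⟨q, hq⟩)) ?_ ?_
  · rw [splitHom_swap_notMem, splitHom_swap_mem, swap_mul_eq]
  · have h1 : (⟨x p, hp'⟩ : {x // x ∈ B}) ≠ ⟨x q, hq'⟩ :=
      fun h => hpq (x.injective (congrArg Subtype.val h))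
    simp [Equiv.Perm.sign_swap h1]

theorem mul_mul_eq_zero_of_forall {G : Type} [Group G] {e f : MonoidAlgebra ℚ G}
    (h : ∀ g, e * MonoidAlgebra.of ℚ G g * f = 0) (x : MonoidAlgebra ℚ G) : e * x * f = 0 := by
  induction x using MonoidAlgebra.induction_on with
  | of g => exact h g
  | add x y hx hy => rw [mul_add, add_mul, hx, hy, add_zero]
  | smul r x hx => rw [mul_smul_comm, smul_mul_assoc, hx, smul_zero]

/-- By the pigeonhole principle, for every `g` two letters antisymmetrized on one side correspond
under `g` to two letters symmetrized on the other. Their transposition forces the product to vanish.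
-/
theorem splitIdem_mul_mul_eq_zero_of_card {B C : Finset α}
    (h : B.card + 2 ≤ C.card ∨ C.card + 2 ≤ B.card) (x : MonoidAlgebra ℚ (Equiv.Perm α)) :
    splitIdem B * x * splitIdem C = 0 := by
  refine mul_mul_eq_zero_of_forall (fun g => ?_) x
  rcases h with h | h
  · have h1 : 1 < (C.map g.toEmbedding \ B).card := by
      have := Finset.le_card_sdiff B (C.map g.toEmbedding)
      rw [Finset.card_map] at this
      omega
    obtain ⟨a, ha, b, hb, hab⟩ := Finset.one_lt_card.1 h1
    simp only [Finset.mem_sdiff, Finset.mem_map, Equiv.coe_toEmbedding] at ha hb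
    obtain ⟨⟨p, hp, rfl⟩, hp'⟩ := ha
    obtain ⟨⟨q, hq, rfl⟩, hq'⟩ := hb
    exact splitIdem_mul_mul_eq_zero (fun h => hab (congrArg g h)) hp hq hp' hq'
  · have h1 : 1 < (B \ C.map g.toEmbedding).card := by
      have := Finset.le_card_sdiff (C.map g.toEmbedding) B
      rw [Finset.card_map] at this
      omega
    obtain ⟨a, ha, b, hb, hab⟩ := Finset.one_lt_card.1 h1
    obtain ⟨p, rfl⟩ := g.surjective a
    obtain ⟨q, rfl⟩ := g.surjective b
    simp only [Finset.mem_sdiff, Finset.mem_map, Equiv.coe_toEmbedding, g.injective.eq_iff,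
      exists_eq_right] at ha hb
    exact splitIdem_mul_mul_eq_zero' (fun h => hab (congrArg g h)) ha.2 hb.2 ha.1 hb.1

/-- Only one double coset survives: either two letters of `g (B ∪ {m})` lie outside `B` and the
product is zero, or `g` lies in the product of the two stabilizers and is absorbed up to sign. This
is what yields rank one on irreducible representations. -/
theorem splitIdem_mul_mul_insert {B : Finset α} {m : α} (hm : m ∉ B)
    (x : MonoidAlgebra ℚ (Equiv.Perm α)) :
    ∃ q : ℚ, splitIdem B * x * splitIdem (insert m B) =
      q • (splitIdem B * splitIdem (insert m B)) := by
  induction x using MonoidAlgebra.induction_on with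
  | add x y hx hy =>
    obtain ⟨q, hq⟩ := hx
    obtain ⟨q', hq'⟩ := hy
    exact ⟨q + q', by rw [mul_add, add_mul, hq, hq', add_smul]⟩
  | smul r x hx =>
    obtain ⟨q, hq⟩ := hx
    exact ⟨r * q, by rw [mul_smul_comm, smul_mul_assoc, hq, smul_smul]⟩
  | of g =>
    by_cases hz : 1 < ((insert m B).map g.toEmbedding \ B).card
    · obtain ⟨a, ha, b, hb, hab⟩ := Finset.one_lt_card.1 hz
      simp only [Finset.mem_sdiff, Finset.mem_map, Equiv.coe_toEmbedding] at ha hb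
      obtain ⟨⟨p, hp, rfl⟩, hp'⟩ := ha
      obtain ⟨⟨q, hq, rfl⟩, hq'⟩ := hb
      exact ⟨0, by rw [splitIdem_mul_mul_eq_zero (fun h => hab (congrArg g h)) hp hq hp' hq',
        zero_smul]⟩
    · -- now `g (B ∪ {m}) = B ∪ {p}`
      have hc : ((insert m B).map g.toEmbedding).card = B.card + 1 := by
        rw [Finset.card_map, Finset.card_insert_of_notMem hm]
      have h1 := Finset.card_sdiff_add_card_inter ((insert m B).map g.toEmbedding) B
      have h2 := Finset.card_le_card
        (Finset.inter_subset_right (s₁ := (insert m B).map g.toEmbedding) (s₂ := B))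
      have h3 : (insert m B).map g.toEmbedding ∩ B = B :=
        Finset.eq_of_subset_of_card_le Finset.inter_subset_right (by omega)
      obtain ⟨p, hp⟩ := Finset.card_eq_one.1
        (show ((insert m B).map g.toEmbedding \ B).card = 1 by omega)
      have hpB : p ∉ B := (Finset.mem_sdiff.1 (hp ▸ Finset.mem_singleton_self p)).2
      have h4 : (insert m B).map g.toEmbedding = insert p B := by
        rw [← Finset.sdiff_union_inter ((insert m B).map g.toEmbedding) B, hp, h3]
        rfl
      -- Since `g` sends `B ∪ {m}` to `B ∪ {p}`, composing with the transposition of `p` and `m`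
      -- gives a permutation stabilizing `B ∪ {m}`. The transposition acts outside `B`, where the
      -- left idempotent symmetrizes.
      have h5 : ∀ y, (Equiv.swap p m * g) y ∈ insert m B ↔ y ∈ insert m B := by
        intro y
        have h6 : y ∈ insert m B ↔ g y ∈ insert p B := by
          rw [← h4, Finset.mem_map_equiv, Equiv.symm_apply_apply]
        rw [h6, Equiv.Perm.mul_apply]
        generalize g y = z
        simp only [Finset.mem_insert]
        by_cases hzp : z = p
        · subst hzp; simp
        by_cases hzm : z = m
        · subst hzm; simpa [hpB, hm] using eq_comm
        · rw [Equiv.swap_apply_of_ne_of_ne hzp hzm]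
          simp [hzp, hzm]
      have h7 : g = splitHom B (1, Equiv.swap ⟨p, hpB⟩ ⟨m, hm⟩) *
          splitHom (insert m B) ((Equiv.swap p m * g).subtypePerm h5,
            (Equiv.swap p m * g).subtypePerm fun x => not_congr (h5 x)) := by
        rw [exists_splitHom_eq, splitHom_swap_notMem, ← mul_assoc, Equiv.swap_mul_self, one_mul]
      refine ⟨unitRat (splitSign (insert m B) ((Equiv.swap p m * g).subtypePerm h5,
            (Equiv.swap p m * g).subtypePerm fun x => not_congr (h5 x))), ?_⟩
      conv_lhs => rw [h7]
      rw [map_mul, ← mul_assoc, splitIdem, charIdem_mul_of, mul_assoc, splitIdem,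
        of_mul_charIdem, mul_smul_comm, smul_mul_assoc]
      simp

end SplitIdem

/-! ### Signed counts of the subsets stable under a permutation. -/

section StableSets

variable {α : Type} [Fintype α] [DecidableEq α]

open Classical in
/-- `(-1)^|B|` times the sign of the restriction of `h` to `B`, if `h` stabilizes `B`, and `0`
otherwise. -/
def stableSign (h : Equiv.Perm α) (B : Finset α) : ℤ :=
  if hB : ∀ x, h x ∈ B ↔ x ∈ B then (-1) ^ B.card * Equiv.Perm.sign (h.subtypePerm hB) else 0

theorem stableSign_of_stable {h : Equiv.Perm α} {B : Finset α} (hB : ∀ x, h x ∈ B ↔ x ∈ B) :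
    stableSign h B = (-1) ^ B.card * Equiv.Perm.sign (h.subtypePerm hB) := dif_pos hB

theorem stableSign_of_not_stable {h : Equiv.Perm α} {B : Finset α}
    (hB : ¬ ∀ x, h x ∈ B ↔ x ∈ B) : stableSign h B = 0 := dif_neg hB

theorem stableSign_empty (h : Equiv.Perm α) : stableSign h ∅ = 1 := by
  rw [stableSign_of_stable (by simp)]
  have : h.subtypePerm (p := fun x => x ∈ (∅ : Finset α)) (by simp) = 1 := by
    ext ⟨x, hx⟩
    simp at hx
  rw [this]
  simp

theorem stableSign_conj (x h : Equiv.Perm α) (B : Finset α) :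
    stableSign (x * h * x⁻¹) (B.map x.toEmbedding) = stableSign h B := by
  have hm : ∀ y, y ∈ B.map x.toEmbedding ↔ x⁻¹ y ∈ B := fun y => Finset.mem_map_equiv
  by_cases hB : ∀ y, h y ∈ B ↔ y ∈ B
  · have hB' : ∀ y, (x * h * x⁻¹) y ∈ B.map x.toEmbedding ↔ y ∈ B.map x.toEmbedding := by
      intro y
      rw [hm, hm]
      simpa using hB (x⁻¹ y)
    rw [stableSign_of_stable hB, stableSign_of_stable hB', Finset.card_map]
    congr 2
    refine (Equiv.Perm.sign_eq_sign_of_equiv _ _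
      (x.subtypeEquiv fun a => (by simp : a ∈ B ↔ x a ∈ B.map x.toEmbedding)) ?_).symm
    rintro ⟨a, ha⟩
    apply Subtype.ext
    simp
  · rw [stableSign_of_not_stable hB, stableSign_of_not_stable]
    contrapose! hB
    intro y
    have := hB (x y)
    rw [hm, hm] at this
    simpa using this

/-- The orbit of `y` under the powers of `h`. -/
def orbitSet (h : Equiv.Perm α) (y : α) : Finset α :=
  {z | h.SameCycle y z}

theorem mem_orbitSet {h : Equiv.Perm α} {y z : α} : z ∈ orbitSet h y ↔ h.SameCycle y z := by
  simp [orbitSet]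

theorem apply_mem_orbitSet (h : Equiv.Perm α) (y x : α) :
    h x ∈ orbitSet h y ↔ x ∈ orbitSet h y := by
  rw [mem_orbitSet, mem_orbitSet, Equiv.Perm.sameCycle_apply_right]

/-- A cycle of length `ℓ` has sign `-(-1)^ℓ`. Fixed points need a separate case, since the support
of their trivial cycle is empty while the orbit has one element. -/
theorem sign_cycleOf_eq (h : Equiv.Perm α) (y : α) :
    (Equiv.Perm.sign (h.cycleOf y) : ℤ) = -(-1) ^ (orbitSet h y).card := by
  by_cases hy : h y = y
  · have h1 : orbitSet h y = {y} := by
      ext z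
      rw [mem_orbitSet, Finset.mem_singleton]
      exact ⟨fun hz => (hz.eq_of_left hy).symm, fun hz => hz ▸ Equiv.Perm.SameCycle.refl _ _⟩
    rw [h1, (Equiv.Perm.cycleOf_eq_one_iff h).2 hy]
    simp
  · have h1 : orbitSet h y = (h.cycleOf y).support := by
      ext z
      rw [mem_orbitSet, Equiv.Perm.mem_support_cycleOf_iff' hy]
    rw [(Equiv.Perm.isCycle_cycleOf h hy).sign, h1]
    simp

/-- Adding an orbit of length `ℓ` multiplies by `(-1)^ℓ` from the cardinality and by `-(-1)^ℓ` from
the sign of the new cycle. -/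
theorem stableSign_union_orbitSet {h : Equiv.Perm α} {B : Finset α}
    (hB : ∀ x, h x ∈ B ↔ x ∈ B) {y : α} (hd : Disjoint B (orbitSet h y)) :
    stableSign h (B ∪ orbitSet h y) = -stableSign h B := by
  have hU : ∀ x, h x ∈ B ∪ orbitSet h y ↔ x ∈ B ∪ orbitSet h y := fun x => by
    rw [Finset.mem_union, Finset.mem_union, hB, apply_mem_orbitSet]
  have key : Equiv.Perm.ofSubtype (h.subtypePerm hU) =
      Equiv.Perm.ofSubtype (h.subtypePerm hB) * h.cycleOf y := by
    ext x
    rw [Equiv.Perm.mul_apply, Equiv.Perm.cycleOf_apply]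
    by_cases hx : h.SameCycle y x
    · have h1 : x ∈ orbitSet h y := mem_orbitSet.2 hx
      have h2 : h x ∈ orbitSet h y := (apply_mem_orbitSet h y x).2 h1
      rw [if_pos hx, Equiv.Perm.ofSubtype_apply_of_mem _ (Finset.mem_union_right _ h1),
        Equiv.Perm.ofSubtype_apply_of_not_mem _ (Finset.disjoint_right.1 hd h2)]
      rfl
    · rw [if_neg hx]
      by_cases hxB : x ∈ B
      · rw [Equiv.Perm.ofSubtype_apply_of_mem _ (Finset.mem_union_left _ hxB),
          Equiv.Perm.ofSubtype_apply_of_mem _ hxB]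
        rfl
      · rw [Equiv.Perm.ofSubtype_apply_of_not_mem _ hxB, Equiv.Perm.ofSubtype_apply_of_not_mem]
        rw [Finset.mem_union, mem_orbitSet]
        exact not_or_intro hxB hx
  have h1 := congrArg (fun p => (Equiv.Perm.sign p : ℤ)) key
  simp only [Equiv.Perm.sign_ofSubtype, Equiv.Perm.sign_mul, Units.val_mul, sign_cycleOf_eq] at h1
  rw [stableSign_of_stable hB, stableSign_of_stable hU, h1, Finset.card_union_of_disjoint hd,
    pow_add]
  have h2 : ((-1 : ℤ) ^ (orbitSet h y).card) * (-1) ^ (orbitSet h y).card = 1 := by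
    rw [← mul_pow]; simp
  linear_combination (-(-1) ^ B.card * (Equiv.Perm.sign (h.subtypePerm hB) : ℤ)) * h2

/-- Toggling a whole orbit preserves stability and instability and reverses the sign. This
involution takes the place of the factor `1 - t^ℓ` of the generating function. -/
theorem stableSign_symmDiff_orbitSet (h : Equiv.Perm α) (B : Finset α) (y : α) :
    stableSign h (symmDiff B (orbitSet h y)) = -stableSign h B := by
  have hst : ∀ B : Finset α, (∀ x, h x ∈ B ↔ x ∈ B) →
      ∀ x, h x ∈ symmDiff B (orbitSet h y) ↔ x ∈ symmDiff B (orbitSet h y) := fun B hB x => by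
    rw [Finset.mem_symmDiff, Finset.mem_symmDiff, hB, apply_mem_orbitSet]
  by_cases hB : ∀ x, h x ∈ B ↔ x ∈ B
  · have hiter : ∀ z, h.SameCycle y z → (z ∈ B ↔ y ∈ B) := by
      rintro z ⟨n, rfl⟩
      have h1 : ∀ (m : ℕ) x, (h ^ m) x ∈ B ↔ x ∈ B := by
        intro m
        induction m with
        | zero => simp
        | succ m ih => intro x; rw [pow_succ', Equiv.Perm.mul_apply, hB, ih]
      rcases n with n | n
      · exact h1 n y
      · have := h1 (n + 1) ((h ^ (n + 1))⁻¹ y)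
        rw [show (h ^ (n + 1)) ((h ^ (n + 1))⁻¹ y) = y from Equiv.apply_symm_apply _ _] at this
        rw [zpow_negSucc]
        exact this.symm
    by_cases hy : y ∈ B
    · have hsub : orbitSet h y ⊆ B := fun z hz => (hiter z (mem_orbitSet.1 hz)).2 hy
      have h1 : symmDiff B (orbitSet h y) = B \ orbitSet h y := by
        rw [symmDiff_def, Finset.sup_eq_union, Finset.sdiff_eq_empty_iff_subset.2 hsub,
          Finset.union_empty]
      have h2 := stableSign_union_orbitSet (h1 ▸ hst B hB) Finset.sdiff_disjoint
      rw [Finset.sdiff_union_of_subset hsub] at h2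
      rw [h1, h2, neg_neg]
    · have hdis : Disjoint B (orbitSet h y) := Finset.disjoint_right.2
        fun z hz hzB => hy ((hiter z (mem_orbitSet.1 hz)).1 hzB)
      have h1 : symmDiff B (orbitSet h y) = B ∪ orbitSet h y := by
        rw [hdis.symmDiff_eq_sup, Finset.sup_eq_union]
      rw [h1, stableSign_union_orbitSet hB hdis]
  · rw [stableSign_of_not_stable hB, stableSign_of_not_stable, neg_zero]
    intro hB'
    have := hst _ hB'
    rw [symmDiff_symmDiff_cancel_right] at this
    exact hB this

theorem sum_stableSign_eq_zero (h : Equiv.Perm α) (y : α) (s : Finset (Finset α))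
    (hs : ∀ B ∈ s, symmDiff B (orbitSet h y) ∈ s) : ∑ B ∈ s, stableSign h B = 0 := by
  have h1 : ∑ B ∈ s, stableSign h B = ∑ B ∈ s, -stableSign h B := by
    refine Finset.sum_nbij' (fun B => symmDiff B (orbitSet h y))
      (fun B => symmDiff B (orbitSet h y)) hs hs ?_ ?_ ?_
    · intro B _; exact symmDiff_symmDiff_cancel_right _ _
    · intro B _; exact symmDiff_symmDiff_cancel_right _ _
    · intro B _; rw [stableSign_symmDiff_orbitSet, neg_neg]
  rw [Finset.sum_neg_distrib] at h1
  omega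

theorem sum_stableSign [Nonempty α] (h : Equiv.Perm α) : ∑ B, stableSign h B = 0 :=
  sum_stableSign_eq_zero h (Classical.arbitrary α) _ fun _ _ => Finset.mem_univ _

theorem stableSign_univ_of_isCycleOn {h : Equiv.Perm α} (hh : h.IsCycleOn Set.univ) (y : α) :
    stableSign h Finset.univ = -1 := by
  have h1 := stableSign_symmDiff_orbitSet h ∅ y
  rw [stableSign_empty] at h1
  rw [← h1]
  congr 1
  ext z
  simp [Finset.mem_symmDiff, mem_orbitSet, hh.2 (Set.mem_univ y) (Set.mem_univ z)]

/-- A stable set that contains one point of a single orbit is everything. -/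
theorem sum_stableSign_mem_of_isCycleOn {h : Equiv.Perm α} (hh : h.IsCycleOn Set.univ) (x : α) :
    ∑ B with x ∈ B, stableSign h B = -1 := by
  rw [Finset.sum_eq_single Finset.univ, stableSign_univ_of_isCycleOn hh x]
  · intro B hB hne
    refine stableSign_of_not_stable fun hst => hne ?_
    ext z
    refine iff_of_true ?_ (Finset.mem_univ z)
    obtain ⟨n, rfl⟩ := (hh.2 (Set.mem_univ x) (Set.mem_univ z)).exists_nat_pow_eq
    clear hne
    induction n with
    | zero => simpa using hB
    | succ n ih => rwa [pow_succ', Equiv.Perm.mul_apply, hst]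
  · simp

/-- Some orbit misses `x`, and toggling it does not affect the condition `x ∈ B`. -/
theorem sum_stableSign_mem_of_not_isCycleOn {h : Equiv.Perm α} (hh : ¬ h.IsCycleOn Set.univ)
    (x : α) : ∑ B with x ∈ B, stableSign h B = 0 := by
  obtain ⟨y, hy⟩ : ∃ y, ¬ h.SameCycle y x := by
    by_contra! hc
    exact hh ⟨Set.bijOn_univ.2 h.bijective, fun a _ b _ => (hc a).trans (hc b).symm⟩
  refine sum_stableSign_eq_zero h y _ fun B hB => ?_
  have : x ∉ orbitSet h y := by rwa [mem_orbitSet]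
  simpa [Finset.mem_symmDiff, this] using hB

open Classical in
-- This is the derivative at `t = 1` of `∏ (1 - t^ℓ)`, computed by counting pairs `x ∈ B`.
theorem sum_card_mul_stableSign (h : Equiv.Perm α) : ∑ B, (B.card : ℤ) * stableSign h B =
    if h.IsCycleOn Set.univ then -(Fintype.card α : ℤ) else 0 := by
  have h1 : ∑ B, (B.card : ℤ) * stableSign h B = ∑ x, ∑ B with x ∈ B, stableSign h B := by
    simp only [Finset.sum_filter]
    rw [Finset.sum_comm]
    refine Finset.sum_congr rfl fun B _ => ?_
    rw [← Finset.sum_filter, Finset.sum_const, nsmul_eq_mul]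
    simp
  rw [h1]
  split_ifs with hh
  · simp [sum_stableSign_mem_of_isCycleOn hh]
  · simp [sum_stableSign_mem_of_not_isCycleOn hh]

end StableSets

/-! ### Class functions at the split idempotents and at full cycles. -/

section ClassFunctions

variable {α : Type} [Fintype α] [DecidableEq α] {τ : MonoidAlgebra ℚ (Equiv.Perm α) →ₗ[ℚ] ℚ}

/-- The subgroup over which `splitIdem B` averages is the stabilizer of `B`. Extension by zero makes
the sum run over all permutations, so that different `B` can be added together. -/
theorem apply_splitIdem (τ : MonoidAlgebra ℚ (Equiv.Perm α) →ₗ[ℚ] ℚ) (B : Finset α) :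
    (-1) ^ B.card * τ (splitIdem B) =
      ((B.card.factorial : ℚ) * (Fintype.card α - B.card).factorial)⁻¹ *
        ∑ h, (stableSign h B : ℚ) * τ (MonoidAlgebra.of ℚ _ h) := by
  rw [splitIdem, charIdem, map_smul, map_sum, smul_eq_mul, mul_left_comm]
  congr 1
  · rw [Fintype.card_prod, Fintype.card_perm, Fintype.card_perm, Fintype.card_coe,
      Fintype.card_subtype_compl, Fintype.card_coe, Nat.cast_mul]
  · rw [Finset.mul_sum]
    refine Finset.sum_of_injOn (splitHom B)
      (Equiv.Perm.subtypeCongrHom_injective (· ∈ B)).injOn (by simp [Set.MapsTo]) ?_ ?_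
    · intro h _ hh
      rw [stableSign_of_not_stable, Int.cast_zero, zero_mul]
      intro hB
      exact hh ⟨_, Finset.mem_coe.2 (Finset.mem_univ _), exists_splitHom_eq hB⟩
    · intro p _
      have hB := splitHom_apply_mem_iff p
      have h1 : (splitHom B p).subtypePerm hB = p.1 := by
        ext ⟨x, hx⟩
        exact splitHom_apply_mem p hx
      rw [stableSign_of_stable hB, h1, map_smul, smul_eq_mul, ← mul_assoc]
      simp [unitRat]

theorem sum_stableSign_map (hτ : ∀ x y, τ (x * y) = τ (y * x)) (B : Finset α)
    (x : Equiv.Perm α) :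
    ∑ h, (stableSign h (B.map x.toEmbedding) : ℚ) * τ (MonoidAlgebra.of ℚ _ h) =
      ∑ h, (stableSign h B : ℚ) * τ (MonoidAlgebra.of ℚ _ h) := by
  refine (Fintype.sum_equiv (MulAut.conj x).toEquiv _ _ fun h => ?_).symm
  change _ = (stableSign (x * h * x⁻¹) _ : ℚ) * τ (MonoidAlgebra.of ℚ _ (x * h * x⁻¹))
  rw [stableSign_conj, map_mul _ (x * h), hτ, ← map_mul, inv_mul_cancel_left]

theorem exists_map_eq_of_card {B B' : Finset α} (h : B.card = B'.card) :
    ∃ x : Equiv.Perm α, B.map x.toEmbedding = B' := by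
  classical
  let e : {x // x ∈ B} ≃ {x // x ∈ B'} := Finset.equivOfCardEq h
  refine ⟨e.extendSubtype, Finset.eq_of_subset_of_card_le ?_ (by simp [h])⟩
  intro y hy
  obtain ⟨z, hz, rfl⟩ := Finset.mem_map.1 hy
  exact e.extendSubtype_mem z hz

theorem sum_stableSign_eq_of_card (hτ : ∀ x y, τ (x * y) = τ (y * x)) {B B' : Finset α}
    (h : B.card = B'.card) :
    ∑ h, (stableSign h B' : ℚ) * τ (MonoidAlgebra.of ℚ _ h) =
      ∑ h, (stableSign h B : ℚ) * τ (MonoidAlgebra.of ℚ _ h) := by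
  obtain ⟨x, rfl⟩ := exists_map_eq_of_card h
  exact sum_stableSign_map hτ B x

/-- A weighted sum of the values of a class function on the idempotents `splitIdem B_k`, with
`|B_k| = k`, is an average over all the subsets. -/
theorem sum_apply_splitIdem (hτ : ∀ x y, τ (x * y) = τ (y * x)) (B : ℕ → Finset α)
    (hB : ∀ k ≤ Fintype.card α, (B k).card = k) (w : ℕ → ℤ) :
    ∑ k ∈ Finset.range (Fintype.card α + 1), (w k : ℚ) * ((-1) ^ k * τ (splitIdem (B k))) =
      ((Fintype.card α).factorial : ℚ)⁻¹ * ∑ h, (∑ B : Finset α,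
        w B.card * stableSign h B : ℤ) * τ (MonoidAlgebra.of ℚ _ h) := by
  have h1 : ∀ k ∈ Finset.range (Fintype.card α + 1),
      (w k : ℚ) * ((-1) ^ k * τ (splitIdem (B k))) = ((Fintype.card α).factorial : ℚ)⁻¹ *
        ∑ C ∈ Finset.powersetCard k Finset.univ, ∑ h, ((w C.card * stableSign h C : ℤ) : ℚ) *
          τ (MonoidAlgebra.of ℚ _ h) := by
    intro k hk
    have hk' : k ≤ Fintype.card α := Nat.lt_succ_iff.1 (Finset.mem_range.1 hk)
    have h2 := apply_splitIdem τ (B k)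
    rw [hB k hk'] at h2
    have h3 : ∀ C ∈ Finset.powersetCard k (Finset.univ : Finset α),
        ∑ h, ((w C.card * stableSign h C : ℤ) : ℚ) * τ (MonoidAlgebra.of ℚ _ h) =
          (w k : ℚ) * ∑ h, (stableSign h (B k) : ℚ) * τ (MonoidAlgebra.of ℚ _ h) := by
      intro C hC
      have hc := (Finset.mem_powersetCard.1 hC).2
      rw [← sum_stableSign_eq_of_card hτ ((hB k hk').trans hc.symm), Finset.mul_sum]
      refine Finset.sum_congr rfl fun h _ => ?_
      rw [hc]
      push_cast
      ring
    -- All subsets of size `k` contribute equally, and their number turns `1 / (k! (n - k)!)` into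
    -- `1 / n!`.
    rw [h2, Finset.sum_congr rfl h3, Finset.sum_const, Finset.card_powersetCard, Finset.card_univ,
      nsmul_eq_mul, Nat.cast_choose ℚ hk']
    have := Nat.factorial_ne_zero (Fintype.card α)
    field_simp
  rw [Finset.sum_congr rfl h1, ← Finset.mul_sum]
  congr 1
  have h3 := Finset.sum_powerset (Finset.univ : Finset α) (fun C => ∑ h,
    ((w C.card * stableSign h C : ℤ) : ℚ) * τ (MonoidAlgebra.of ℚ _ h))
  rw [Finset.card_univ] at h3
  rw [← h3, Finset.powerset_univ, Finset.sum_comm]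
  refine Finset.sum_congr rfl fun h _ => ?_
  rw [Int.cast_sum, Finset.sum_mul]

theorem sum_neg_one_pow_apply_splitIdem [Nonempty α] (hτ : ∀ x y, τ (x * y) = τ (y * x))
    (B : ℕ → Finset α) (hB : ∀ k ≤ Fintype.card α, (B k).card = k) :
    ∑ k ∈ Finset.range (Fintype.card α + 1), (-1) ^ k * τ (splitIdem (B k)) = 0 := by
  have h := sum_apply_splitIdem hτ B hB (fun _ => 1)
  simpa [← Int.cast_sum, sum_stableSign] using h

theorem isConj_of_isCycleOn {g h : Equiv.Perm α} (hg : g.IsCycleOn Set.univ)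
    (hh : h.IsCycleOn Set.univ) : IsConj g h := by
  rcases subsingleton_or_nontrivial α with hα | hα
  · rw [Subsingleton.elim g h]
  · have key : ∀ g : Equiv.Perm α, g.IsCycleOn Set.univ →
        g.IsCycle ∧ g.support = Finset.univ := by
      intro g hg
      have h1 : ∀ x, g x ≠ x := fun x => hg.apply_ne Set.nontrivial_univ (Set.mem_univ x)
      refine ⟨⟨Classical.arbitrary α, h1 _, fun y _ => hg.2 (Set.mem_univ _) (Set.mem_univ _)⟩, ?_⟩
      ext x
      simp [h1]
    refine (key g hg).1.isConj (key h hh).1 ?_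
    rw [(key g hg).2, (key h hh).2]

theorem apply_eq_of_isCycleOn (hτ : ∀ x y, τ (x * y) = τ (y * x)) {g h : Equiv.Perm α}
    (hg : g.IsCycleOn Set.univ) (hh : h.IsCycleOn Set.univ) :
    τ (MonoidAlgebra.of ℚ _ h) = τ (MonoidAlgebra.of ℚ _ g) := by
  obtain ⟨x, rfl⟩ := isConj_iff.1 (isConj_of_isCycleOn hg hh)
  rw [map_mul _ (x * g), hτ, ← map_mul, inv_mul_cancel_left]

open Classical in
theorem sum_mul_apply_splitIdem (hτ : ∀ x y, τ (x * y) = τ (y * x)) (B : ℕ → Finset α)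
    (hB : ∀ k ≤ Fintype.card α, (B k).card = k) {g : Equiv.Perm α} (hg : g.IsCycleOn Set.univ) :
    ∑ k ∈ Finset.range (Fintype.card α + 1), (k : ℚ) * ((-1) ^ k * τ (splitIdem (B k))) =
      -(((Fintype.card α).factorial : ℚ)⁻¹ * Fintype.card α *
        Finset.card {h : Equiv.Perm α | h.IsCycleOn Set.univ}) * τ (MonoidAlgebra.of ℚ _ g) := by
  have h := sum_apply_splitIdem hτ B hB (fun k => k)
  simp only [sum_card_mul_stableSign, Int.cast_natCast] at h
  rw [h]
  have h1 : ∀ h : Equiv.Perm α, (((if h.IsCycleOn Set.univ then -(Fintype.card α : ℤ) else 0 : ℤ) :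
      ℚ) * τ (MonoidAlgebra.of ℚ _ h)) = if h.IsCycleOn Set.univ then
        -(Fintype.card α : ℚ) * τ (MonoidAlgebra.of ℚ _ g) else 0 := by
    intro h
    split_ifs with hh
    · rw [apply_eq_of_isCycleOn hτ hg hh]
      simp
    · simp
  rw [Finset.sum_congr rfl fun h _ => h1 h, ← Finset.sum_filter, Finset.sum_const, nsmul_eq_mul]
  ring

/-- The value of a class function at a cycle of maximal length. -/
theorem apply_of_isCycleOn [Nonempty α] (hτ : ∀ x y, τ (x * y) = τ (y * x)) (B : ℕ → Finset α)
    (hB : ∀ k ≤ Fintype.card α, (B k).card = k) {g : Equiv.Perm α} (hg : g.IsCycleOn Set.univ) :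
    τ (MonoidAlgebra.of ℚ _ g) = -∑ k ∈ Finset.range (Fintype.card α + 1),
      (k : ℚ) * ((-1) ^ k * τ (splitIdem (B k))) := by
  classical
  rw [sum_mul_apply_splitIdem hτ B hB hg]
  -- the number of such cycles is determined by evaluating the trivial character
  let ε : MonoidAlgebra ℚ (Equiv.Perm α) →ₐ[ℚ] ℚ := MonoidAlgebra.lift ℚ ℚ (Equiv.Perm α) 1
  have hof : ∀ g, ε (MonoidAlgebra.of ℚ _ g) = 1 := fun g => by
    rw [MonoidAlgebra.lift_of, MonoidHom.one_apply]
  have h1 := sum_mul_apply_splitIdem (τ := ε.toLinearMap) (fun x y => by simp [mul_comm]) B hB hg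
  simp only [AlgHom.toLinearMap_apply, hof, mul_one] at h1
  have hpos : 1 ≤ Fintype.card α := Fintype.card_pos
  -- For the trivial character only `k = 1` contributes: the weight is zero at `k = 0`, and an
  -- antisymmetrizer over at least two letters is killed. This shows that the normalizing factor is
  -- `1`.
  rw [Finset.sum_eq_single 1] at h1
  · have h2 : ε (splitIdem (B 1)) = 1 := by
      rw [splitIdem, charIdem, map_smul, map_sum]
      have h3 : ∀ p, ε (unitRat (splitSign (B 1) p) • MonoidAlgebra.of ℚ _ (splitHom (B 1) p)) =
          1 := by
        intro p
        have hs : Subsingleton {x // x ∈ B 1} := by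
          rw [← Fintype.card_le_one_iff_subsingleton, Fintype.card_coe, hB 1 hpos]
        rw [map_smul, hof]
        simp [Subsingleton.elim p.1 1]
      rw [Finset.sum_congr rfl fun p _ => h3 p, Finset.sum_const, Finset.card_univ, nsmul_eq_mul,
        mul_one, smul_eq_mul, inv_mul_cancel₀ (by positivity)]
    rw [h2] at h1
    rw [← h1]
    norm_num
  · intro k hk hk1
    rcases Nat.eq_zero_or_pos k with rfl | hk0
    · simp
    have hk' : k ≤ Fintype.card α := Nat.lt_succ_iff.1 (Finset.mem_range.1 hk)
    obtain ⟨p, hp, q, hq, hpq⟩ := Finset.one_lt_card.1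
      (show 1 < (B k).card by rw [hB k hk']; omega)
    have hne : (⟨p, hp⟩ : {x // x ∈ B k}) ≠ ⟨q, hq⟩ := fun h => hpq (congrArg Subtype.val h)
    -- A transposition inside `B k` changes the sign of the idempotent but has value `1` under `ε`.
    have h3 := congrArg ε (of_mul_charIdem (splitHom (B k)) (splitSign (B k))
      (Equiv.swap ⟨p, hp⟩ ⟨q, hq⟩, 1))
    rw [map_mul, map_smul, hof, one_mul] at h3
    have h4 : ε (splitIdem (B k)) = 0 := by
      rw [splitIdem]
      simp [unitRat, Equiv.Perm.sign_swap hne] at h3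
      linarith
    rw [h4, mul_zero, mul_zero]
  · intro hc
    exact absurd (Finset.mem_range.2 (by omega)) hc

end ClassFunctions

/-! ### From characters to arbitrary idempotent-additive functions. -/

section CyclePairing

/-- The idempotent lies in its own ideal and fixes itself, so it acts nontrivially there. -/
theorem Irrep.char_idem_self_ne_zero {G : Type} [Group G] [Finite G] (c : Irrep G) :
    c.char c.idem ≠ 0 := by
  rw [Ne, c.char_eq_zero_iff c.isIdempotentElem_idem]
  intro h
  have h1 : c.idem * c.idem = 0 := congrArg Subtype.val (h ⟨c.idem, c.idem_mem⟩)
  rw [c.isIdempotentElem_idem.eq] at h1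
  have h2 := c.ideal_spec.1
  have h3 := IsSimpleModule.nontrivial (MonoidAlgebra ℚ G) c.ideal
  rw [Submodule.nontrivial_iff_ne_bot] at h3
  exact h3 (c.ideal_eq_span.trans (Ideal.span_singleton_eq_bot.2 h1))

/-- The coefficients of an idempotent in terms of the primitive ones, together with the effect on
characters. -/
theorem IsIdemAdditive.exists_mult_char {G : Type} [Group G] [Finite G] [Fintype (Irrep G)]
    {M : Type*} [AddCommGroup M] {Φ : MonoidAlgebra ℚ G → M} (h : IsIdemAdditive Φ)
    {f : MonoidAlgebra ℚ G} (hf : IsIdempotentElem f) : ∃ n : Irrep G → ℕ,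
      Φ f = ∑ c, n c • Φ c.idem ∧ ∀ c, Irrep.char c f = n c * c.char c.idem := by
  classical
  have h1 : IsIdemAdditive fun x : MonoidAlgebra ℚ G => fun c : Irrep G => c.char x :=
    IsIdemAdditive.pi fun c => IsIdemAdditive.of_trace (τ := c.char.toAddMonoidHom)
      c.char_mul_comm
  obtain ⟨n, hn⟩ := (h.prodMk h1).exists_mult hf
  refine ⟨n, ?_, fun c => ?_⟩
  · have := congrArg Prod.fst hn
    rwa [Prod.fst_sum] at this
  · have := congrFun (congrArg Prod.snd hn) c
    rw [Prod.snd_sum, Finset.sum_apply, Finset.sum_eq_single c] at this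
    · exact this.trans (nsmul_eq_mul _ _)
    · intro c' _ hc'
      exact (congrArg (n c' • ·) (Irrep.char_idem_of_ne hc')).trans (smul_zero _)
    · simp

variable {α : Type} [Fintype α] [DecidableEq α] [Nonempty α]

/-- An irreducible representation on which some `splitIdem B_k` acts nontrivially is absolutely
irreducible. -/
theorem Irrep.char_idem_self_eq_one {B : ℕ → Finset α}
    (hB : ∀ k ≤ Fintype.card α, (B k).card = k) (hsub : ∀ k < Fintype.card α, B k ⊆ B (k + 1))
    (c : Irrep (Equiv.Perm α)) {k : ℕ} (hk : k ≤ Fintype.card α)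
    (hc : c.char (splitIdem (B k)) ≠ 0) : c.char c.idem = 1 := by
  have := Fintype.ofFinite (Irrep (Equiv.Perm α))
  -- The alternating sum over `k` vanishes, so a nonzero term is never alone. Two sizes that differ
  -- by at least two cannot both act nontrivially on `V_c`, so two consecutive sizes occur.
  have hadj : ∃ j < Fintype.card α, c.char (splitIdem (B j)) ≠ 0 ∧
      c.char (splitIdem (B (j + 1))) ≠ 0 := by
    obtain ⟨l, hl, hlk, hcl⟩ : ∃ l ≤ Fintype.card α, l ≠ k ∧ c.char (splitIdem (B l)) ≠ 0 := by
      by_contra! hno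
      have h1 := sum_neg_one_pow_apply_splitIdem c.char_mul_comm B hB
      rw [Finset.sum_eq_single k] at h1
      · exact hc ((mul_eq_zero.1 h1).resolve_left (by simp))
      · intro l hl hlk
        rw [hno l (Nat.lt_succ_iff.1 (Finset.mem_range.1 hl)) hlk, mul_zero]
      · intro hk'
        exact absurd (Finset.mem_range.2 (Nat.lt_succ_iff.2 hk)) hk'
    have hclose : ¬ (k + 2 ≤ l ∨ l + 2 ≤ k) := by
      intro hkl
      rw [← hB k hk, ← hB l hl] at hkl
      exact hc (c.char_eq_zero_of_mul (isIdempotentElem_splitIdem _)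
        (isIdempotentElem_splitIdem _) (splitIdem_mul_mul_eq_zero_of_card
          (by rwa [hB k hk, hB l hl] at hkl ⊢)) hcl)
    rcases lt_or_gt_of_ne hlk with h | h
    · obtain rfl : k = l + 1 := by omega
      exact ⟨l, by omega, hcl, hc⟩
    · obtain rfl : l = k + 1 := by omega
      exact ⟨k, by omega, hc, hcl⟩
  obtain ⟨j, hj, hj0, hj1⟩ := hadj
  obtain ⟨m, hm, hins⟩ : ∃ m, m ∉ B j ∧ B (j + 1) = insert m (B j) := by
    have h1 : (B (j + 1) \ B j).card = 1 := by
      rw [Finset.card_sdiff_of_subset (hsub j hj), hB _ hj, hB j hj.le]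
      omega
    obtain ⟨m, hm⟩ := Finset.card_eq_one.1 h1
    refine ⟨m, (Finset.mem_sdiff.1 (hm ▸ Finset.mem_singleton_self m)).2, ?_⟩
    rw [← Finset.sdiff_union_of_subset (hsub j hj), hm]
    rfl
  have h1 : c.char (splitIdem (B j)) = 1 := by
    refine c.char_eq_one_of_mul (isIdempotentElem_splitIdem _) (isIdempotentElem_splitIdem _)
      ?_ hj1 hj0
    rw [hins]
    exact splitIdem_mul_mul_insert hm
  -- The value `1` is now a product of a multiplicity and the rank of `e_c` on `V_c`, both natural
  -- numbers.
  obtain ⟨n, -, hn⟩ := (IsIdemAdditive.of_trace (τ := c.char.toAddMonoidHom)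
    c.char_mul_comm).exists_mult_char (isIdempotentElem_splitIdem (B j))
  have h2 := hn c
  rw [h1, c.char_idem_eq c.isIdempotentElem_idem] at h2
  rw [c.char_idem_eq c.isIdempotentElem_idem]
  norm_cast at h2 ⊢
  exact Nat.eq_one_of_mul_eq_one_left h2.symm

variable {M : Type*} [AddCommGroup M] {Φ : MonoidAlgebra ℚ (Equiv.Perm α) → M}

/-- The multiplicity of each `e_c` in the alternating sum is zero because the character of `V_c`
vanishes there. Since the right side is zero, only `char(e_c) ≠ 0` is needed. -/
theorem IsIdemAdditive.sum_splitIdem (h : IsIdemAdditive Φ) {B : ℕ → Finset α}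
    (hB : ∀ k ≤ Fintype.card α, (B k).card = k) :
    ∑ k ∈ Finset.range (Fintype.card α + 1), (-1 : ℤ) ^ k • Φ (splitIdem (B k)) = 0 := by
  have := Fintype.ofFinite (Irrep (Equiv.Perm α))
  choose n hn hc using fun k => h.exists_mult_char (isIdempotentElem_splitIdem (B k))
  have h1 : ∀ c, ∑ k ∈ Finset.range (Fintype.card α + 1), (-1 : ℤ) ^ k * n k c = 0 := by
    intro c
    have h2 := sum_neg_one_pow_apply_splitIdem c.char_mul_comm B hB
    simp only [hc, ← mul_assoc] at h2
    rw [← Finset.sum_mul] at h2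
    have h3 := (mul_eq_zero.1 h2).resolve_right c.char_idem_self_ne_zero
    exact_mod_cast h3
  simp only [hn, Finset.smul_sum, ← natCast_zsmul, smul_smul]
  rw [Finset.sum_comm]
  refine Finset.sum_eq_zero fun c _ => ?_
  rw [← Finset.sum_smul, h1, zero_smul]

/-- The pairing with the trace of a cycle of maximal length. -/
theorem IsIdemAdditive.sum_tr_smul [Fintype (Irrep (Equiv.Perm α))] (h : IsIdemAdditive Φ)
    {B : ℕ → Finset α}
    (hB : ∀ k ≤ Fintype.card α, (B k).card = k) (hsub : ∀ k < Fintype.card α, B k ⊆ B (k + 1))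
    {g : Equiv.Perm α} (hg : g.IsCycleOn Set.univ) :
    ∑ c : Irrep (Equiv.Perm α), tr g (K0.of c.rep) • Φ c.idem =
      -∑ k ∈ Finset.range (Fintype.card α + 1), ((k : ℤ) * (-1) ^ k) • Φ (splitIdem (B k)) := by
  choose n hn hc using fun k => h.exists_mult_char (isIdempotentElem_splitIdem (B k))
  have h1 : ∀ c : Irrep (Equiv.Perm α), tr g (K0.of c.rep) =
      -∑ k ∈ Finset.range (Fintype.card α + 1), ((k : ℤ) * (-1) ^ k) * n k c := by
    intro c
    rw [← Int.cast_inj (α := ℚ), tr_of, ← c.char_of,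
      apply_of_isCycleOn c.char_mul_comm B hB hg]
    push_cast
    congr 1
    refine Finset.sum_congr rfl fun k hk => ?_
    have hk' : k ≤ Fintype.card α := Nat.lt_succ_iff.1 (Finset.mem_range.1 hk)
    -- Either the multiplicity is zero, or `V_c` is absolutely irreducible and the character value
    -- equals the multiplicity.
    by_cases h0 : c.char (splitIdem (B k)) = 0
    · have h2 := hc k c
      rw [h0, zero_eq_mul] at h2
      rw [h0, h2.resolve_right c.char_idem_self_ne_zero]
      simp
    · rw [hc, c.char_idem_self_eq_one hB hsub hk' h0]
      ring
  simp only [hn, h1, Finset.smul_sum, ← natCast_zsmul, smul_smul]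
  rw [Finset.sum_comm, ← Finset.sum_neg_distrib]
  refine Finset.sum_congr rfl fun c _ => ?_
  rw [neg_smul, Finset.sum_smul]

end CyclePairing

/-! ### Concatenation of tensor powers and equivariance of tensor products of morphisms. -/

section TensorPowers

variable {T : Type u} [Category.{v} T] [MonoidalCategory T]

/-- The isomorphism `V^{⊗ a} ⊗ V^{⊗ b} ≅ V^{⊗ (b + a)}`. -/
def powMul (V : T) (b : ℕ) : (a : ℕ) → (tensorPow V a ⊗ tensorPow V b ≅ tensorPow V (b + a))
  | 0 => λ_ _
  | a + 1 => α_ V (tensorPow V a) (tensorPow V b) ≪≫ whiskerLeftIso V (powMul V b a)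

/-- The tensor product `f_0 ⊗ ⋯ ⊗ f_{n-1}`. -/
def tensorMap {V W : T} : (n : ℕ) → (Fin n → (V ⟶ W)) → (tensorPow V n ⟶ tensorPow W n)
  | 0, _ => 𝟙 _
  | n + 1, f => MonoidalCategoryStruct.tensorHom (f 0) (tensorMap n fun i => f i.succ)

theorem tensorMap_succ {V W : T} {n : ℕ} (f : Fin (n + 1) → (V ⟶ W)) : tensorMap (n + 1) f =
    MonoidalCategoryStruct.tensorHom (f 0) (tensorMap n fun i => f i.succ) := rfl

theorem tensorMap_id (V : T) (n : ℕ) : tensorMap n (fun _ => 𝟙 V) = 𝟙 (tensorPow V n) := by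
  induction n with
  | zero => rfl
  | succ n ih => rw [tensorMap_succ, ih]; exact id_tensorHom_id _ _

theorem tensorMap_comp {U V W : T} {n : ℕ} (f : Fin n → (U ⟶ V)) (g : Fin n → (V ⟶ W)) :
    tensorMap n f ≫ tensorMap n g = tensorMap n fun i => f i ≫ g i := by
  induction n with
  | zero => exact Category.id_comp _
  | succ n ih =>
    rw [tensorMap_succ, tensorMap_succ, tensorMap_succ, ← ih]
    exact tensorHom_comp_tensorHom _ _ _ _

/-- This and the next two lemmas are inductive steps for `powMul`. Arbitrary objects in place of
tensor powers let them apply through definitional unfolding of `tensorPow` and `powMul`; the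
exponent `b + a` makes the recursion on `a` definitional. -/
theorem tensorHom_assoc_step {V W X X' Y Y' Z Z' : T} (f : V ⟶ W) {g : X ⟶ X'} {h : Y ⟶ Y'}
    {k : Z ⟶ Z'} {φ : X ⊗ Y ⟶ Z} {φ' : X' ⊗ Y' ⟶ Z'} (hk : (g ⊗ₘ h) ≫ φ' = φ ≫ k) :
    ((f ⊗ₘ g) ⊗ₘ h) ≫ (α_ W X' Y').hom ≫ W ◁ φ' = ((α_ V X Y).hom ≫ V ◁ φ) ≫ (f ⊗ₘ k) := by
  rw [associator_naturality_assoc, tensorHom_comp_whiskerLeft, hk, Category.assoc,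
    whiskerLeft_comp_tensorHom]

theorem whiskerRight_assoc_step (V : T) {X Y Z : T} {s : X ⟶ X} {t : Z ⟶ Z} {φ : X ⊗ Y ⟶ Z}
    (h : s ▷ Y ≫ φ = φ ≫ t) :
    (V ◁ s) ▷ Y ≫ (α_ V X Y).hom ≫ V ◁ φ = ((α_ V X Y).hom ≫ V ◁ φ) ≫ V ◁ t := by
  rw [Category.assoc, ← whiskerLeft_comp, ← h, whiskerLeft_comp,
    associator_naturality_middle_assoc]

theorem whiskerLeft_assoc_step (V : T) {X Y Z : T} {s : Y ⟶ Y} {t : Z ⟶ Z} {φ : X ⊗ Y ⟶ Z}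
    (h : X ◁ s ≫ φ = φ ≫ t) :
    (V ⊗ X) ◁ s ≫ (α_ V X Y).hom ≫ V ◁ φ = ((α_ V X Y).hom ≫ V ◁ φ) ≫ V ◁ t := by
  rw [Category.assoc, ← whiskerLeft_comp, ← h, whiskerLeft_comp,
    associator_naturality_right_assoc]

theorem tensorMap_powMul {V W : T} (a b : ℕ) (f : ℕ → (V ⟶ W)) :
    MonoidalCategoryStruct.tensorHom (tensorMap a fun i => f i) (tensorMap b fun i => f (i + a)) ≫
      (powMul W b a).hom = (powMul V b a).hom ≫ tensorMap (b + a) fun i => f i := by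
  induction a generalizing f with
  | zero => 
    refine (congrArg (· ≫ _) (id_tensorHom _ _)).trans (leftUnitor_naturality _)
  | succ a ih =>
    exact tensorHom_assoc_step (f 0) (ih fun i => f (i + 1))

variable [SymmetricCategory T]

theorem swapFront_tensor {V W X Y : T} (f g : V ⟶ W) (h : X ⟶ Y) :
    swapFront V X ≫ MonoidalCategoryStruct.tensorHom f (MonoidalCategoryStruct.tensorHom g h) =
      MonoidalCategoryStruct.tensorHom g (MonoidalCategoryStruct.tensorHom f h) ≫
        swapFront W Y := by
  simp only [swapFront, Category.assoc]
  rw [← associator_naturality, whiskerRight_comp_tensorHom_assoc, ← BraidedCategory.braiding_naturality,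
    associator_inv_naturality_assoc, ← Category.assoc (_ ⊗ₘ h), tensorHom_comp_whiskerRight]

theorem swapFront_whiskerRight (V : T) {X Y Z : T} (φ : X ⊗ Y ⟶ Z) :
    swapFront V X ▷ Y ≫ (α_ V (V ⊗ X) Y).hom ≫ V ◁ ((α_ V X Y).hom ≫ V ◁ φ) =
      ((α_ V (V ⊗ X) Y).hom ≫ V ◁ ((α_ V X Y).hom ≫ V ◁ φ)) ≫ swapFront V Z := by
  have h := swapFront_natural V φ
  have h1 : swapFront V X ▷ Y ≫ (α_ V (V ⊗ X) Y).hom ≫ V ◁ (α_ V X Y).hom =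
      (α_ V (V ⊗ X) Y).hom ≫ V ◁ (α_ V X Y).hom ≫ swapFront V (X ⊗ Y) := by
    simp only [swapFront]
    monoidal
  simp only [whiskerLeft_comp, Category.assoc, h]
  rw [reassoc_of% h1]

theorem permMor_adjTransp (V : T) {n : ℕ} (j : Fin n) :
    permMor V (n + 1) (adjTransp j) = adjSwap V (n + 1) j := by
  have h := permMor_adjTransp_mul V n j 1
  rwa [mul_one, permMor_one, Category.id_comp] at h

theorem permMor_swap (V : T) {n : ℕ} {x y : Fin n} (h : (y : ℕ) = x + 1) :
    permMor V n (Equiv.swap x y) = adjSwap V n x := by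
  obtain ⟨m, rfl⟩ : ∃ m, n = m + 1 := ⟨n - 1, by have := x.isLt; omega⟩
  have hx : (x : ℕ) < m := by have := y.isLt; omega
  have h1 : Equiv.swap x y = adjTransp ⟨x, hx⟩ := by
    rw [adjTransp]
    congr 1
    exact Fin.ext h
  rw [h1, permMor_adjTransp]

/-- Induction on a permutation of `Fin n` along adjacent transpositions. -/
theorem perm_fin_induction {n : ℕ} {P : Equiv.Perm (Fin n) → Prop} (one : P 1)
    (mul : ∀ σ τ, P σ → P τ → P (σ * τ))
    (swap : ∀ x y : Fin n, (y : ℕ) = x + 1 → P (Equiv.swap x y)) (σ : Equiv.Perm (Fin n)) : P σ := by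
  rcases n with _ | n
  · rwa [Subsingleton.elim σ 1]
  have h : σ ∈ Submonoid.closure (Set.range (fun i : Fin n => Equiv.swap i.castSucc i.succ)) := by
    rw [Equiv.Perm.mclosure_swap_castSucc_succ]
    trivial
  induction h using Submonoid.closure_induction with
  | mem x hx =>
    obtain ⟨j, rfl⟩ := hx
    exact swap _ _ (by simp)
  | one => exact one
  | mul x y _ _ hx hy => exact mul x y hx hy

theorem adjSwap_tensorMap {V W : T} {n : ℕ} (j : Fin n) (f : Fin (n + 1) → (V ⟶ W)) :
    adjSwap V (n + 1) j ≫ tensorMap (n + 1) f =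
      tensorMap (n + 1) (f ∘ adjTransp j) ≫ adjSwap W (n + 1) j := by
  induction n with
  | zero => exact j.elim0
  | succ n ih =>
    cases j using Fin.cases with
    | zero =>
      have h1 : ∀ i : Fin n, adjTransp (0 : Fin (n + 1)) i.succ.succ = i.succ.succ := fun i => by
        apply Fin.ext
        rw [adjTransp_val]
        simp
      have h2 := swapFront_tensor (f 0) (f 1) (tensorMap n fun i => f i.succ.succ)
      have h3 : tensorMap (n + 2) (f ∘ adjTransp 0) = MonoidalCategoryStruct.tensorHom (f 1)
          (MonoidalCategoryStruct.tensorHom (f 0) (tensorMap n fun i => f i.succ.succ)) := by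
        rw [tensorMap_succ, tensorMap_succ]
        simp only [Function.comp_apply, h1]
        congr 2
      rw [h3]
      exact h2
    | succ j =>
      have h1 : adjTransp j.succ 0 = 0 := by
        apply Fin.ext
        rw [adjTransp_val]
        simp
      have h2 : ∀ i, adjTransp j.succ i.succ = (adjTransp j i).succ := fun i => by
        apply Fin.ext
        rw [adjTransp_val, Fin.val_succ, Fin.val_succ, Fin.val_succ, adjTransp_val]
        split_ifs <;> omega
      have h3 := ih j fun i => f i.succ
      have h4 : tensorMap (n + 2) (f ∘ adjTransp j.succ) = MonoidalCategoryStruct.tensorHom (f 0)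
          (tensorMap (n + 1) ((fun i => f i.succ) ∘ adjTransp j)) := by
        rw [tensorMap_succ]
        simp only [Function.comp_apply, h1, h2]
        rfl
      rw [Fin.val_succ, adjSwap_succ, adjSwap_succ, h4]
      exact (whiskerLeft_comp_tensorHom _ _ _).trans
        ((congrArg _ h3).trans (tensorHom_comp_whiskerLeft _ _ _).symm)

/-- Equivariance of the tensor product of morphisms. -/
theorem permMor_tensorMap {V W : T} {n : ℕ} (σ : Equiv.Perm (Fin n)) (f : Fin n → (V ⟶ W)) :
    permMor V n σ ≫ tensorMap n f = tensorMap n (f ∘ σ) ≫ permMor W n σ := by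
  induction σ using perm_fin_induction generalizing f with
  | one => rw [permMor_one, permMor_one, Category.id_comp, Category.comp_id]; rfl
  | mul σ τ hσ hτ =>
    rw [permMor_mul, permMor_mul, Category.assoc, hσ, ← Category.assoc, hτ, Category.assoc]
    rfl
  | swap x y h =>
    obtain ⟨m, rfl⟩ : ∃ m, n = m + 1 := ⟨n - 1, by have := x.isLt; omega⟩
    have hx : (x : ℕ) < m := by have := y.isLt; omega
    have h1 : Equiv.swap x y = adjTransp ⟨x, hx⟩ := by
      rw [adjTransp]
      congr 1
      exact Fin.ext h
    rw [h1, permMor_adjTransp, permMor_adjTransp]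
    exact adjSwap_tensorMap _ f

theorem adjSwap_powMul_left (V : T) (a b j : ℕ) (h : j + 1 < a) :
    adjSwap V a j ▷ tensorPow V b ≫ (powMul V b a).hom =
      (powMul V b a).hom ≫ adjSwap V (b + a) j := by
  induction j generalizing a with
  | zero =>
    obtain ⟨a, rfl⟩ : ∃ m, a = m + 2 := ⟨a - 2, by omega⟩
    exact swapFront_whiskerRight V (powMul V b a).hom
  | succ j ih =>
    obtain ⟨a, rfl⟩ : ∃ m, a = m + 1 := ⟨a - 1, by omega⟩
    rw [adjSwap_succ]
    exact (whiskerRight_assoc_step V (ih a (by omega))).trans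
      (congrArg _ (adjSwap_succ V (b + a) j).symm)

/-- The right factor occupies the positions from `a` on, hence the shift of `j` by `a`. -/
theorem adjSwap_powMul_right (V : T) (a b j : ℕ) :
    tensorPow V a ◁ adjSwap V b j ≫ (powMul V b a).hom =
      (powMul V b a).hom ≫ adjSwap V (b + a) (j + a) := by
  induction a with
  | zero => exact leftUnitor_naturality _
  | succ a ih =>
    exact (whiskerLeft_assoc_step V ih).trans
      (congrArg _ (adjSwap_succ V (b + a) (j + a)).symm)

end TensorPowers

/-! ### Standard representatives of the subsets and the corresponding Young subgroups. -/

section LastSet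

/-- The set of the last `k` elements of `{0, …, r-1}`. -/
def lastSet (r k : ℕ) : Finset (Fin r) := {x | r ≤ (x : ℕ) + k}

theorem mem_lastSet {r k : ℕ} {x : Fin r} : x ∈ lastSet r k ↔ r ≤ (x : ℕ) + k := by
  simp [lastSet]

theorem lastSet_subset (r k : ℕ) : lastSet r k ⊆ lastSet r (k + 1) := fun x hx => by
  rw [mem_lastSet] at hx ⊢
  omega

/-- The last `b` elements of `Fin (b + a)`. -/
def lastEquiv (a b : ℕ) : Fin b ≃ {x // x ∈ lastSet (b + a) b} where
  toFun i := ⟨⟨i + a, by omega⟩, by rw [mem_lastSet]; simp only; omega⟩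
  invFun x := ⟨x.1 - a, by have := mem_lastSet.1 x.2; omega⟩
  left_inv i := by simp
  right_inv x := by
    have := mem_lastSet.1 x.2
    ext
    simp only
    omega

/-- The first `a` elements of `Fin (b + a)`. -/
def firstEquiv (a b : ℕ) : Fin a ≃ {x // x ∉ lastSet (b + a) b} where
  toFun i := ⟨⟨i, by omega⟩, by rw [mem_lastSet]; simp only; omega⟩
  invFun x := ⟨x.1, by have := mt mem_lastSet.2 x.2; omega⟩
  left_inv i := rfl
  right_inv x := rfl

theorem card_lastSet {r k : ℕ} (hk : k ≤ r) : (lastSet r k).card = k := by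
  obtain ⟨a, rfl⟩ := Nat.exists_eq_add_of_le hk
  rw [← Fintype.card_coe, ← Fintype.card_congr (lastEquiv a k), Fintype.card_fin]

/-- The embedding of `Σ_b` in `Σ_{b+a}` permuting the last elements. -/
def lastHom (a b : ℕ) : Equiv.Perm (Fin b) →* Equiv.Perm (Fin (b + a)) :=
  ((splitHom (lastSet (b + a) b)).comp (MonoidHom.inl _ _)).comp
    (lastEquiv a b).permCongrHom.toMonoidHom

/-- The embedding of `Σ_a` in `Σ_{b+a}` permuting the first elements. -/
def firstHom (a b : ℕ) : Equiv.Perm (Fin a) →* Equiv.Perm (Fin (b + a)) :=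
  ((splitHom (lastSet (b + a) b)).comp (MonoidHom.inr _ _)).comp
    (firstEquiv a b).permCongrHom.toMonoidHom

theorem permCongrHom_swap {α β : Type*} [DecidableEq α] [DecidableEq β] (e : α ≃ β) (x y : α) :
    e.permCongrHom (Equiv.swap x y) = Equiv.swap (e x) (e y) :=
  Equiv.symm_trans_swap_trans x y e

theorem lastHom_swap {a b : ℕ} (x y : Fin b) : lastHom a b (Equiv.swap x y) =
    Equiv.swap (lastEquiv a b x).1 (lastEquiv a b y).1 := by
  refine (congrArg (fun p => splitHom (lastSet (b + a) b) (p, 1)) (permCongrHom_swap _ x y)).trans ?_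
  exact splitHom_swap_mem _ _

theorem firstHom_swap {a b : ℕ} (x y : Fin a) : firstHom a b (Equiv.swap x y) =
    Equiv.swap (firstEquiv a b x).1 (firstEquiv a b y).1 := by
  refine (congrArg (fun p => splitHom (lastSet (b + a) b) (1, p)) (permCongrHom_swap _ x y)).trans ?_
  exact splitHom_swap_notMem _ _

/-- Averaging over a product group is averaging over the two factors successively. -/
theorem charIdem_coprod {H H' G : Type} [Group H] [Group H'] [Fintype H] [Fintype H'] [Group G]
    (θ : H × H' →* G) (ε : H →* ℤˣ) (ε' : H' →* ℤˣ) : charIdem θ (ε.coprod ε') =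
      charIdem (θ.comp (MonoidHom.inl H H')) ε * charIdem (θ.comp (MonoidHom.inr H H')) ε' := by
  rw [charIdem, charIdem, charIdem, smul_mul_smul_comm, Finset.sum_mul_sum, Fintype.card_prod,
    Nat.cast_mul, mul_inv, Fintype.sum_prod_type]
  refine congrArg _ (Finset.sum_congr rfl fun h _ => Finset.sum_congr rfl fun h' _ => ?_)
  rw [smul_mul_smul_comm, ← map_mul unitRat, ← map_mul, MonoidHom.comp_apply, MonoidHom.comp_apply,
    ← map_mul θ]
  simp

/-- The ring homomorphism of group algebras induced by a group homomorphism. -/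
def algMap {H G : Type} [Group H] [Group G] (θ : H →* G) :
    MonoidAlgebra ℚ H →ₐ[ℚ] MonoidAlgebra ℚ G :=
  MonoidAlgebra.lift ℚ _ H ((MonoidAlgebra.of ℚ G).comp θ)

theorem algMap_of {H G : Type} [Group H] [Group G] (θ : H →* G) (h : H) :
    algMap θ (MonoidAlgebra.of ℚ H h) = MonoidAlgebra.of ℚ G (θ h) :=
  MonoidAlgebra.lift_of _ _

theorem algMap_charIdem {H K G : Type} [Group H] [Fintype H] [Group K] [Group G] (θ : K →* G)
    (η : H →* K) (ε : H →* ℤˣ) : algMap θ (charIdem η ε) = charIdem (θ.comp η) ε := by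
  simp only [charIdem, map_smul, map_sum, algMap_of, MonoidHom.comp_apply]

/-- The idempotent of a sign character of the group itself. -/
abbrev selfIdem {G : Type} [Group G] [Fintype G] (ε : G →* ℤˣ) : MonoidAlgebra ℚ G :=
  charIdem (MonoidHom.id G) ε

theorem charIdem_lastSet {a b : ℕ} (ε : Equiv.Perm {x // x ∈ lastSet (b + a) b} →* ℤˣ)
    (ε' : Equiv.Perm {x // x ∉ lastSet (b + a) b} →* ℤˣ) :
    charIdem (splitHom (lastSet (b + a) b)) (ε.coprod ε') =
      algMap (lastHom a b) (selfIdem (ε.comp (lastEquiv a b).permCongrHom.toMonoidHom)) *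
      algMap (firstHom a b) (selfIdem (ε'.comp (firstEquiv a b).permCongrHom.toMonoidHom)) := by
  rw [charIdem_coprod, algMap_charIdem, algMap_charIdem, MonoidHom.comp_id, MonoidHom.comp_id,
    lastHom, firstHom, charIdem_comp, charIdem_comp]

theorem splitIdem_lastSet (a b : ℕ) : splitIdem (lastSet (b + a) b) =
    algMap (lastHom a b) (selfIdem Equiv.Perm.sign) * algMap (firstHom a b) (selfIdem 1) := by
  have h1 : splitSign (lastSet (b + a) b) = Equiv.Perm.sign.coprod 1 := by
    ext p
    simp
  have h2 : Equiv.Perm.sign.comp (lastEquiv a b).permCongrHom.toMonoidHom = Equiv.Perm.sign := by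
    ext p
    exact congrArg Units.val (Equiv.Perm.sign_permCongr (lastEquiv a b) p)
  rw [splitIdem, h1, charIdem_lastSet, h2, MonoidHom.one_comp]

/-- The symmetrizer over the first `a` and over the last `b` elements. -/
theorem charIdem_lastSet_one (a b : ℕ) : charIdem (splitHom (lastSet (b + a) b)) 1 =
    algMap (lastHom a b) (selfIdem 1) * algMap (firstHom a b) (selfIdem 1) := by
  have h1 : (1 : Equiv.Perm {x // x ∈ lastSet (b + a) b} ×
      Equiv.Perm {x // x ∉ lastSet (b + a) b} →* ℤˣ) = MonoidHom.coprod 1 1 := by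
    ext p
    simp
  rw [h1, charIdem_lastSet, MonoidHom.one_comp, MonoidHom.one_comp]

end LastSet

/-! ### The group algebra acting on a concatenation of tensor powers. -/

section Equivariance

variable {T : Type u} [Category.{v} T] [MonoidalCategory T] [SymmetricCategory T]

theorem permMor_powMul_left (V : T) (a b : ℕ) (σ : Equiv.Perm (Fin a)) :
    permMor V a σ ▷ tensorPow V b ≫ (powMul V b a).hom =
      (powMul V b a).hom ≫ permMor V (b + a) (firstHom a b σ) := by
  induction σ using perm_fin_induction with
  | one => simp [permMor_one]
  | mul σ τ hσ hτ =>
    rw [permMor_mul, map_mul, permMor_mul, comp_whiskerRight, Category.assoc, hσ, reassoc_of% hτ]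
  | swap x y h =>
    rw [firstHom_swap, permMor_swap V h, permMor_swap V
      (x := (firstEquiv a b x).1) (y := (firstEquiv a b y).1) h,
      adjSwap_powMul_left V a b x (by have := y.isLt; omega)]
    rfl

theorem permMor_powMul_right (V : T) (a b : ℕ) (σ : Equiv.Perm (Fin b)) :
    tensorPow V a ◁ permMor V b σ ≫ (powMul V b a).hom =
      (powMul V b a).hom ≫ permMor V (b + a) (lastHom a b σ) := by
  induction σ using perm_fin_induction with
  | one => simp [permMor_one]
  | mul σ τ hσ hτ =>
    rw [permMor_mul, map_mul, permMor_mul, whiskerLeft_comp, Category.assoc, hσ, reassoc_of% hτ]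
  | swap x y h =>
    rw [lastHom_swap, permMor_swap V h, permMor_swap V
      (x := (lastEquiv a b x).1) (y := (lastEquiv a b y).1)
      (show (y : ℕ) + a = (x + a) + 1 by omega), adjSwap_powMul_right V a b x]
    rfl

variable [Preadditive T] [Linear ℚ T]

/-- The action of the group algebra of the symmetric group on a tensor power. -/
def powAct (V : T) (n : ℕ) : MonoidAlgebra ℚ (Equiv.Perm (Fin n)) →ₐ[ℚ] End (tensorPow V n) :=
  groupAlgebraAct (tensorPowAction V n)

theorem powAct_of (V : T) (n : ℕ) (σ : Equiv.Perm (Fin n)) :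
    powAct V n (MonoidAlgebra.of ℚ _ σ) = permMor V n σ :=
  groupAlgebraAct_of _ _

theorem powAct_mul (V : T) (n : ℕ) (x y : MonoidAlgebra ℚ (Equiv.Perm (Fin n))) :
    (powAct V n (x * y) : tensorPow V n ⟶ tensorPow V n) = powAct V n y ≫ powAct V n x :=
  map_mul (powAct V n) x y

theorem powAct_comp_self (V : T) (n : ℕ) {x : MonoidAlgebra ℚ (Equiv.Perm (Fin n))}
    (hx : IsIdempotentElem x) : (powAct V n x : tensorPow V n ⟶ tensorPow V n) ≫ powAct V n x =
      powAct V n x := by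
  rw [← powAct_mul, hx.eq]

variable [MonoidalPreadditive T] [MonoidalLinear ℚ T]

theorem powAct_powMul_left (V : T) (a b : ℕ) (x : MonoidAlgebra ℚ (Equiv.Perm (Fin a))) :
    (powAct V a x : tensorPow V a ⟶ tensorPow V a) ▷ tensorPow V b ≫ (powMul V b a).hom =
      (powMul V b a).hom ≫ powAct V (b + a) (algMap (firstHom a b) x) := by
  induction x using MonoidAlgebra.induction_on with
  | of σ => rw [algMap_of, powAct_of, powAct_of, permMor_powMul_left]
  | add x y hx hy =>
    rw [map_add, map_add, map_add]
    refine (congrArg (· ≫ _) (MonoidalPreadditive.add_whiskerRight _ _)).trans ?_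
    rw [Preadditive.add_comp, hx, hy]
    exact (Preadditive.comp_add _ _ _ _ _ _).symm
  | smul r x hx =>
    rw [map_smul, map_smul, map_smul]
    refine (congrArg (· ≫ _) (MonoidalLinear.smul_whiskerRight _ _ _)).trans ?_
    rw [Linear.smul_comp, hx]
    exact (Linear.comp_smul _ _ _ _ _ _).symm

theorem powAct_powMul_right (V : T) (a b : ℕ) (x : MonoidAlgebra ℚ (Equiv.Perm (Fin b))) :
    tensorPow V a ◁ (powAct V b x : tensorPow V b ⟶ tensorPow V b) ≫ (powMul V b a).hom =
      (powMul V b a).hom ≫ powAct V (b + a) (algMap (lastHom a b) x) := by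
  induction x using MonoidAlgebra.induction_on with
  | of σ => rw [algMap_of, powAct_of, powAct_of, permMor_powMul_right]
  | add x y hx hy =>
    rw [map_add, map_add, map_add]
    refine (congrArg (· ≫ _) (MonoidalPreadditive.whiskerLeft_add _ _)).trans ?_
    rw [Preadditive.add_comp, hx, hy]
    exact (Preadditive.comp_add _ _ _ _ _ _).symm
  | smul r x hx =>
    rw [map_smul, map_smul, map_smul]
    refine (congrArg (· ≫ _) (MonoidalLinear.whiskerLeft_smul _ _ _)).trans ?_
    rw [Linear.smul_comp, hx]
    exact (Linear.comp_smul _ _ _ _ _ _).symm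

theorem powAct_powMul (V : T) (a b : ℕ) (x : MonoidAlgebra ℚ (Equiv.Perm (Fin a)))
    (y : MonoidAlgebra ℚ (Equiv.Perm (Fin b))) :
    MonoidalCategoryStruct.tensorHom (C := T) (powAct V a x) (powAct V b y) ≫
      (powMul V b a).hom = (powMul V b a).hom ≫
        powAct V (b + a) (algMap (lastHom a b) y * algMap (firstHom a b) x) := by
  rw [powAct_mul, ← Category.assoc, ← powAct_powMul_left, Category.assoc, ← powAct_powMul_right,
    ← Category.assoc, ← MonoidalCategory.tensorHom_def]

variable [HasZeroObject T] [HasBinaryBiproducts T] [IsIdempotentComplete T]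

/-- Concatenation conjugates the tensor product of the symmetrizer on `a` letters and the
antisymmetrizer on `b` letters into the split idempotent. -/
theorem idemClass_powAct_splitIdem (V : T) (a b : ℕ) :
    idemClass (powAct V (b + a) (splitIdem (lastSet (b + a) b))) =
      idemClass (powAct V a (selfIdem 1)) * idemClass (powAct V b (selfIdem Equiv.Perm.sign)) := by
  have ha := powAct_comp_self V a (isIdempotentElem_charIdem (MonoidHom.id _) 1)
  have hb := powAct_comp_self V b (isIdempotentElem_charIdem (MonoidHom.id _) Equiv.Perm.sign)
  rw [← idemClass_tensor ha hb]
  refine (idemClass_conj ?_ (powMul V b a) ?_).symm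
  · exact (tensorHom_comp_tensorHom _ _ _ _).trans (by rw [ha, hb])
  · rw [splitIdem_lastSet]
    exact powAct_powMul V a b _ _

end Equivariance

/-! ### The symmetrizer relative to idempotents permuted by the symmetric group. -/

section CrossedProduct

variable {α : Type} [Fintype α] [DecidableEq α] {S M : Type*} [Ring S] [Algebra ℚ S]
  [AddCommGroup M]

/-- If `s` is the image of the symmetrizer and the `π_A` form a complete family of orthogonal
idempotents permuted by the symmetric group, then `s` is equivalent to the orthogonal sum of the
idempotents `π_B f_B`, for representatives `B` of the orbits of the symmetric group on subsets, where
`f_B` is the symmetrizer of the stabilizer of `B`. -/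
theorem IsIdemAdditive.apply_symmetrizer {Φ : S → M} (h : IsIdemAdditive Φ)
    (ρ : MonoidAlgebra ℚ (Equiv.Perm α) →ₐ[ℚ] S) (π : Finset α → S)
    (hπ : ∀ A, π A * π A = π A) (hπ' : ∀ A A', A ≠ A' → π A * π A' = 0) (hsum : ∑ A, π A = 1)
    (hρ : ∀ (σ : Equiv.Perm α) A, ρ (MonoidAlgebra.of ℚ _ σ) * π A =
      π (A.map σ.toEmbedding) * ρ (MonoidAlgebra.of ℚ _ σ))
    (B : ℕ → Finset α) (hB : ∀ k ≤ Fintype.card α, (B k).card = k) :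
    Φ (ρ (selfIdem 1)) = ∑ k ∈ Finset.range (Fintype.card α + 1),
      Φ (π (B k) * ρ (charIdem (splitHom (B k)) 1)) := by
  set s := ρ (selfIdem 1) with hs
  have hss : s * s = s := by
    rw [hs, ← map_mul, (isIdempotentElem_charIdem (MonoidHom.id _) 1).eq]
  have hσs : ∀ σ, ρ (MonoidAlgebra.of ℚ _ σ) * s = s := fun σ => by
    have := of_mul_charIdem (MonoidHom.id (Equiv.Perm α)) 1 σ
    rw [MonoidHom.one_apply, map_one, one_smul] at this
    rw [hs, ← map_mul, ← MonoidHom.id_apply (Equiv.Perm α) σ, this]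
  have hsσ : ∀ σ, s * ρ (MonoidAlgebra.of ℚ _ σ) = s := fun σ => by
    have := charIdem_mul_of (MonoidHom.id (Equiv.Perm α)) 1 σ
    rw [MonoidHom.one_apply, map_one, one_smul] at this
    rw [hs, ← map_mul, ← MonoidHom.id_apply (Equiv.Perm α) σ, this]
  have hs_eq : s = ((Fintype.card α).factorial : ℚ)⁻¹ •
      ∑ σ : Equiv.Perm α, ρ (MonoidAlgebra.of ℚ _ σ) := by
    rw [hs, selfIdem, charIdem, map_smul, map_sum, Fintype.card_perm]
    simp
  have hf_eq : ∀ C : Finset α, ρ (charIdem (splitHom C) 1) =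
      ((C.card.factorial : ℚ) * (Fintype.card α - C.card).factorial)⁻¹ •
        ∑ p, ρ (MonoidAlgebra.of ℚ _ (splitHom C p)) := fun C => by
    rw [charIdem, map_smul, map_sum, Fintype.card_prod, Fintype.card_perm, Fintype.card_perm,
      Fintype.card_coe, Fintype.card_subtype_compl, Fintype.card_coe, Nat.cast_mul]
    simp
  have hfs : ∀ C : Finset α, ρ (charIdem (splitHom C) 1) * s = s := fun C => by
    rw [hf_eq, smul_mul_assoc, Finset.sum_mul, Finset.sum_congr rfl fun p _ => hσs _,
      Finset.sum_const, Finset.card_univ, Fintype.card_prod, Fintype.card_perm, Fintype.card_perm,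
      Fintype.card_coe, Fintype.card_subtype_compl, Fintype.card_coe, ← Nat.cast_smul_eq_nsmul ℚ,
      smul_smul, Nat.cast_mul, inv_mul_cancel₀ (by positivity), one_smul]
  have hff : ∀ C : Finset α, ρ (charIdem (splitHom C) 1) * ρ (charIdem (splitHom C) 1) =
      ρ (charIdem (splitHom C) 1) := fun C => by
    rw [← map_mul, (isIdempotentElem_charIdem (splitHom C) 1).eq]
  have hπsπ : ∀ C C' : Finset α, π C * s * π C' = ((Fintype.card α).factorial : ℚ)⁻¹ •
      ∑ σ : Equiv.Perm α, π C * π (C'.map σ.toEmbedding) * ρ (MonoidAlgebra.of ℚ _ σ) := by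
    intro C C'
    rw [hs_eq, mul_smul_comm, smul_mul_assoc, Finset.mul_sum, Finset.sum_mul]
    refine congrArg _ (Finset.sum_congr rfl fun σ _ => ?_)
    rw [mul_assoc, hρ, mul_assoc]
  have hne : ∀ C C' : Finset α, C.card ≠ C'.card → π C * s * π C' = 0 := by
    intro C C' hC
    rw [hπsπ, Finset.sum_eq_zero, smul_zero]
    intro σ _
    rw [hπ', zero_mul]
    rintro rfl
    exact hC (Finset.card_map _)
  -- In the expansion of `s`, only the permutations stabilizing `B k` survive between two copies of
  -- `π (B k)`. The binomial coefficient changes `1 / n!` into the inverse order of that stabilizer.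
  have hself : ∀ k ≤ Fintype.card α, ((Fintype.card α).choose k : ℚ) • (π (B k) * s * π (B k)) =
      π (B k) * ρ (charIdem (splitHom (B k)) 1) := by
    intro k hk
    have h1 : ∑ σ : Equiv.Perm α, π (B k) * π ((B k).map σ.toEmbedding) *
        ρ (MonoidAlgebra.of ℚ _ σ) = π (B k) * ∑ p, ρ (MonoidAlgebra.of ℚ _ (splitHom (B k) p)) := by
      rw [Finset.mul_sum]
      refine (Finset.sum_of_injOn (splitHom (B k))
        (Equiv.Perm.subtypeCongrHom_injective (· ∈ B k)).injOn (by simp [Set.MapsTo]) ?_ ?_).symm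
      · intro σ _ hσ
        rw [hπ', zero_mul]
        intro heq
        refine hσ ⟨_, Finset.mem_coe.2 (Finset.mem_univ _), exists_splitHom_eq (h := σ) fun x => ?_⟩
        conv_lhs => rw [heq]
        rw [Finset.mem_map_equiv, Equiv.symm_apply_apply]
      · intro p _
        have h2 : (B k).map (splitHom (B k) p).toEmbedding = B k := by
          ext x
          rw [Finset.mem_map_equiv, ← splitHom_apply_mem_iff p, Equiv.apply_symm_apply]
        rw [h2, hπ]
    rw [hπsπ, h1, hf_eq, mul_smul_comm, smul_smul, hB k hk, Nat.cast_choose ℚ hk]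
    congr 1
    have := Nat.factorial_ne_zero (Fintype.card α)
    field_simp
  have hconj : ∀ C C' : Finset α, C.card = C'.card → s * π C' * s = s * π C * s := by
    intro C C' hC
    obtain ⟨σ, rfl⟩ := exists_map_eq_of_card hC
    calc s * π (C.map σ.toEmbedding) * s
        = s * (π (C.map σ.toEmbedding) * ρ (MonoidAlgebra.of ℚ _ σ)) * s := by
          simp only [mul_assoc, hσs]
      _ = s * π C * s := by rw [← hρ, ← mul_assoc, hsσ]
  have hcard : ∀ k ∈ Finset.range (Fintype.card α + 1), k ≤ Fintype.card α := fun k hk =>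
    Nat.lt_succ_iff.1 (Finset.mem_range.1 hk)
  -- Insert `1 = ∑ π A` between two copies of `s`; the term `s π A s` depends only on the size of
  -- `A`.
  have htotal : s = ∑ k ∈ Finset.range (Fintype.card α + 1),
      ((Fintype.card α).choose k : ℚ) • (s * π (B k) * s) := by
    have h1 := Finset.sum_powerset (Finset.univ : Finset α) (fun C => s * π C * s)
    rw [Finset.powerset_univ, ← Finset.sum_mul, ← Finset.mul_sum, hsum, mul_one, hss,
      Finset.card_univ] at h1
    refine h1.trans (Finset.sum_congr rfl fun k hk => ?_)
    rw [Finset.sum_congr rfl fun C hC => hconj (B k) C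
      ((hB k (hcard k hk)).trans (Finset.mem_powersetCard.1 hC).2.symm), Finset.sum_const,
      Finset.card_powersetCard, Finset.card_univ, Nat.cast_smul_eq_nsmul]
  have hF : ∀ k ≤ Fintype.card α, IsIdempotentElem
      (((Fintype.card α).choose k : ℚ) • (s * π (B k) * s)) := by
    intro k hk
    calc (((Fintype.card α).choose k : ℚ) • (s * π (B k) * s)) *
          (((Fintype.card α).choose k : ℚ) • (s * π (B k) * s))
        = ((Fintype.card α).choose k : ℚ) •
          (s * (((Fintype.card α).choose k : ℚ) • (π (B k) * (s * s) * π (B k))) * s) := by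
          simp only [smul_mul_assoc, mul_smul_comm, mul_assoc]
      _ = ((Fintype.card α).choose k : ℚ) • (s * π (B k) * s) := by
          rw [hss, hself k hk, mul_assoc, mul_assoc, hfs, mul_assoc]
  have hE : ∀ k ≤ Fintype.card α, IsIdempotentElem
      (π (B k) * ρ (charIdem (splitHom (B k)) 1)) := by
    intro k hk
    calc π (B k) * ρ (charIdem (splitHom (B k)) 1) * (π (B k) * ρ (charIdem (splitHom (B k)) 1))
        = ((Fintype.card α).choose k : ℚ) • (π (B k) * s * (π (B k) * π (B k))) *
            ρ (charIdem (splitHom (B k)) 1) := by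
          conv_lhs => enter [1]; rw [← hself k hk]
          simp only [smul_mul_assoc, mul_assoc]
      _ = π (B k) * ρ (charIdem (splitHom (B k)) 1) := by
          rw [hπ, hself k hk, mul_assoc, hff]
  rw [htotal, h.sum]
  · refine Finset.sum_congr rfl fun k hk => ?_
    have hk' := hcard k hk
    -- The equivalence between the `k`-th summand of `s` and `π (B k) f_{B k}` is given by a
    -- multiple of `s π (B k)` and by `π (B k) s`.
    have h1 : (((Fintype.card α).choose k : ℚ) • (s * π (B k))) * (π (B k) * s) =
        ((Fintype.card α).choose k : ℚ) • (s * π (B k) * s) := by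
      rw [smul_mul_assoc, ← mul_assoc, mul_assoc s, hπ]
    have h2 : (π (B k) * s) * (((Fintype.card α).choose k : ℚ) • (s * π (B k))) =
        π (B k) * ρ (charIdem (splitHom (B k)) 1) := by
      rw [mul_smul_comm, ← mul_assoc, mul_assoc _ s s, hss, hself k hk']
    rw [← h1, ← h2]
    exact h.mvn (h1 ▸ hF k hk') (h2 ▸ hE k hk')
  · intro k hk
    exact hF k (hcard k hk)
  · intro k hk l hl hkl
    have h1 : π (B k) * s * π (B l) = 0 := hne _ _ (by rwa [hB k (hcard k hk), hB l (hcard l hl)])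
    calc (((Fintype.card α).choose k : ℚ) • (s * π (B k) * s)) *
          (((Fintype.card α).choose l : ℚ) • (s * π (B l) * s))
        = ((Fintype.card α).choose k : ℚ) • ((Fintype.card α).choose l : ℚ) •
          (s * (π (B k) * (s * s) * π (B l)) * s) := by
          rw [smul_mul_smul_comm, mul_smul]
          simp only [mul_assoc]
      _ = 0 := by rw [hss, h1]; simp

end CrossedProduct

/-! ### Symmetric powers of direct summands and of direct sums. -/

section TensorMapLinear

variable {T : Type u} [Category.{v} T] [MonoidalCategory T] [Preadditive T] [Linear ℚ T]
  [MonoidalPreadditive T] [MonoidalLinear ℚ T]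

/-- The tensor product of morphisms, as a multilinear map. -/
def tensorMapMultilinear (V W : T) (n : ℕ) :
    MultilinearMap ℚ (fun _ : Fin n => (V ⟶ W)) (tensorPow V n ⟶ tensorPow W n) where
  toFun := tensorMap n
  map_update_add' := by
    intro hd f i x y
    obtain rfl : hd = instDecidableEqFin n := Subsingleton.elim _ _
    induction n with
    | zero => exact i.elim0
    | succ n ih =>
      cases i using Fin.cases with
      | zero =>
        simp only [tensorMap_succ, Function.update_self, Function.update_of_ne (Fin.succ_ne_zero _)]
        exact MonoidalPreadditive.add_tensor _ _ _
      | succ i =>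
        have h1 : ∀ z, (fun j : Fin n => Function.update f i.succ z j.succ) =
            Function.update (fun j => f j.succ) i z := fun z => by
          ext j
          simp [Function.update_apply]
        simp only [tensorMap_succ, Function.update_of_ne (Fin.succ_ne_zero i).symm, h1, ih]
        exact MonoidalPreadditive.tensor_add _ _ _
  map_update_smul' := by
    intro hd f i c x
    obtain rfl : hd = instDecidableEqFin n := Subsingleton.elim _ _
    induction n with
    | zero => exact i.elim0
    | succ n ih =>
      cases i using Fin.cases with
      | zero =>
        simp only [tensorMap_succ, Function.update_self, Function.update_of_ne (Fin.succ_ne_zero _)]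
        refine (MonoidalCategory.tensorHom_def _ _).trans ?_
        rw [MonoidalLinear.smul_whiskerRight, Linear.smul_comp, ← MonoidalCategory.tensorHom_def]
        rfl
      | succ i =>
        have h1 : ∀ z, (fun j : Fin n => Function.update f i.succ z j.succ) =
            Function.update (fun j => f j.succ) i z := fun z => by
          ext j
          simp [Function.update_apply]
        simp only [tensorMap_succ, Function.update_of_ne (Fin.succ_ne_zero i).symm, h1, ih]
        refine (MonoidalCategory.tensorHom_def _ _).trans ?_
        rw [MonoidalLinear.whiskerLeft_smul, Linear.comp_smul, ← MonoidalCategory.tensorHom_def]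
        rfl

theorem sum_tensorMap {V W : T} (n : ℕ) (p q : V ⟶ W) :
    ∑ A : Finset (Fin n), tensorMap n (fun x => if x ∈ A then q else p) =
      tensorMap n fun _ => q + p :=
  ((tensorMapMultilinear V W n).map_add_univ (fun _ => q) (fun _ => p)).symm

theorem tensorMap_eq_zero {V W : T} {n : ℕ} (f : Fin n → (V ⟶ W)) (i : Fin n) (h : f i = 0) :
    tensorMap n f = 0 :=
  (tensorMapMultilinear V W n).map_coord_zero i h

variable [SymmetricCategory T]

theorem powAct_tensorMap {V W : T} {n : ℕ} (f : V ⟶ W)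
    (x : MonoidAlgebra ℚ (Equiv.Perm (Fin n))) :
    (powAct V n x : tensorPow V n ⟶ tensorPow V n) ≫ tensorMap n (fun _ => f) =
      tensorMap n (fun _ => f) ≫ (powAct W n x : tensorPow W n ⟶ tensorPow W n) := by
  induction x using MonoidAlgebra.induction_on with
  | of σ => rw [powAct_of, powAct_of]; exact permMor_tensorMap σ _
  | add x y hx hy =>
    rw [map_add, map_add]
    refine (Preadditive.add_comp _ _ _ _ _ _).trans ?_
    rw [hx, hy]
    exact (Preadditive.comp_add _ _ _ _ _ _).symm
  | smul r x hx =>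
    rw [map_smul, map_smul]
    refine (Linear.smul_comp _ _ _ _ _ _).trans ?_
    rw [hx]
    exact (Linear.comp_smul _ _ _ _ _ _).symm

variable [HasZeroObject T] [HasBinaryBiproducts T] [IsIdempotentComplete T]

/-- The class `[Symⁿ V]` of a symmetric power. -/
def symClass (V : T) (n : ℕ) : K0 T := idemClass (powAct V n (selfIdem 1))

/-- The class `[Λⁿ V]` of an exterior power. -/
def altClass (V : T) (n : ℕ) : K0 T := idemClass (powAct V n (selfIdem Equiv.Perm.sign))

/-- The symmetric power of a direct summand. -/
theorem idemClass_symmetrizer_retract {V U : T} (i : V ⟶ U) (p : U ⟶ V) (h : i ≫ p = 𝟙 V) (n : ℕ) :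
    let e : tensorPow U n ⟶ tensorPow U n :=
      (powAct U n (selfIdem 1) : tensorPow U n ⟶ tensorPow U n) ≫ tensorMap n (fun _ => p ≫ i)
    e ≫ e = e ∧ idemClass (T := T) (X := tensorPow U n) e = symClass V n := by
  intro e
  have h1 : tensorMap n (fun _ => i) ≫ tensorMap n (fun _ => p) = 𝟙 (tensorPow V n) := by
    rw [tensorMap_comp, h, tensorMap_id]
  have hs := powAct_comp_self U n (isIdempotentElem_charIdem (MonoidHom.id _) 1)
  have hs' := powAct_comp_self V n (isIdempotentElem_charIdem (MonoidHom.id _) 1)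
  have h2 : tensorMap n (fun _ => p) ≫ (powAct V n (selfIdem 1) : tensorPow V n ⟶ tensorPow V n) ≫
      tensorMap n (fun _ => i) = e := by
    rw [← Category.assoc, ← powAct_tensorMap, Category.assoc, tensorMap_comp]
  have he : e ≫ e = e := by
    rw [← h2]
    simp only [Category.assoc, reassoc_of% h1, reassoc_of% hs']
  -- The two idempotents are exchanged by symmetrizing and then including, and by projecting.
  refine ⟨he, (idemClass_mvn hs' he ((powAct V n (selfIdem 1) : tensorPow V n ⟶ tensorPow V n) ≫
    tensorMap n (fun _ => i)) (tensorMap n fun _ => p) ?_ h2).symm⟩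
  rw [Category.assoc, h1, Category.comp_id]

/-- The symmetric powers of a direct sum. -/
theorem symClass_biprod (V W : T) (n : ℕ) : symClass (V ⊞ W) n =
    ∑ k ∈ Finset.range (n + 1), symClass V (n - k) * symClass W k := by
  set p : V ⊞ W ⟶ V ⊞ W := biprod.fst ≫ biprod.inl with hp
  set q : V ⊞ W ⟶ V ⊞ W := biprod.snd ≫ biprod.inr with hq
  -- This projects onto the summand of `(V ⊕ W)^{⊗ n}` whose factors are `W` at the positions in `A`
  -- and `V` elsewhere.
  let π : Finset (Fin n) → End (tensorPow (V ⊞ W) n) := fun A =>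
    tensorMap n fun x => if x ∈ A then q else p
  have hpp : p ≫ p = p := by simp [hp]
  have hqq : q ≫ q = q := by simp [hq]
  have hpq : p ≫ q = 0 := by simp [hp, hq]
  have hqp : q ≫ p = 0 := by simp [hp, hq]
  have h := (isIdemAdditive_idemClass (tensorPow (V ⊞ W) n)).apply_symmetrizer
    (powAct (V ⊞ W) n) π ?_ ?_ ?_ ?_ (lastSet n)
    (fun k hk => card_lastSet (hk.trans_eq (Fintype.card_fin n)))
  · rw [Fintype.card_fin] at h
    refine h.trans (Finset.sum_congr rfl fun k hk => ?_)
    obtain ⟨a, rfl⟩ := Nat.exists_eq_add_of_le (Nat.lt_succ_iff.1 (Finset.mem_range.1 hk))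
    rw [Nat.add_sub_cancel_left]
    obtain ⟨h1, h2⟩ := idemClass_symmetrizer_retract (biprod.inl : V ⟶ V ⊞ W) biprod.fst
      biprod.inl_fst a
    obtain ⟨h3, h4⟩ := idemClass_symmetrizer_retract (biprod.inr : W ⟶ V ⊞ W) biprod.snd
      biprod.inr_snd k
    rw [← h2, ← h4, ← idemClass_tensor h1 h3]
    refine (idemClass_conj ?_ (powMul (V ⊞ W) k a) ?_).symm
    · exact (tensorHom_comp_tensorHom _ _ _ _).trans (by rw [h1, h3])
    · have h5 := powAct_powMul (V ⊞ W) a k (selfIdem 1) (selfIdem 1)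
      rw [← charIdem_lastSet_one] at h5
      have h6 := tensorMap_powMul a k (fun i => if a ≤ i then q else p)
      have h7 : (fun i : Fin a => if a ≤ (i : ℕ) then q else p) = fun _ => p :=
        funext fun i => if_neg (by omega)
      have h8 : (fun i : Fin k => if a ≤ (i : ℕ) + a then q else p) = fun _ => q :=
        funext fun i => if_pos (by omega)
      have h9 : (tensorMap (k + a) fun i : Fin (k + a) => if a ≤ (i : ℕ) then q else p) =
          π (lastSet (k + a) k) := by
        refine congrArg (tensorMap (k + a)) (funext fun i => ?_)
        simp only [mem_lastSet]
        exact if_congr (by omega) rfl rfl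
      rw [h7, h8, h9] at h6
      refine (congrArg (· ≫ _) (tensorHom_comp_tensorHom _ _ _ _).symm).trans ?_
      rw [Category.assoc, h6, ← Category.assoc, h5, Category.assoc]
      rfl
  · intro A
    refine (tensorMap_comp _ _).trans (congrArg _ (funext fun x => ?_))
    split_ifs <;> assumption
  · intro A A' hA
    obtain ⟨x, hx⟩ : ∃ x, ¬ (x ∈ A ↔ x ∈ A') := by
      by_contra! hc
      exact hA (Finset.ext hc)
    refine (tensorMap_comp _ _).trans (tensorMap_eq_zero _ x ?_)
    by_cases h1 : x ∈ A <;> by_cases h2 : x ∈ A' <;> simp_all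
  · refine (sum_tensorMap n p q).trans ?_
    rw [add_comm, hp, hq, biprod.total, tensorMap_id]
    rfl
  · intro σ A
    rw [powAct_of]
    refine Eq.trans ?_ (permMor_tensorMap σ _).symm
    refine congrArg (· ≫ permMor (V ⊞ W) n σ) (congrArg _ (funext fun x => ?_))
    simp [Finset.mem_map_equiv]

end TensorMapLinear

/-! ### Extension of invariants to `K̄₀`, and sums over irreducible representations. -/

section GrothendieckGroup

/-- The extension of an additive isomorphism invariant of objects to the Grothendieck group. -/
def K0.liftObj {A : Type u} [Category.{v} A] [Preadditive A] [HasZeroObject A]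
    [HasBinaryBiproducts A] {B : Type*} [AddCommGroup B] (f : A → B)
    (hiso : ∀ {X Y : A}, (X ≅ Y) → f X = f Y) (hadd : ∀ X Y : A, f (X ⊞ Y) = f X + f Y) :
    K0 A →+ B :=
  have hmk : ∀ a b : IsoClass A, Quotient.lift (s := isIsomorphicSetoid A) f
      (fun _ _ ⟨e⟩ => hiso e) (a + b) = Quotient.lift (s := isIsomorphicSetoid A) f
      (fun _ _ ⟨e⟩ => hiso e) a + Quotient.lift (s := isIsomorphicSetoid A) f
      (fun _ _ ⟨e⟩ => hiso e) b := fun a b => by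
    induction a using IsoClass.ind with | _ X
    induction b using IsoClass.ind with | _ Y
    exact hadd X Y
  K0.lift
    { toFun := Quotient.lift (s := isIsomorphicSetoid A) f (fun _ _ ⟨e⟩ => hiso e)
      map_zero' := by
        -- Additivity alone gives `f(0) = f(0) + f(0)`, and the target is a group.
        have h := hmk 0 0
        rw [add_zero] at h
        exact left_eq_add.1 h
      map_add' := hmk }

/-- The additive group of the ring `K̄₀` is the Grothendieck group. -/
theorem K0.addCommGroup_eq {T : Type u} [Category.{v} T] [Preadditive T] [HasZeroObject T]
    [HasBinaryBiproducts T] [MonoidalCategory T] [SymmetricCategory T] [MonoidalPreadditive T] :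
    (instAddCommGroupK0 : AddCommGroup (K0 T)) = NonUnitalNonAssocRing.toAddCommGroup :=
  AddCommGroup.ext rfl

/-- The ring instance carries its own integer multiples, `zsmulRec`, which are only propositionally
those of the Grothendieck group. The statement names the latter explicitly because the idempotent
calculus produces them. -/
theorem K0.zsmul_eq_mul {T : Type u} [Category.{v} T] [Preadditive T] [HasZeroObject T]
    [HasBinaryBiproducts T] [MonoidalCategory T] [SymmetricCategory T] [MonoidalPreadditive T]
    (n : ℤ) (x : K0 T) : @HSMul.hSMul ℤ (K0 T) (K0 T) (@instHSMul ℤ (K0 T)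
      (@ZSMul.toSMul (K0 T) instAddCommGroupK0.toZSMul)) n x = n * x := by
  rw [K0.addCommGroup_eq]
  exact _root_.zsmul_eq_mul x n

/-- The sum `∑ φ(V_λ) [S_λ(V)]` over the irreducible rational representations of `G`. -/
def schurSum {A : Type u} [Category.{v} A] [Preadditive A] [Linear ℚ A] [HasZeroObject A]
    [HasBinaryBiproducts A] [IsIdempotentComplete A] {G : Type} [Group G] [Fintype G]
    [Fintype (Irrep G)] (φ : RepRing G →+ ℤ) (V : Action A G) : K0 A :=
  ∑ c : Irrep G, φ (K0.of c.rep) • idemClass (groupAlgebraAct V c.idem)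

end GrothendieckGroup

/-! ### The pre-lambda structure of symmetric powers and its uniqueness. -/

section PowerSeriesClasses

variable {T : Type u} [Category.{v} T] [Preadditive T] [Linear ℚ T] [HasZeroObject T]
  [HasBinaryBiproducts T] [IsIdempotentComplete T] [MonoidalCategory T] [SymmetricCategory T]
  [MonoidalPreadditive T]

theorem selfIdem_of_subsingleton {G : Type} [Group G] [Fintype G] [Subsingleton G] (ε : G →* ℤˣ) :
    selfIdem ε = 1 := by
  have h : ∀ g : G, unitRat (ε g) • MonoidAlgebra.of ℚ G (MonoidHom.id G g) = 1 := fun g => by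
    rw [Subsingleton.elim g 1, map_one, map_one, map_one, map_one, one_smul]
  rw [selfIdem, charIdem, Finset.sum_congr rfl fun g _ => h g, Finset.sum_const, Finset.card_univ,
    ← Nat.cast_smul_eq_nsmul ℚ, smul_smul, inv_mul_cancel₀ (by simp), one_smul]

theorem idemClass_powAct_one (V : T) (n : ℕ) :
    idemClass (powAct V n 1) = K0.of (tensorPow V n) := by
  rw [map_one]
  exact idemClass_id _

theorem symClass_zero (V : T) : symClass V 0 = 1 := by
  rw [symClass, selfIdem_of_subsingleton, idemClass_powAct_one]
  rfl

theorem altClass_zero (V : T) : altClass V 0 = 1 := by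
  rw [altClass, selfIdem_of_subsingleton, idemClass_powAct_one]
  rfl

theorem symClass_one (V : T) : symClass V 1 = K0.of V := by
  rw [symClass, selfIdem_of_subsingleton, idemClass_powAct_one]
  exact K0.of_iso (ρ_ V)

theorem altClass_one (V : T) : altClass V 1 = K0.of V := by
  rw [altClass, selfIdem_of_subsingleton, idemClass_powAct_one]
  exact K0.of_iso (ρ_ V)

theorem K0.of_invariants (V : T) (n : ℕ) : K0.of (invariants (tensorPowAction V n)) =
    symClass V n := by
  rw [invariants, ← idemClass_groupAlgebraAct, symClass, powAct]
  exact congrArg (fun x => idemClass (groupAlgebraAct (tensorPowAction V n) x))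
    (symIdem_eq_charIdem _)

variable [MonoidalLinear ℚ T]

/-- An isomorphism is a retraction whose projector is the identity. -/
theorem symClass_of_iso {V W : T} (e : V ≅ W) (n : ℕ) : symClass V n = symClass W n := by
  have h := (idemClass_symmetrizer_retract e.hom e.inv e.hom_inv_id n).2
  rw [← h, symClass, e.inv_hom_id, tensorMap_id]
  exact congrArg idemClass (Category.comp_id _)

/-- The series `∑ [Symⁿ V] tⁿ`. -/
def symSeries (V : T) : PowerSeries (K0 T) := PowerSeries.mk (symClass V)

/-- The series `∑ (-1)ⁿ [Λⁿ V] tⁿ`. -/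
def altSeries (V : T) : PowerSeries (K0 T) := PowerSeries.mk fun n => (-1) ^ n * altClass V n

theorem idemClass_splitIdem (V : T) {n k : ℕ} (hk : k ≤ n) :
    idemClass (powAct V n (splitIdem (lastSet n k))) = symClass V (n - k) * altClass V k := by
  obtain ⟨a, rfl⟩ := Nat.exists_eq_add_of_le hk
  rw [Nat.add_sub_cancel_left]
  exact idemClass_powAct_splitIdem V a k

theorem isIdemAdditive_powAct (V : T) (n : ℕ) :
    IsIdemAdditive fun x => idemClass (powAct V n x) :=
  (isIdemAdditive_idemClass (tensorPow V n)).comp (powAct V n).toRingHom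

/-- The Koszul relation: in positive degree this is the vanishing alternating sum of the split
idempotents. -/
theorem altSeries_mul_symSeries (V : T) : altSeries V * symSeries V = 1 := by
  ext n
  rw [PowerSeries.coeff_mul, Finset.Nat.sum_antidiagonal_eq_sum_range_succ_mk,
    PowerSeries.coeff_one]
  simp only [altSeries, symSeries, PowerSeries.coeff_mk]
  rcases n with _ | n
  · simp [symClass_zero, altClass_zero]
  · have h := (isIdemAdditive_powAct V (n + 1)).sum_splitIdem (B := lastSet (n + 1))
      fun k hk => card_lastSet (hk.trans_eq (Fintype.card_fin _))
    rw [Fintype.card_fin] at h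
    rw [if_neg (Nat.succ_ne_zero n), ← h]
    refine Finset.sum_congr rfl fun k hk => ?_
    rw [idemClass_splitIdem V (Nat.lt_succ_iff.1 (Finset.mem_range.1 hk)), K0.zsmul_eq_mul]
    push_cast
    ring

theorem symSeries_biprod (V W : T) : symSeries (V ⊞ W) = symSeries V * symSeries W := by
  ext n
  rw [mul_comm, PowerSeries.coeff_mul, Finset.Nat.sum_antidiagonal_eq_sum_range_succ_mk]
  simp only [symSeries, PowerSeries.coeff_mk, symClass_biprod]
  exact Finset.sum_congr rfl fun k _ => mul_comm _ _

/-- The series `∑ [Symⁿ V] tⁿ` as a unit. -/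
def symUnit (V : T) : (PowerSeries (K0 T))ˣ where
  val := symSeries V
  inv := altSeries V
  val_inv := by rw [mul_comm, altSeries_mul_symSeries]
  inv_val := altSeries_mul_symSeries V

variable (T) in
/-- The homomorphism `[V] ↦ ∑ [Symⁿ V] tⁿ`. -/
def symHom : K0 T →+ Additive (PowerSeries (K0 T))ˣ :=
  K0.liftObj (fun V => Additive.ofMul (symUnit V))
    (fun e => congrArg Additive.ofMul (Units.ext (congrArg PowerSeries.mk
      (funext (symClass_of_iso e)))))
    (fun V W => congrArg Additive.ofMul (Units.ext (symSeries_biprod V W)))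

theorem symHom_of (V : T) : symHom T (K0.of V) = Additive.ofMul (symUnit V) :=
  K0.lift_ofClass _ _

theorem K0.exists_eq_sub (x : K0 T) : ∃ V W : T, x = K0.of V - K0.of W := by
  induction x using K0.induction with | _ a b
  induction a using IsoClass.ind with | _ V
  induction b using IsoClass.ind with | _ W
  exact ⟨V, W, rfl⟩

theorem symHom_sub (V W : T) : ((symHom T (K0.of V - K0.of W)).toMul : PowerSeries (K0 T)) =
    symSeries V * altSeries W := by
  rw [map_sub, symHom_of, symHom_of]
  rfl

variable (T) in
/-- The pre-lambda structure given by symmetric powers. -/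
def symPreLambda : PreLambda (K0 T) where
  series a := ((symHom T a).toMul : PowerSeries (K0 T))
  series_zero := by rw [map_zero]; rfl
  series_add a b := by rw [map_add]; rfl
  coeff_zero a := by
    obtain ⟨V, W, rfl⟩ := K0.exists_eq_sub a
    rw [symHom_sub]
    simp [PowerSeries.coeff_mul, symSeries, altSeries, symClass_zero, altClass_zero]
  coeff_one a := by
    obtain ⟨V, W, rfl⟩ := K0.exists_eq_sub a
    rw [symHom_sub]
    simp [PowerSeries.coeff_mul, symSeries, altSeries, symClass_zero, altClass_zero, symClass_one,
      altClass_one, Finset.Nat.sum_antidiagonal_eq_sum_range_succ_mk, Finset.sum_range_succ]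
    abel

theorem isSymmetricPowers_symPreLambda : IsSymmetricPowers (symPreLambda T) := by
  intro V n _
  rw [K0.of_invariants]
  change PowerSeries.coeff n ((symHom T (K0.of V)).toMul : PowerSeries (K0 T)) = _
  rw [symHom_of]
  exact PowerSeries.coeff_mk n (symClass V)

theorem IsSymmetricPowers.series_of {σ : PreLambda (K0 T)} (h : IsSymmetricPowers σ) (V : T) :
    σ.series (K0.of V) = symSeries V := by
  ext n
  rcases n with _ | n
  · rw [σ.coeff_zero, symSeries, PowerSeries.coeff_mk, symClass_zero]
  · rw [h V _ (Nat.succ_le_succ (Nat.zero_le n)), K0.of_invariants, symSeries, PowerSeries.coeff_mk]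

/-- Multiplicativity on `([V] - [W]) + [W]` and invertibility of the series of `[W]` determine the
series at a difference, hence everywhere. -/
theorem IsSymmetricPowers.series_sub {σ : PreLambda (K0 T)} (h : IsSymmetricPowers σ) (V W : T) :
    σ.series (K0.of V - K0.of W) = symSeries V * altSeries W := by
  have h1 := σ.series_add (K0.of V - K0.of W) (K0.of W)
  rw [sub_add_cancel, h.series_of, h.series_of] at h1
  rw [h1, mul_assoc, mul_comm (symSeries W), altSeries_mul_symSeries, mul_one]

theorem IsSymmetricPowers.eq {σ τ : PreLambda (K0 T)} (hσ : IsSymmetricPowers σ)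
    (hτ : IsSymmetricPowers τ) : σ = τ := by
  have h : σ.series = τ.series := funext fun a => by
    obtain ⟨V, W, rfl⟩ := K0.exists_eq_sub a
    rw [hσ.series_sub, hτ.series_sub]
  cases σ
  cases τ
  cases h
  rfl

end PowerSeriesClasses

/-! ### Newton's formula and the trace of a cycle. -/

section Adams

open PowerSeries

theorem PowerSeries.invOfUnit_eq_of_mul_eq_one {R : Type*} [CommRing R] {f g : PowerSeries R}
    (hf : constantCoeff f = 1) (h : f * g = 1) : invOfUnit f 1 = g :=
  (left_inv_eq_right_inv ((mul_comm _ _).trans h) (mul_invOfUnit f 1 hf)).symm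

variable {T : Type u} [Category.{v} T] [Preadditive T] [Linear ℚ T] [HasZeroObject T]
  [HasBinaryBiproducts T] [IsIdempotentComplete T] [MonoidalCategory T] [SymmetricCategory T]
  [MonoidalPreadditive T] [MonoidalLinear ℚ T]

theorem IsSymmetricPowers.opp_of {σ : PreLambda (K0 T)} (h : IsSymmetricPowers σ) (V : T) :
    σ.opp (K0.of V) = rescale (-1) (altSeries V) := by
  rw [PreLambda.opp, h.series_of]
  refine PowerSeries.invOfUnit_eq_of_mul_eq_one ?_ ?_
  · rw [← coeff_zero_eq_constantCoeff_apply, coeff_rescale, symSeries, coeff_mk, symClass_zero]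
    simp
  · rw [← map_mul, mul_comm, altSeries_mul_symSeries, map_one]

/-- Here `λ_t = ∑ [Λ^k V] t^k` and `λ_t⁻¹ = ∑ (-1)^i [Sym^i V] t^i`, so the formula is the
coefficient of `t^{r-1}` in `λ_t⁻¹ λ_t'`. -/
theorem IsSymmetricPowers.adams_of {σ : PreLambda (K0 T)} (h : IsSymmetricPowers σ) (V : T)
    {r : ℕ} (hr : 1 ≤ r) : σ.adams r (K0.of V) = -∑ k ∈ Finset.range (r + 1),
      (((k : ℤ) * (-1) ^ k : ℤ) : K0 T) * (symClass V (r - k) * altClass V k) := by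
  obtain ⟨m, rfl⟩ : ∃ m, r = m + 1 := ⟨r - 1, by omega⟩
  have hinv : invOfUnit (σ.opp (K0.of V)) 1 = rescale (-1) (symSeries V) := by
    rw [h.opp_of]
    refine PowerSeries.invOfUnit_eq_of_mul_eq_one ?_ ?_
    · rw [← coeff_zero_eq_constantCoeff_apply, coeff_rescale, altSeries, coeff_mk, altClass_zero]
      simp
    · rw [← map_mul, altSeries_mul_symSeries, map_one]
  -- The term `k = 0` on the right has weight zero; removing it aligns `k = j + 1` with the degree
  -- shift of the derivative.
  rw [PreLambda.adams, hinv, h.opp_of, mul_comm (rescale (-1) _), Nat.add_sub_cancel, coeff_mul,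
    Finset.Nat.sum_antidiagonal_eq_sum_range_succ_mk, Finset.sum_range_succ' _ (m + 1)]
  simp only [coeff_derivative, coeff_rescale, symSeries, altSeries, coeff_mk, Nat.cast_zero,
    zero_mul, Int.cast_zero, add_zero]
  rw [Finset.mul_sum, ← Finset.sum_neg_distrib]
  refine Finset.sum_congr rfl fun j hj => ?_
  obtain ⟨i, rfl⟩ := Nat.exists_eq_add_of_le (Nat.lt_succ_iff.1 (Finset.mem_range.1 hj))
  rw [Nat.add_sub_cancel_left, show j + i + 1 - (j + 1) = i by omega]
  have h1 : ((-1 : K0 T) ^ i) * (-1) ^ i = 1 := by rw [← mul_pow]; simp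
  have h2 : ((-1 : K0 T) ^ j) * (-1) ^ j = 1 := by rw [← mul_pow]; simp
  push_cast
  rw [pow_add, pow_succ]
  linear_combination ((-1 : K0 T) ^ j * (-1) ^ j * (-1) ^ j * (j + 1) * symClass V i *
    altClass V (j + 1)) * h1 + ((-1 : K0 T) ^ j * (j + 1) * symClass V i *
    altClass V (j + 1)) * h2

/-- The Adams operations of symmetric powers are given by the trace of a cycle. -/
theorem IsSymmetricPowers.adams_eq_sum_tr {σ : PreLambda (K0 T)} (h : IsSymmetricPowers σ) (V : T)
    {r : ℕ} (hr : 1 ≤ r) [Fintype (Irrep (Equiv.Perm (Fin r)))] {g : Equiv.Perm (Fin r)}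
    (hg : g.IsCycleOn Set.univ) : σ.adams r (K0.of V) =
      schurSum (tr g) (tensorPowAction V r) := by
  have : Nonempty (Fin r) := ⟨⟨0, hr⟩⟩
  have h1 := (isIdemAdditive_powAct V r).sum_tr_smul (B := lastSet r)
    (fun k hk => card_lastSet (hk.trans_eq (Fintype.card_fin _))) (fun k _ => lastSet_subset r k) hg
  rw [Fintype.card_fin] at h1
  refine Eq.trans ?_ h1.symm
  rw [h.adams_of V hr]
  refine congrArg Neg.neg (Finset.sum_congr rfl fun k hk => ?_)
  rw [K0.zsmul_eq_mul, idemClass_splitIdem V (Nat.lt_succ_iff.1 (Finset.mem_range.1 hk))]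

end Adams

/-! ### Compatibility of Schur functors with push-forward, and the comparison at the point. -/

section PushForward

variable {A : Type u} [Category.{v} A] [Preadditive A] [Linear ℚ A] [HasZeroObject A]
  [HasBinaryBiproducts A] [IsIdempotentComplete A]

theorem idTensor_tmul {K R : Type*} [AddCommGroup K] [AddCommGroup R] (φ : R →+ ℤ) (x : K) (y : R) :
    idTensor φ (x ⊗ₜ[ℤ] y) = φ y • x := by
  simp [idTensor]

theorem idTensor_decomp {n : ℕ} [Fintype (Irrep (Equiv.Perm (Fin n)))]
    (φ : RepRing (Equiv.Perm (Fin n)) →+ ℤ) (V : Action A (Equiv.Perm (Fin n))) :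
    idTensor φ (decomp A n (K0.of V)) = schurSum φ V := by
  have h : decomp A n (K0.of V) = ∑ c : Irrep (Equiv.Perm (Fin n)),
      idemClass (groupAlgebraAct V c.idem) ⊗ₜ[ℤ] K0.of c.rep := by
    rw [decomp, AddMonoidHom.finsetSum_apply]
    -- `decomp` sums with its own `Fintype` instance, so the two sums are matched by the identity
    -- bijection.
    refine Finset.sum_bij (fun c _ => c) (by simp) (by simp) (by simp) fun c _ => ?_
    rw [idemClass_groupAlgebraAct _ c.isIdempotentElem_idem, ← K0.map_of]
    rfl
  rw [h, map_sum]
  exact Finset.sum_congr rfl fun c _ => idTensor_tmul _ _ _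

theorem idemClass_act_of_iso {G : Type} [Group G] {V W : Action A G} (f : V ≅ W)
    {e : MonoidAlgebra ℚ G} (he : IsIdempotentElem e) :
    idemClass (groupAlgebraAct V e) = idemClass (groupAlgebraAct W e) :=
  idemClass_conj ((map_mul (groupAlgebraAct V) e e).symm.trans (congrArg _ he))
    ((Action.forget A G).mapIso f) (groupAlgebraAct_natural f.hom e)

/-- An additive functor between `ℚ`-linear categories is `ℚ`-linear, so it respects the action of
the whole group algebra. -/
theorem map_groupAlgebraAct {B : Type u₁} [Category.{v₁} B] [Preadditive B] [Linear ℚ B]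
    (F : A ⥤ B) [F.Additive] {G : Type} [Group G] (V : Action A G) (x : MonoidAlgebra ℚ G) :
    F.map (groupAlgebraAct V x : V.V ⟶ V.V) = groupAlgebraAct ((F.mapAction G).obj V) x := by
  induction x using MonoidAlgebra.induction_on with
  | of g => rw [groupAlgebraAct_of, groupAlgebraAct_of]; rfl
  | add x y hx hy =>
    rw [map_add, map_add, ← hx, ← hy]
    exact F.map_add
  | smul r x hx =>
    rw [map_smul, map_smul, ← hx]
    exact F.map_smul _ _

theorem schurSum_of_iso {G : Type} [Group G] [Fintype G] [Fintype (Irrep G)] (φ : RepRing G →+ ℤ)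
    {V W : Action A G} (f : V ≅ W) : schurSum φ V = schurSum φ W :=
  Finset.sum_congr rfl fun c _ => by rw [idemClass_act_of_iso f c.isIdempotentElem_idem]

theorem map_schurSum {B : Type u₁} [Category.{v₁} B] [Preadditive B] [Linear ℚ B]
    [HasZeroObject B] [HasBinaryBiproducts B] [IsIdempotentComplete B] (F : A ⥤ B) [F.Additive]
    {G : Type} [Group G] [Fintype G] [Fintype (Irrep G)] (φ : RepRing G →+ ℤ) (V : Action A G) :
    K0.map F (schurSum φ V) = schurSum φ ((F.mapAction G).obj V) := by
  rw [schurSum, map_sum]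
  refine Finset.sum_congr rfl fun c _ => ?_
  rw [map_zsmul, K0.map_idemClass _ ((map_mul (groupAlgebraAct V) _ _).symm.trans
    (congrArg _ c.isIdempotentElem_idem)), map_groupAlgebraAct]
  rfl

variable {C : Type u₁} [Category.{v₁} C] (F : Pseudofunctor (LocallyDiscrete C) Cat.{v, u})

/-- Push-forward of equivariant objects is functorial. -/
def pushActionComp {G : Type} [Group G] {X Y Z : C} {ρ : G →* End X} {M : Fib F X}
    (E : EquivariantStructure F ρ M) (p : X ⟶ Y) (hp : ∀ g, (ρ g : X ⟶ X) ≫ p = p) (k : Y ⟶ Z)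
    (q : X ⟶ Z) (hq : ∀ g, (ρ g : X ⟶ X) ≫ q = q) (hpk : p ≫ k = q) :
    pushAction F E q hq ≅ ((push F k).mapAction G).obj (pushAction F E p hp) :=
  Action.mkIso ((pushComp F p k q hpk).app M) fun g => by
    -- Equivariance follows from associativity of the composition isomorphisms for `ρ g`, `p`, `k`
    -- together with their naturality in `φ_g`.
    have h1 := pushComp_assoc F (ρ g) p k p q q (hp g) hpk hpk (hq g) M
    have h2 := (pushComp F p k q hpk).hom.naturality (E.iso g).hom
    change ((pushComp F (ρ g) q q (hq g)).hom.app M ≫ (push F q).map (E.iso g).hom) ≫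
      (pushComp F p k q hpk).hom.app M = (pushComp F p k q hpk).hom.app M ≫
        (push F k).map ((pushComp F (ρ g) p p (hp g)).hom.app M ≫ (push F p).map (E.iso g).hom)
    rw [Functor.map_comp, reassoc_of% h1, Category.assoc, h2]
    rfl

end PushForward

/-- The Schur sum commutes with the additive functor `k_*`. The resulting equivariant object is the
push-forward of `M^{⊠ r}` to the point, which Künneth identifies with `(k_* M)^{⊗ r}`. The element
`g` is arbitrary here; that it is an `r`-cycle matters only for the Adams side. -/
theorem CoefficientTheory.map_adamsCoeff {C : Type u₁} [Category.{v₁} C] [HasFiniteProducts C]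
    [HasSymmetricProducts C] (A : CoefficientTheory.{v, u} C) {X : C} (M : A.Coeff X) (r : ℕ)
    [Fintype (Irrep (Equiv.Perm (Fin r)))] (g : Equiv.Perm (Fin r)) :
    K0.map (A.toPt (symProd X r)) (A.adamsCoeff r g M) =
      schurSum (tr g) (tensorPowAction ((A.toPt X).obj M) r) := by
  obtain ⟨f⟩ := A.kunneth X r M
  rw [CoefficientTheory.adamsCoeff, CoefficientTheory.operation, idTensor_decomp, map_schurSum]
  exact (schurSum_of_iso (tr g) (pushActionComp A.F (A.boxEquivariant X r M)
    (symProj X r) (perm_symProj X r) (terminal.from _) (terminal.from _)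
    (fun _ => Subsingleton.elim _ _) (Subsingleton.elim _ _))).symm.trans
    (schurSum_of_iso (tr g) f)

end SymProd

end

theorem proposition3p3 {C : Type u₁} [Category.{v₁} C] [HasFiniteProducts C]
    [HasSymmetricProducts C] (A : CoefficientTheory.{v, u} C) :
    (∃! σ : PreLambda (K0 (A.Coeff (⊤_ C))), IsSymmetricPowers σ) ∧
    ∀ σ : PreLambda (K0 (A.Coeff (⊤_ C))), IsSymmetricPowers σ →
      ∀ (X : C) (M : A.Coeff X) (r : ℕ), 1 ≤ r →
        ∀ g : Equiv.Perm (Fin r), g.IsCycleOn Set.univ →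
          σ.adams r (K0.of ((A.toPt X).obj M)) =
            K0.map (A.toPt (symProd X r)) (A.adamsCoeff r g M) := by
  refine ⟨⟨symPreLambda _, isSymmetricPowers_symPreLambda, fun σ hσ =>
    hσ.eq isSymmetricPowers_symPreLambda⟩, fun σ hσ X M r hr g hg => ?_⟩
  have := Fintype.ofFinite (Irrep (Equiv.Perm (Fin r)))
  rw [A.map_adamsCoeff, hσ.adams_eq_sum_tr _ hr hg]
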